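/- **Proposition 2 (Causal classification of Lorentzian tetrahedra).** Let $\mathbb R^{1,2}$ be Minkowski space with $\langle x,y\rangle=-x_0y_0+x_1y_1+x_2y_2$. A point $x$ is timelike, lightlike or spacelike if $\langle x,x\rangle<0$, $=0$ or $>0$; the two lightcones $L_+,L_-$ consist of the lightlike points with $x_0>0$ resp. $x_0<0$, and the future and past timelike regions $I_+,I_-$ of the timelike points with $x_0>0$ resp. $x_0<0$. Consider the tetrahedra $\Delta(v_0v_1v_2v_3)\subset\mathbb R^{1,2}$ with affinely independent vertices, $v_0=0$, no null edges, and no null triangular faces (the inner product is nondegenerate on the direction plane of each of the four faces). Let $T=\Delta(v_1v_2v_3)$ be the triangle opposite to $v_0$. The *causal structure at $v_0$* is the decomposition of $T$ into $T\cap I_\pm$, $T\cap L_\pm$ and the spacelike part; two tetrahedra have the same causal structure at $v_0$ if, after a permutation of $v_1,v_2,v_3$ and possibly an exchange of future and past, there is a homeomorphism between their opposite triangles that maps vertices to corresponding vertices, edges to corresponding edges, and each of these five parts to the corresponding part. 1. The causal structure at $v_0$ is determined by the causal positions of the vertices and the intersection pattern. For every fixed permutation of the labels and every fixed choice whether future and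 past are exchanged, a homeomorphism of this kind between the opposite triangles of two such tetrahedra exists if and only if, under that correspondence, the vertices $v_1,v_2,v_3$ have the same causal positions (in $I_+$, in $I_-$, or spacelike), and the same lightcones meet corresponding open edges and the open triangle. 2. There are exactly 13 causal structures at $v_0$. They are the following types: every tetrahedron considered is of exactly one of them, for a suitable naming of $v_1,v_2,v_3$ and a suitable choice of $\{\varepsilon,-\varepsilon\}=\{+,-\}$; each of them occurs; and two tetrahedra have the same causal structure at $v_0$ if and only if they are of the same type. Below, "$T$: …" lists all lightcones that meet $T$, and "$ij$: …" all lightcones that meet the open edge between $v_i$ and $v_j$. - A1: $v_1,v_2,v_3\in I_\varepsilon$; $T$: none. - A2: $v_1,v_2\in I_\varepsilon$, $v_3\in I_{-\varepsilon}$; $T$: both; $12$: none; $13$: both; $23$: both. - B1: $v_1,v_2\in I_\varepsilon$, $v_3$ spacelike; $T$: $L_\varepsilon$; $12$: none; $13$: $L_\varepsilon$; $23$: $L_\varepsilon$. - B2: $v_1\in I_\varepsilon$, $v_2\in I_{-\varepsilon}$, $v_3$ spacelike; $T$: both; $12$: both; $13$: $L_\varepsilon$; $23$: $L_{-\varepsilon}$.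 - C1, C2, C3: $v_1\in I_\varepsilon$, $v_2,v_3$ spacelike; $12$: $L_\varepsilon$; $13$: $L_\varepsilon$; and for C1: $T$: $L_\varepsilon$, $23$: none; for C2: $T$: $L_\varepsilon$, $23$: $L_\varepsilon$, in exactly two points; for C3: $T$: both, $23$: $L_{-\varepsilon}$. - D1–D6: $v_1,v_2,v_3$ spacelike; and for D1: $T$: none; for D2: $T$: $L_\varepsilon$, which meets the open triangle, and no lightcone meets an edge; for D3: $T$: $L_\varepsilon$; $12$: none; $13$: none; $23$: $L_\varepsilon$; for D4: $T$: $L_\varepsilon$; $12$: none; $13$: $L_\varepsilon$; $23$: $L_\varepsilon$; for D5: $T$: $L_\varepsilon$; $12$, $13$, $23$: $L_\varepsilon$; for D6: $T$: both; $12$: $L_\varepsilon$; $13$: $L_{-\varepsilon}$; $23$: none. -/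

import Mathlib

noncomputable section

namespace LorentzCausal

/-- Points and vectors of `ℝ^{1,2}`; the coordinate with index `0` is time. -/
abbrev Minkowski : Type := Fin 3 → ℝ

/-- The Minkowski inner product, of signature `(-,+,+)`. -/
def mink (x y : Minkowski) : ℝ := -(x 0 * y 0) + x 1 * y 1 + x 2 * y 2

/-- The open future (`ε = 1`) or past (`ε = -1`) timelike region of the origin. -/
def timelike (ε : ℤˣ) : Set Minkowski := {x | mink x x < 0 ∧ 0 < ((ε : ℤ) : ℝ) * x 0}

/-- The future (`ε = 1`) or past (`ε = -1`) lightcone of the origin, without its apex. -/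
def lightcone (ε : ℤˣ) : Set Minkowski := {x | mink x x = 0 ∧ 0 < ((ε : ℤ) : ℝ) * x 0}

/-- The spacelike region of the origin. -/
def spacelike : Set Minkowski := {x | 0 < mink x x}

/-- A linear subspace is null if the Minkowski inner product is degenerate on it. -/
def IsNullSubspace (W : Submodule ℝ Minkowski) : Prop :=
  ∃ w ∈ W, w ≠ 0 ∧ ∀ u ∈ W, mink w u = 0

/-- A nondegenerate tetrahedron in Minkowski space with reference vertex `vertex 0` at the origin,
none of whose six edges and none of whose four triangular faces is null. -/
structure Tetrahedron where
  vertex : Fin 4 → Minkowski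
  affineIndependent : AffineIndependent ℝ vertex
  vertex_zero : vertex 0 = 0
  edge_not_null : ∀ i j, i ≠ j → mink (vertex i - vertex j) (vertex i - vertex j) ≠ 0
  face_not_null : ∀ s : Finset (Fin 4), s.card = 3 →
    ¬ IsNullSubspace (vectorSpan ℝ (vertex '' (s : Set (Fin 4))))

namespace Tetrahedron

/-- The three vertices `v₁, v₂, v₃` opposite to the reference vertex, indexed by `0, 1, 2`. -/
def v (t : Tetrahedron) (i : Fin 3) : Minkowski := t.vertex i.succ

/-- The closed face of the opposite triangle with vertex set `s`. -/
def face (t : Tetrahedron) (s : Set (Fin 3)) : Set Minkowski := convexHull ℝ (t.v '' s)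

/-- The closed triangle opposite to the reference vertex. -/
def triangle (t : Tetrahedron) : Set Minkowski := t.face Set.univ

/-- The relative interior of the opposite triangle, in barycentric coordinates. -/
def openTriangle (t : Tetrahedron) : Set Minkowski :=
  {x | ∃ a : Fin 3 → ℝ, (∀ i, 0 < a i) ∧ ∑ i, a i = 1 ∧ ∑ i, a i • t.v i = x}

/-- The lightcones (future, past) that meet the open edge between `t.v i` and `t.v j`. -/
def edgeCones (t : Tetrahedron) (i j : Fin 3) : Set ℤˣ :=
  {ε | (openSegment ℝ (t.v i) (t.v j) ∩ lightcone ε).Nonempty}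

/-- The lightcones that meet the relative interior of the opposite triangle. -/
def interiorCones (t : Tetrahedron) : Set ℤˣ := {ε | (t.openTriangle ∩ lightcone ε).Nonempty}

/-- The lightcones that meet the closed opposite triangle. -/
def cones (t : Tetrahedron) : Set ℤˣ := {ε | (t.triangle ∩ lightcone ε).Nonempty}

/-- Up to the relabelling `σ` of the three vertices and the time orientation `δ` (`δ = -1`
exchanges future and past), the vertices of the two opposite triangles have the same causal
positions, and the two lightcones meet the same open edges and the same open triangle. -/
structure SamePattern (σ : Equiv.Perm (Fin 3)) (δ : ℤˣ) (t t' : Tetrahedron) : Prop where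
  timelike_iff : ∀ i ε, t.v i ∈ timelike ε ↔ t'.v (σ i) ∈ timelike (δ * ε)
  spacelike_iff : ∀ i, t.v i ∈ spacelike ↔ t'.v (σ i) ∈ spacelike
  edge_iff : ∀ i j, i ≠ j → ∀ ε, ε ∈ t.edgeCones i j ↔ δ * ε ∈ t'.edgeCones (σ i) (σ j)
  interior_iff : ∀ ε, ε ∈ t.interiorCones ↔ δ * ε ∈ t'.interiorCones

/-- The decompositions of the two opposite triangles into timelike, spacelike and lightlike points
agree up to the relabelling `σ` and the time orientation `δ`: there is a homeomorphism of the
triangles that respects vertices, edges and the causal character of every point. -/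
def SameStructureVia (σ : Equiv.Perm (Fin 3)) (δ : ℤˣ) (t t' : Tetrahedron) : Prop :=
  ∃ h : t.triangle ≃ₜ t'.triangle,
    (∀ (s : Set (Fin 3)) (x : t.triangle), (x : Minkowski) ∈ t.face s ↔
      (h x : Minkowski) ∈ t'.face (σ '' s)) ∧
    (∀ ε (x : t.triangle), (x : Minkowski) ∈ timelike ε ↔ (h x : Minkowski) ∈ timelike (δ * ε)) ∧
    (∀ ε (x : t.triangle), (x : Minkowski) ∈ lightcone ε ↔ (h x : Minkowski) ∈ lightcone (δ * ε)) ∧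
    (∀ x : t.triangle, (x : Minkowski) ∈ spacelike ↔ (h x : Minkowski) ∈ spacelike)

/-- The two tetrahedra have the same causal structure at the reference vertex. -/
def SameStructure (t t' : Tetrahedron) : Prop := ∃ σ δ, SameStructureVia σ δ t t'

theorem SameStructureVia.refl (t : Tetrahedron) : SameStructureVia 1 1 t t :=
  ⟨Homeomorph.refl _, by simp, by simp, by simp, by simp⟩

theorem SameStructureVia.symm {σ : Equiv.Perm (Fin 3)} {δ : ℤˣ} {t t' : Tetrahedron}
    (H : SameStructureVia σ δ t t') : SameStructureVia σ.symm δ t' t := by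
  obtain ⟨h, h1, h2, h3, h4⟩ := H
  have hδ : ∀ ε : ℤˣ, δ * (δ * ε) = ε := fun ε => by
    rw [← mul_assoc, Int.units_mul_self, one_mul]
  refine ⟨h.symm, fun s x => ?_, fun ε x => ?_, fun ε x => ?_, fun x => ?_⟩
  · have := h1 (σ.symm '' s) (h.symm x)
    rw [← Set.image_comp] at this
    simpa using this.symm
  · simpa [hδ] using (h2 (δ * ε) (h.symm x)).symm
  · simpa [hδ] using (h3 (δ * ε) (h.symm x)).symm
  · simpa using (h4 (h.symm x)).symm

theorem SameStructureVia.trans {σ σ' : Equiv.Perm (Fin 3)} {δ δ' : ℤˣ} {t t' t'' : Tetrahedron}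
    (H : SameStructureVia σ δ t t') (H' : SameStructureVia σ' δ' t' t'') :
    SameStructureVia (σ' * σ) (δ' * δ) t t'' := by
  obtain ⟨h, h1, h2, h3, h4⟩ := H
  obtain ⟨k, k1, k2, k3, k4⟩ := H'
  refine ⟨h.trans k, fun s x => ?_, fun ε x => ?_, fun ε x => ?_, fun x => ?_⟩
  · rw [h1, k1, ← Set.image_comp]
    rfl
  · rw [h2, k2, mul_assoc]
    rfl
  · rw [h3, k3, mul_assoc]
    rfl
  · rw [h4, k4]
    rfl

/-- Having the same causal structure at the reference vertex, as an equivalence relation. -/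
def structureSetoid : Setoid Tetrahedron where
  r := SameStructure
  iseqv :=
    { refl := fun t => ⟨1, 1, SameStructureVia.refl t⟩
      symm := fun ⟨σ, δ, H⟩ => ⟨σ.symm, δ, H.symm⟩
      trans := fun ⟨σ, δ, H⟩ ⟨σ', δ', H'⟩ => ⟨σ' * σ, δ' * δ, H.trans H'⟩ }

end Tetrahedron

/-- The names of the vertex causal types. -/
inductive VertexCausalType
  | A1 | A2 | B1 | B2 | C1 | C2 | C3 | D1 | D2 | D3 | D4 | D5 | D6

namespace Tetrahedron

/-- The description of each vertex causal type, where the three vertices opposite to the reference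
vertex are called `a, b, c` and `ε` is one of the two time directions. -/
def IsOfTypeWith (t : Tetrahedron) (a b c : Fin 3) (ε : ℤˣ) : VertexCausalType → Prop
  | .A1 => (t.v a ∈ timelike ε ∧ t.v b ∈ timelike ε ∧ t.v c ∈ timelike ε) ∧ t.cones = ∅
  | .A2 => (t.v a ∈ timelike ε ∧ t.v b ∈ timelike ε ∧ t.v c ∈ timelike (-ε)) ∧
      t.cones = {ε, -ε} ∧
      t.edgeCones a b = ∅ ∧ t.edgeCones a c = {ε, -ε} ∧ t.edgeCones b c = {ε, -ε}
  | .B1 => (t.v a ∈ timelike ε ∧ t.v b ∈ timelike ε ∧ t.v c ∈ spacelike) ∧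
      t.cones = {ε} ∧
      t.edgeCones a b = ∅ ∧ t.edgeCones a c = {ε} ∧ t.edgeCones b c = {ε}
  | .B2 => (t.v a ∈ timelike ε ∧ t.v b ∈ timelike (-ε) ∧ t.v c ∈ spacelike) ∧
      t.cones = {ε, -ε} ∧
      t.edgeCones a b = {ε, -ε} ∧ t.edgeCones a c = {ε} ∧ t.edgeCones b c = {-ε}
  | .C1 => (t.v a ∈ timelike ε ∧ t.v b ∈ spacelike ∧ t.v c ∈ spacelike) ∧
      t.cones = {ε} ∧
      t.edgeCones a b = {ε} ∧ t.edgeCones a c = {ε} ∧ t.edgeCones b c = ∅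
  | .C2 => (t.v a ∈ timelike ε ∧ t.v b ∈ spacelike ∧ t.v c ∈ spacelike) ∧
      t.cones = {ε} ∧
      t.edgeCones a b = {ε} ∧ t.edgeCones a c = {ε} ∧ t.edgeCones b c = {ε} ∧
      (openSegment ℝ (t.v b) (t.v c) ∩ lightcone ε).ncard = 2
  | .C3 => (t.v a ∈ timelike ε ∧ t.v b ∈ spacelike ∧ t.v c ∈ spacelike) ∧
      t.cones = {ε, -ε} ∧
      t.edgeCones a b = {ε} ∧ t.edgeCones a c = {ε} ∧ t.edgeCones b c = {-ε}
  | .D1 => (t.v a ∈ spacelike ∧ t.v b ∈ spacelike ∧ t.v c ∈ spacelike) ∧ t.cones = ∅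
  | .D2 => (t.v a ∈ spacelike ∧ t.v b ∈ spacelike ∧ t.v c ∈ spacelike) ∧
      t.cones = {ε} ∧ t.interiorCones = {ε} ∧
      t.edgeCones a b = ∅ ∧ t.edgeCones a c = ∅ ∧ t.edgeCones b c = ∅
  | .D3 => (t.v a ∈ spacelike ∧ t.v b ∈ spacelike ∧ t.v c ∈ spacelike) ∧
      t.cones = {ε} ∧
      t.edgeCones a b = ∅ ∧ t.edgeCones a c = ∅ ∧ t.edgeCones b c = {ε}
  | .D4 => (t.v a ∈ spacelike ∧ t.v b ∈ spacelike ∧ t.v c ∈ spacelike) ∧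
      t.cones = {ε} ∧
      t.edgeCones a b = ∅ ∧ t.edgeCones a c = {ε} ∧ t.edgeCones b c = {ε}
  | .D5 => (t.v a ∈ spacelike ∧ t.v b ∈ spacelike ∧ t.v c ∈ spacelike) ∧
      t.cones = {ε} ∧
      t.edgeCones a b = {ε} ∧ t.edgeCones a c = {ε} ∧ t.edgeCones b c = {ε}
  | .D6 => (t.v a ∈ spacelike ∧ t.v b ∈ spacelike ∧ t.v c ∈ spacelike) ∧
      t.cones = {ε, -ε} ∧
      t.edgeCones a b = {ε} ∧ t.edgeCones a c = {-ε} ∧ t.edgeCones b c = ∅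

/-- The tetrahedron is of type `τ` at the reference vertex, for a suitable naming of the three
other vertices and a suitable choice of the time direction. -/
def IsOfType (t : Tetrahedron) (τ : VertexCausalType) : Prop :=
  ∃ (σ : Equiv.Perm (Fin 3)) (ε : ℤˣ), t.IsOfTypeWith (σ 0) (σ 1) (σ 2) ε τ

end Tetrahedron

end LorentzCausal

end

/-! ### Elementary geometry of the causal cones. -/

namespace LorentzCausal

open Set

/-! Let `p` lie in the timelike region I_ε and let `k • p + b` never vanish. On the line of these
points the form is a quadratic in `k` with two simple roots, and as `k` decreases from infinity the
line runs through I_ε, L_ε, the spacelike region, L_{-ε} and I_{-ε}, in this order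
(`ray_mem_timelike` and its companions). Hence, up to reparametrisation, the causal character along
the segment from `p` to `b` depends only on the character of `b`.

A simplex with a timelike point `p` in its interior is a cone with apex `p` over its boundary. A
homeomorphism between the boundaries of two such simplices that preserves causal characters extends
segment by segment, after each segment is reparametrised so that it crosses the two lightcones at
fixed times (`IsConeOver.exists_extension`). If the interior has no timelike point, then, because no
face is tangent to the lightcone (`IsTransverse`, from the non-null edges and faces), the whole
closed simplex is spacelike and the affine map serves instead. Used for the edges and then for the
triangle, this produces the homeomorphism (`exists_causalMap_edge`, `exists_causalMap_triangle`).
The construction needs to know which open faces meet which timelike region; by transversality this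
amounts to the vertex positions and the lightcones met (`IsTransverse.meetsTimelike_iff`).
Conversely, open edges and the open triangle are expressible through faces, so a homeomorphism that
respects faces and characters preserves the pattern.

The classification rests on convexity of I_ε and on I_{-ε} = -I_ε. An edge meets both timelike
regions only if its ends lie in opposite ones (`endpoints_of_meets_both`); a lightcone that meets
the triangle together with the opposite one is already visible on the edges (`exists_edge_meets`);
and the sign pattern ε, ε, -ε on the edges forces a timelike vertex (`timelike_of_edges`). Only the
listed patterns remain. Three counts separate them (`invariant`, `typeCode_injective`), and integer
vectors realise each. -/

theorem mink_comm (x y : Minkowski) : mink x y = mink y x := by simp only [mink]; ring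

theorem mink_add_left (x y z : Minkowski) : mink (x + y) z = mink x z + mink y z := by
  simp only [mink, Pi.add_apply]; ring

theorem mink_add_right (x y z : Minkowski) : mink x (y + z) = mink x y + mink x z := by
  simp only [mink, Pi.add_apply]; ring

theorem mink_smul_left (c : ℝ) (x y : Minkowski) : mink (c • x) y = c * mink x y := by
  simp only [mink, Pi.smul_apply, smul_eq_mul]; ring

theorem mink_smul_right (c : ℝ) (x y : Minkowski) : mink x (c • y) = c * mink x y := by
  simp only [mink, Pi.smul_apply, smul_eq_mul]; ring

theorem mink_neg_left (x y : Minkowski) : mink (-x) y = -mink x y := by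
  simp only [mink, Pi.neg_apply]; ring

theorem mink_neg_right (x y : Minkowski) : mink x (-y) = -mink x y := by
  simp only [mink, Pi.neg_apply]; ring

@[fun_prop]
theorem continuous_mink {X : Type*} [TopologicalSpace X] {f g : X → Minkowski}
    (hf : Continuous f) (hg : Continuous g) : Continuous fun x => mink (f x) (g x) := by
  unfold mink; fun_prop

theorem isOpen_timelike (ε : ℤˣ) : IsOpen (timelike ε) := by
  have h1 : IsOpen {x : Minkowski | mink x x < 0} :=
    isOpen_lt (continuous_mink continuous_id continuous_id) continuous_const
  have h2 : IsOpen {x : Minkowski | 0 < ((ε : ℤ) : ℝ) * x 0} :=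
    isOpen_lt continuous_const (by fun_prop)
  exact h1.inter h2

theorem units_cast_mul_self (ε : ℤˣ) : ((ε : ℤ) : ℝ) * ((ε : ℤ) : ℝ) = 1 := by
  rcases Int.units_eq_one_or ε with rfl | rfl <;> simp

theorem units_ne_iff {ε η : ℤˣ} : η ≠ ε ↔ η = -ε := by
  rcases Int.units_eq_one_or ε with rfl | rfl <;>
    rcases Int.units_eq_one_or η with rfl | rfl <;> decide

theorem units_eq_or_eq_neg (ε η : ℤˣ) : η = ε ∨ η = -ε := by
  by_cases h : η = ε
  · exact Or.inl h
  · exact Or.inr (units_ne_iff.1 h)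

theorem neg_mem_timelike {ε : ℤˣ} {x : Minkowski} : -x ∈ timelike (-ε) ↔ x ∈ timelike ε := by
  simp [timelike, mink_neg_left, mink_neg_right]

theorem smul_mem_timelike {ε : ℤˣ} {x : Minkowski} {c : ℝ} (hc : 0 < c) :
    c • x ∈ timelike ε ↔ x ∈ timelike ε := by
  have h : ((ε : ℤ) : ℝ) * (c * x 0) = c * (((ε : ℤ) : ℝ) * x 0) := by ring
  have h' : c * (c * mink x x) = c * c * mink x x := by ring
  simp only [timelike, mem_ofPred_eq, mink_smul_left, mink_smul_right, Pi.smul_apply, smul_eq_mul,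
    h, h', mul_pos_iff_of_pos_left hc]
  rw [← neg_pos, ← mul_neg, mul_pos_iff_of_pos_left (mul_pos hc hc), neg_pos]

theorem smul_mem_lightcone {ε : ℤˣ} {x : Minkowski} {c : ℝ} (hc : 0 < c) :
    c • x ∈ lightcone ε ↔ x ∈ lightcone ε := by
  have h : ((ε : ℤ) : ℝ) * (c * x 0) = c * (((ε : ℤ) : ℝ) * x 0) := by ring
  have h' : c * (c * mink x x) = c * c * mink x x := by ring
  simp only [lightcone, mem_ofPred_eq, mink_smul_left, mink_smul_right, Pi.smul_apply, smul_eq_mul,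
    h, h', mul_pos_iff_of_pos_left hc, mul_eq_zero, hc.ne', false_or]

theorem smul_mem_spacelike {x : Minkowski} {c : ℝ} (hc : 0 < c) :
    c • x ∈ spacelike ↔ x ∈ spacelike := by
  simp only [spacelike, mem_ofPred_eq, mink_smul_left, mink_smul_right,
    mul_pos_iff_of_pos_left hc]

theorem mink_neg_of_causal {ε : ℤˣ} {p x : Minkowski} (hp : p ∈ timelike ε) (hx : mink x x ≤ 0)
    (hx0 : 0 < ((ε : ℤ) : ℝ) * x 0) : mink p x < 0 := by
  obtain ⟨h1, h2⟩ := hp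
  have hpx : 0 < p 0 * x 0 := by
    have := mul_pos h2 hx0
    have e := units_cast_mul_self ε
    have : 0 < (((ε : ℤ) : ℝ) * ((ε : ℤ) : ℝ)) * (p 0 * x 0) := by linarith [this]
    simpa [e] using this
  have hx00 : 0 < x 0 ^ 2 := by
    have : x 0 ≠ 0 := by rintro h; simp [h] at hpx
    positivity
  simp only [mink] at *
  -- Euclidean Cauchy–Schwarz for the spatial parts; strict because `p` is timelike and the time
  -- component of `x` is nonzero.
  have key : (p 1 * x 1 + p 2 * x 2) ^ 2 < (p 0 * x 0) ^ 2 := by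
    nlinarith [sq_nonneg (p 1 * x 2 - p 2 * x 1), sq_nonneg (p 1), sq_nonneg (p 2),
      mul_nonneg (add_nonneg (sq_nonneg (p 1)) (sq_nonneg (p 2))) (sub_nonneg.2 hx),
      mul_pos (neg_pos.2 h1) hx00]
  have := abs_lt_of_sq_lt_sq key hpx.le
  linarith [(abs_lt.1 this).2]

/-- The mixed product is negative as well, so each timelike region is a convex cone. The
classification rests on this. -/
theorem add_mem_timelike {ε : ℤˣ} {x y : Minkowski} (hx : x ∈ timelike ε) (hy : y ∈ timelike ε) :
    x + y ∈ timelike ε := by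
  have h := mink_neg_of_causal hx hy.1.le hy.2
  refine ⟨?_, ?_⟩
  · rw [mink_add_left, mink_add_right, mink_add_right, mink_comm y x]
    linarith [hx.1, hy.1]
  · have := add_pos hx.2 hy.2
    simpa [mul_add] using this

theorem timelike_disjoint {ε η : ℤˣ} {x : Minkowski} (hx : x ∈ timelike ε) :
    x ∈ timelike η ↔ η = ε := by
  refine ⟨fun h => ?_, fun h => h ▸ hx⟩
  by_contra hne
  replace hne := units_ne_iff.1 hne
  subst hne
  have h1 := hx.2
  have h2 := h.2
  simp at h2
  linarith

theorem spacelike_not_timelike {ε : ℤˣ} {x : Minkowski} (hx : x ∈ spacelike) :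
    x ∉ timelike ε := fun h => lt_asymm h.1 hx

theorem spacelike_not_lightcone {ε : ℤˣ} {x : Minkowski} (hx : x ∈ spacelike) :
    x ∉ lightcone ε := fun h => hx.ne' h.1

theorem timelike_not_lightcone {ε η : ℤˣ} {x : Minkowski} (hx : x ∈ timelike ε) :
    x ∉ lightcone η := fun h => hx.1.ne h.1

theorem time_ne_zero_of_causal {x : Minkowski} (hx : mink x x ≤ 0) (h0 : x ≠ 0) : x 0 ≠ 0 := by
  intro h
  apply h0
  simp only [mink, h] at hx
  have h1 : x 1 = 0 := by nlinarith [sq_nonneg (x 1), sq_nonneg (x 2)]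
  have h2 : x 2 = 0 := by nlinarith [sq_nonneg (x 1), sq_nonneg (x 2)]
  ext i
  fin_cases i <;> assumption

theorem exists_sign_of_causal {x : Minkowski} (hx : mink x x ≤ 0) (h0 : x ≠ 0) :
    ∃ ε : ℤˣ, 0 < ((ε : ℤ) : ℝ) * x 0 := by
  rcases lt_or_gt_of_ne (time_ne_zero_of_causal hx h0) with h | h
  · exact ⟨-1, by simpa using h⟩
  · exact ⟨1, by simpa using h⟩

/-- Time orientation becomes the sign of a linear functional adapted to `p`, which is easy to follow
along a line in direction `p`. -/
theorem sign_iff {ε : ℤˣ} {p x : Minkowski} (hp : p ∈ timelike ε) (hx : mink x x ≤ 0)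
    (h0 : x ≠ 0) : 0 < ((ε : ℤ) : ℝ) * x 0 ↔ mink p x < 0 := by
  refine ⟨mink_neg_of_causal hp hx, fun h => ?_⟩
  obtain ⟨η, hη⟩ := exists_sign_of_causal hx h0
  rcases units_eq_or_eq_neg ε η with rfl | rfl
  · exact hη
  · have := mink_neg_of_causal (neg_mem_timelike.2 hp) hx hη
    rw [mink_neg_left] at this
    linarith

theorem sign_neg_iff {ε : ℤˣ} {p x : Minkowski} (hp : p ∈ timelike ε) (hx : mink x x ≤ 0)
    (h0 : x ≠ 0) : 0 < (((-ε : ℤˣ) : ℤ) : ℝ) * x 0 ↔ 0 < mink p x := by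
  rw [sign_iff (neg_mem_timelike.2 hp) hx h0, mink_neg_left, neg_lt_zero]

theorem mink_self_pos_of_orthogonal {ε : ℤˣ} {p x : Minkowski} (hp : p ∈ timelike ε)
    (hx : mink p x = 0) (h0 : x ≠ 0) : 0 < mink x x := by
  by_contra! h
  obtain ⟨η, hη⟩ := exists_sign_of_causal h h0
  rcases units_eq_or_eq_neg ε η with rfl | rfl
  · exact (mink_neg_of_causal hp h hη).ne hx
  · exact ((sign_neg_iff hp h h0).1 hη).ne' hx

/-- The component of `b` orthogonal to `p` is nonzero, hence spacelike, and the discriminant is its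
square norm times the positive number -⟨p, p⟩. -/
theorem discr_pos {ε : ℤˣ} {p b : Minkowski} (hp : p ∈ timelike ε) (hb : ∀ k : ℝ, k • p + b ≠ 0) :
    0 < mink p b ^ 2 - mink p p * mink b b := by
  have hpp := hp.1
  have h1 := mink_self_pos_of_orthogonal (x := (-(mink p b / mink p p)) • p + b) hp
    (by rw [mink_add_right, mink_smul_right]; field_simp [hpp.ne]; ring) (hb _)
  rw [mink_add_left, mink_add_right, mink_add_right, mink_smul_left, mink_smul_left,
    mink_smul_right, mink_smul_right, mink_comm b p] at h1
  have h2 : mink p b ^ 2 - mink p p * mink b b = -mink p p *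
      (-(mink p b / mink p p) * (-(mink p b / mink p p) * mink p p) +
        -(mink p b / mink p p) * mink p b + (-(mink p b / mink p p) * mink p b + mink b b)) := by
    field_simp [hpp.ne]; ring
  rw [h2]
  exact mul_pos (neg_pos.2 hpp) h1

/-! ### Causal character along a line with timelike direction. -/

/-- The larger root `k` of `⟨k p + b, k p + b⟩ = 0`. -/
noncomputable def rootHi (p b : Minkowski) : ℝ :=
  (mink p b + √(mink p b ^ 2 - mink p p * mink b b)) / -mink p p

/-- The smaller root `k` of `⟨k p + b, k p + b⟩ = 0`. -/
noncomputable def rootLo (p b : Minkowski) : ℝ :=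
  (mink p b - √(mink p b ^ 2 - mink p p * mink b b)) / -mink p p

theorem continuous_rootHi (p : Minkowski) : Continuous (rootHi p) := by
  unfold rootHi; fun_prop

theorem continuous_rootLo (p : Minkowski) : Continuous (rootLo p) := by
  unfold rootLo; fun_prop

section ray

variable {ε : ℤˣ} {p b : Minkowski}

theorem rootLo_lt_rootHi (hp : p ∈ timelike ε) (hb : ∀ k : ℝ, k • p + b ≠ 0) :
    rootLo p b < rootHi p b := by
  have := Real.sqrt_pos.2 (discr_pos hp hb)
  have hpp := neg_pos.2 hp.1
  unfold rootLo rootHi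
  gcongr
  linarith

theorem mink_ray_self (hp : p ∈ timelike ε) (hb : ∀ k : ℝ, k • p + b ≠ 0) (k : ℝ) :
    mink (k • p + b) (k • p + b) = mink p p * ((k - rootHi p b) * (k - rootLo p b)) := by
  have hs := Real.sq_sqrt (discr_pos hp hb).le
  have hpp := hp.1.ne
  rw [mink_add_left, mink_add_right, mink_add_right, mink_smul_left, mink_smul_left,
    mink_smul_right, mink_smul_right, mink_comm b p]
  unfold rootLo rootHi
  field_simp
  linear_combination hs

/-- The linear functional vanishes midway between the roots, so it has opposite signs at them: the
two roots belong to different lightcones. -/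
theorem mink_ray (hp : p ∈ timelike ε) (k : ℝ) :
    mink p (k • p + b) = mink p p * (k - (rootHi p b + rootLo p b) / 2) := by
  have hpp := hp.1.ne
  rw [mink_add_right, mink_smul_right]
  unfold rootLo rootHi
  field_simp
  ring

theorem ray_mem_timelike (hp : p ∈ timelike ε) (hb : ∀ k : ℝ, k • p + b ≠ 0) {k : ℝ} :
    k • p + b ∈ timelike ε ↔ rootHi p b < k := by
  have hlt := rootLo_lt_rootHi hp hb
  have h1 := mink_ray_self hp hb k
  have h2 := mink_ray (b := b) hp k
  have hpp := hp.1
  constructor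
  · rintro ⟨h3, h4⟩
    have h5 := (sign_iff hp h3.le (hb k)).1 h4
    rw [h2] at h5
    rw [h1] at h3
    have h6 := pos_of_mul_neg_right h5 hpp.le
    have h7 := pos_of_mul_neg_right h3 hpp.le
    -- The two factors have equal signs, and beyond the midpoint of the roots the factor with the
    -- smaller root is positive.
    have h8 := (pos_iff_pos_of_mul_pos h7).2 (by linarith)
    linarith
  · intro h
    have h3 : mink (k • p + b) (k • p + b) < 0 := by
      rw [h1]; exact mul_neg_of_neg_of_pos hpp (mul_pos (by linarith) (by linarith))
    refine ⟨h3, (sign_iff hp h3.le (hb k)).2 ?_⟩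
    rw [h2]; exact mul_neg_of_neg_of_pos hpp (by linarith)

theorem ray_mem_timelike_neg (hp : p ∈ timelike ε) (hb : ∀ k : ℝ, k • p + b ≠ 0) {k : ℝ} :
    k • p + b ∈ timelike (-ε) ↔ k < rootLo p b := by
  have hlt := rootLo_lt_rootHi hp hb
  have h1 := mink_ray_self hp hb k
  have h2 := mink_ray (b := b) hp k
  have hpp := hp.1
  constructor
  · rintro ⟨h3, h4⟩
    have h5 := (sign_neg_iff hp h3.le (hb k)).1 h4
    rw [h2] at h5
    rw [h1] at h3
    have h6 := neg_of_mul_pos_right h5 hpp.le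
    have h7 := pos_of_mul_neg_right h3 hpp.le
    by_contra! hk
    have h8 := (pos_iff_pos_of_mul_pos h7)
    have h9 : ¬ 0 < k - rootHi p b := by linarith
    have := mul_nonpos_of_nonpos_of_nonneg (not_lt.1 h9) (sub_nonneg.2 hk)
    linarith
  · intro h
    have h3 : mink (k • p + b) (k • p + b) < 0 := by
      rw [h1]; exact mul_neg_of_neg_of_pos hpp (mul_pos_of_neg_of_neg (by linarith) (by linarith))
    refine ⟨h3, (sign_neg_iff hp h3.le (hb k)).2 ?_⟩
    rw [h2]; exact mul_pos_of_neg_of_neg hpp (by linarith)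

theorem ray_mem_lightcone (hp : p ∈ timelike ε) (hb : ∀ k : ℝ, k • p + b ≠ 0) {k : ℝ} :
    k • p + b ∈ lightcone ε ↔ k = rootHi p b := by
  have hlt := rootLo_lt_rootHi hp hb
  have h1 := mink_ray_self hp hb k
  have h2 := mink_ray (b := b) hp k
  have hpp := hp.1
  constructor
  · rintro ⟨h3, h4⟩
    have h5 := (sign_iff hp h3.le (hb k)).1 h4
    rw [h2] at h5
    have h6 := pos_of_mul_neg_right h5 hpp.le
    rw [h1, mul_eq_zero, mul_eq_zero] at h3
    rcases h3 with h3 | h3 | h3 <;> linarith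
  · intro h
    have h3 : mink (k • p + b) (k • p + b) = 0 := by rw [h1, h]; ring
    refine ⟨h3, (sign_iff hp h3.le (hb k)).2 ?_⟩
    rw [h2]; exact mul_neg_of_neg_of_pos hpp (by linarith)

theorem ray_mem_lightcone_neg (hp : p ∈ timelike ε) (hb : ∀ k : ℝ, k • p + b ≠ 0) {k : ℝ} :
    k • p + b ∈ lightcone (-ε) ↔ k = rootLo p b := by
  have hlt := rootLo_lt_rootHi hp hb
  have h1 := mink_ray_self hp hb k
  have h2 := mink_ray (b := b) hp k
  have hpp := hp.1
  constructor
  · rintro ⟨h3, h4⟩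
    have h5 := (sign_neg_iff hp h3.le (hb k)).1 h4
    rw [h2] at h5
    have h6 := neg_of_mul_pos_right h5 hpp.le
    rw [h1, mul_eq_zero, mul_eq_zero] at h3
    rcases h3 with h3 | h3 | h3 <;> linarith
  · intro h
    have h3 : mink (k • p + b) (k • p + b) = 0 := by rw [h1, h]; ring
    refine ⟨h3, (sign_neg_iff hp h3.le (hb k)).2 ?_⟩
    rw [h2]; exact mul_pos_of_neg_of_neg hpp (by linarith)

theorem ray_mem_spacelike (hp : p ∈ timelike ε) (hb : ∀ k : ℝ, k • p + b ≠ 0) {k : ℝ} :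
    k • p + b ∈ spacelike ↔ rootLo p b < k ∧ k < rootHi p b := by
  have hlt := rootLo_lt_rootHi hp hb
  have hpp := hp.1
  simp only [spacelike, mem_ofPred_eq, mink_ray_self hp hb k]
  constructor
  · intro h
    have h1 := neg_of_mul_pos_right h hpp.le
    rcases mul_neg_iff.1 h1 with h2 | h2 <;> constructor <;> linarith [h2.1, h2.2]
  · rintro ⟨h1, h2⟩
    exact mul_pos_of_neg_of_neg hpp (mul_neg_of_neg_of_pos (by linarith) (by linarith))

end ray

/-! ### Comparison of causal characters. -/

/-- The points `x` and `x'` have the same causal character up to the time orientation `δ`. -/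
structure SameCharacter (δ : ℤˣ) (x x' : Minkowski) : Prop where
  timelike : ∀ ε, x ∈ timelike ε ↔ x' ∈ timelike (δ * ε)
  lightcone : ∀ ε, x ∈ lightcone ε ↔ x' ∈ lightcone (δ * ε)
  spacelike : x ∈ spacelike ↔ x' ∈ spacelike

theorem SameCharacter.of_spacelike {δ : ℤˣ} {x x' : Minkowski} (hx : x ∈ LorentzCausal.spacelike)
    (hx' : x' ∈ LorentzCausal.spacelike) : SameCharacter δ x x' :=
  ⟨fun _ => iff_of_false (spacelike_not_timelike hx) (spacelike_not_timelike hx'),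
    fun _ => iff_of_false (spacelike_not_lightcone hx) (spacelike_not_lightcone hx'),
    iff_of_true hx hx'⟩

theorem SameCharacter.of_timelike {δ ε : ℤˣ} {x x' : Minkowski} (hx : x ∈ LorentzCausal.timelike ε)
    (hx' : x' ∈ LorentzCausal.timelike (δ * ε)) : SameCharacter δ x x' :=
  ⟨fun η => by rw [timelike_disjoint hx, timelike_disjoint hx', mul_right_inj],
    fun _ => iff_of_false (timelike_not_lightcone hx) (timelike_not_lightcone hx'),
    iff_of_false (fun h => spacelike_not_timelike h hx) (fun h => spacelike_not_timelike h hx')⟩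

theorem SameCharacter.smul {δ : ℤˣ} {x x' : Minkowski} {c c' : ℝ} (hc : 0 < c) (hc' : 0 < c')
    (h : SameCharacter δ x x') : SameCharacter δ (c • x) (c' • x') :=
  ⟨fun ε => by rw [smul_mem_timelike hc, smul_mem_timelike hc', h.timelike],
    fun ε => by rw [smul_mem_lightcone hc, smul_mem_lightcone hc', h.lightcone],
    by rw [smul_mem_spacelike hc, smul_mem_spacelike hc', h.spacelike]⟩

/-- The two roots cut the line into five zones, one for each causal character; strict and weak
comparison with both roots locate the zone. -/
theorem sameCharacter_ray {δ ε : ℤˣ} {p b p' b' : Minkowski} (hp : p ∈ timelike ε)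
    (hb : ∀ k : ℝ, k • p + b ≠ 0) (hp' : p' ∈ timelike (δ * ε)) (hb' : ∀ k : ℝ, k • p' + b' ≠ 0)
    {k k' : ℝ} :
    SameCharacter δ (k • p + b) (k' • p' + b') ↔
      (rootHi p b < k ↔ rootHi p' b' < k') ∧ (rootHi p b ≤ k ↔ rootHi p' b' ≤ k') ∧
      (rootLo p b < k ↔ rootLo p' b' < k') ∧ (rootLo p b ≤ k ↔ rootLo p' b' ≤ k') := by
  have hlt := rootLo_lt_rootHi hp hb
  have hlt' := rootLo_lt_rootHi hp' hb'
  have e : ∀ η : ℤˣ, δ * -η = -(δ * η) := fun η => by simp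
  constructor
  · intro h
    have h1 := h.timelike ε
    have h2 := h.timelike (-ε)
    have h3 := h.lightcone ε
    have h4 := h.lightcone (-ε)
    rw [ray_mem_timelike hp hb, ray_mem_timelike hp' hb'] at h1
    rw [e, ray_mem_timelike_neg hp hb, ray_mem_timelike_neg hp' hb'] at h2
    rw [ray_mem_lightcone hp hb, ray_mem_lightcone hp' hb'] at h3
    rw [e, ray_mem_lightcone_neg hp hb, ray_mem_lightcone_neg hp' hb'] at h4
    refine ⟨h1, ?_, ?_, ?_⟩
    · rw [le_iff_lt_or_eq, h1, eq_comm, h3, eq_comm (a := k'), ← le_iff_lt_or_eq]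
    · rw [← not_le, ← not_le, not_iff_not, le_iff_lt_or_eq, le_iff_lt_or_eq, h2, h4]
    · rw [← not_lt, ← not_lt, not_iff_not, h2]
  · rintro ⟨h1, h2, h3, h4⟩
    have h5 : k < rootLo p b ↔ k' < rootLo p' b' := by rw [← not_le, h4, not_le]
    have h6 : k = rootHi p b ↔ k' = rootHi p' b' := by
      rw [eq_comm, eq_comm (a := k'), eq_iff_le_not_lt, eq_iff_le_not_lt, h1, h2]
    have h7 : k = rootLo p b ↔ k' = rootLo p' b' := by
      rw [eq_comm, eq_comm (a := k'), eq_iff_le_not_lt, eq_iff_le_not_lt, h3, h4]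
    have h8 : k < rootHi p b ↔ k' < rootHi p' b' := by rw [← not_le, h2, not_le]
    refine ⟨fun η => ?_, fun η => ?_, ?_⟩
    · rcases units_eq_or_eq_neg ε η with rfl | rfl
      · rw [ray_mem_timelike hp hb, ray_mem_timelike hp' hb', h1]
      · rw [e, ray_mem_timelike_neg hp hb, ray_mem_timelike_neg hp' hb', h5]
    · rcases units_eq_or_eq_neg ε η with rfl | rfl
      · rw [ray_mem_lightcone hp hb, ray_mem_lightcone hp' hb', h6]
      · rw [e, ray_mem_lightcone_neg hp hb, ray_mem_lightcone_neg hp' hb', h7]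
    · rw [ray_mem_spacelike hp hb, ray_mem_spacelike hp' hb', h3, h8]

/-- A continuous map from a compact space to a Hausdorff space is closed, hence a quotient map onto
its image. This gives continuity of maps defined through non-unique coordinates. -/
theorem continuousOn_image_of_comp {A B C : Type*} [TopologicalSpace A] [TopologicalSpace B]
    [TopologicalSpace C] [T2Space A] [T2Space B] {K : Set A} (hK : IsCompact K) {π : A → B}
    (hπ : ContinuousOn π K) {F : B → C} (h : ContinuousOn (F ∘ π) K) : ContinuousOn F (π '' K) := by
  rw [continuousOn_iff_isClosed]
  intro t ht
  have hc : IsCompact (K ∩ (F ∘ π) ⁻¹' t) :=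
    hK.of_isClosed_subset (h.preimage_isClosed_of_isClosed hK.isClosed ht) inter_subset_left
  refine ⟨π '' (K ∩ (F ∘ π) ⁻¹' t), (hc.image_of_continuousOn (hπ.mono inter_subset_left)).isClosed,
    ?_⟩
  ext y
  constructor
  · rintro ⟨hy, x, hx, rfl⟩
    exact ⟨⟨x, ⟨hx, hy⟩, rfl⟩, x, hx, rfl⟩
  · rintro ⟨⟨x, ⟨hx, hy⟩, rfl⟩, h2⟩
    exact ⟨hy, h2⟩

/-! ### Reparametrisation of segments with prescribed crossing times. -/

/-- The piecewise linear path with values `0, s, u, 1` at the times `0, 1, 2, 3`. -/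
def breakPath (s u τ : ℝ) : ℝ :=
  min τ 1 * s + min (max (τ - 1) 0) 1 * (u - s) + max (τ - 2) 0 * (1 - u)

theorem breakPath_of_le_one {s u τ : ℝ} (h : τ ≤ 1) : breakPath s u τ = τ * s := by
  simp [breakPath, h, show τ ≤ 2 by linarith]

theorem breakPath_of_mem_one_two {s u τ : ℝ} (h : 1 ≤ τ) (h2 : τ ≤ 2) :
    breakPath s u τ = s + (τ - 1) * (u - s) := by
  simp [breakPath, h, h2, show τ - 1 ≤ 1 by linarith]

theorem breakPath_of_two_le {s u τ : ℝ} (h : 2 ≤ τ) :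
    breakPath s u τ = u + (τ - 2) * (1 - u) := by
  simp [breakPath, h, show 1 ≤ τ by linarith, show 1 ≤ τ - 1 by linarith]

theorem breakPath_zero (s u : ℝ) : breakPath s u 0 = 0 := by
  rw [breakPath_of_le_one zero_le_one, zero_mul]

theorem breakPath_three (s u : ℝ) : breakPath s u 3 = 1 := by
  rw [breakPath_of_two_le (by norm_num)]; ring

section breakPath

variable {s u : ℝ}

theorem breakPath_monotone (h0 : 0 < s) (h1 : s ≤ u) (h2 : u ≤ 1) : Monotone (breakPath s u) := by
  intro a b hab
  unfold breakPath
  have h1' := sub_nonneg.2 h1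
  have h2' := sub_nonneg.2 h2
  gcongr

theorem breakPath_mem (h0 : 0 < s) (h1 : s ≤ u) (h2 : u ≤ 1) {τ : ℝ} (hτ : τ ∈ Icc (0 : ℝ) 3) :
    breakPath s u τ ∈ Icc (0 : ℝ) 1 := by
  have hm := breakPath_monotone h0 h1 h2
  have a := hm hτ.1
  have b := hm hτ.2
  rw [breakPath_zero] at a
  rw [breakPath_three] at b
  exact ⟨a, b⟩

theorem breakPath_lt_left (h0 : 0 < s) (h1 : s ≤ u) (h2 : u ≤ 1) {τ : ℝ} :
    breakPath s u τ < s ↔ τ < 1 := by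
  constructor
  · intro h
    by_contra! hτ
    have := breakPath_monotone h0 h1 h2 hτ
    rw [breakPath_of_le_one le_rfl] at this
    linarith
  · intro h
    rw [breakPath_of_le_one h.le]
    nlinarith

theorem breakPath_le_left (h0 : 0 < s) (h1 : s < u) (h2 : u ≤ 1) {τ : ℝ} :
    breakPath s u τ ≤ s ↔ τ ≤ 1 := by
  constructor
  · intro h
    by_contra! hτ
    have hm := breakPath_monotone h0 h1.le h2 (min_le_left τ 2)
    rw [breakPath_of_mem_one_two (le_min hτ.le (by norm_num)) (min_le_right _ _)] at hm
    have : 1 < min τ 2 := lt_min hτ (by norm_num)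
    nlinarith
  · intro h
    have := breakPath_monotone h0 h1.le h2 h
    rwa [breakPath_of_le_one le_rfl, one_mul] at this

theorem breakPath_lt_right (h0 : 0 < s) (h1 : s < u) (h2 : u ≤ 1) {τ : ℝ} :
    breakPath s u τ < u ↔ τ < 2 := by
  constructor
  · intro h
    by_contra! hτ
    have := breakPath_monotone h0 h1.le h2 hτ
    rw [breakPath_of_two_le le_rfl] at this
    linarith
  · intro h
    have hm := breakPath_monotone h0 h1.le h2 (le_max_left τ 1)
    rw [breakPath_of_mem_one_two (le_max_right τ 1) (max_le h.le (by norm_num))] at hm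
    have : max τ 1 < 2 := max_lt h (by norm_num)
    nlinarith

theorem breakPath_le_right (h0 : 0 < s) (h1 : s ≤ u) (h2 : u < 1) {τ : ℝ} :
    breakPath s u τ ≤ u ↔ τ ≤ 2 := by
  constructor
  · intro h
    by_contra! hτ
    rw [breakPath_of_two_le hτ.le] at h
    nlinarith
  · intro h
    have := breakPath_monotone h0 h1 h2.le h
    rw [breakPath_of_two_le le_rfl] at this
    linarith

theorem breakPath_eq_zero_iff (h0 : 0 < s) (h1 : s ≤ u) (h2 : u ≤ 1) {τ : ℝ} :
    breakPath s u τ = 0 ↔ τ = 0 := by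
  refine ⟨fun h => ?_, fun h => by rw [h, breakPath_zero]⟩
  have h3 : τ < 1 := (breakPath_lt_left h0 h1 h2).1 (by rwa [h])
  rw [breakPath_of_le_one h3.le] at h
  simpa [h0.ne'] using h

/-- The path is a sum of three terms, each monotone in time, so equal sums force equal terms. A term
loses information about time exactly when its slope is zero; this happens when the segment ends
before the corresponding crossing. -/
theorem breakPath_eq_iff (h0 : 0 < s) (h1 : s ≤ u) (h2 : u ≤ 1) {τ τ' : ℝ} :
    breakPath s u τ = breakPath s u τ' ↔ min τ 1 = min τ' 1 ∧
      (min (max (τ - 1) 0) 1 = min (max (τ' - 1) 0) 1 ∨ s = u) ∧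
      (max (τ - 2) 0 = max (τ' - 2) 0 ∨ u = 1) := by
  constructor
  · intro h
    wlog hle : τ ≤ τ' generalizing τ τ'
    · have := this h.symm (le_of_not_ge hle)
      simpa only [eq_comm] using this
    have a1 : min τ 1 ≤ min τ' 1 := by gcongr
    have a2 : min (max (τ - 1) 0) 1 ≤ min (max (τ' - 1) 0) 1 := by gcongr
    have a3 : max (τ - 2) 0 ≤ max (τ' - 2) 0 := by gcongr
    unfold breakPath at h
    have b1 := mul_le_mul_of_nonneg_right a1 h0.le
    have b2 := mul_le_mul_of_nonneg_right a2 (sub_nonneg.2 h1)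
    have b3 := mul_le_mul_of_nonneg_right a3 (sub_nonneg.2 h2)
    have c1 : min τ 1 * s = min τ' 1 * s := by linarith
    have c2 : min (max (τ - 1) 0) 1 * (u - s) = min (max (τ' - 1) 0) 1 * (u - s) := by linarith
    have c3 : max (τ - 2) 0 * (1 - u) = max (τ' - 2) 0 * (1 - u) := by linarith
    rw [mul_eq_mul_right_iff] at c1 c2 c3
    refine ⟨c1.resolve_right h0.ne', c2.imp_right ?_, c3.imp_right ?_⟩ <;> intro h <;> linarith
  · rintro ⟨h3, h4, h5⟩
    unfold breakPath
    rw [h3]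
    rcases h4 with h4 | h4 <;> rcases h5 with h5 | h5 <;> simp [h4, h5]

end breakPath

theorem continuous_breakPath {X : Type*} [TopologicalSpace X] {f g h : X → ℝ} (hf : Continuous f)
    (hg : Continuous g) (hh : Continuous h) : Continuous fun x => breakPath (f x) (g x) (h x) := by
  unfold breakPath; fun_prop

/-- The parameter at which the segment from `p` to `b` passes through `k p + b`, cut off at `b`. -/
noncomputable def cutoff (k : ℝ) : ℝ := (1 + max k 0)⁻¹

theorem cutoff_pos (k : ℝ) : 0 < cutoff k := by unfold cutoff; positivity

theorem cutoff_le_one (k : ℝ) : cutoff k ≤ 1 :=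
  inv_le_one_of_one_le₀ (by linarith [le_max_right k 0])

theorem cutoff_le {a c : ℝ} (h : c ≤ a) : cutoff a ≤ cutoff c := by unfold cutoff; gcongr

theorem cutoff_lt {a c : ℝ} (h : c < a) (ha : 0 < a) : cutoff a < cutoff c := by
  unfold cutoff
  have : max c 0 < max a 0 := max_lt (lt_max_of_lt_left h) (lt_max_of_lt_left ha)
  gcongr

theorem cutoff_eq_one_iff {k : ℝ} : cutoff k = 1 ↔ k ≤ 0 := by
  unfold cutoff
  rw [inv_eq_one]
  simp

theorem cutoff_eq_cutoff_iff {a c : ℝ} (h : c < a) : cutoff a = cutoff c ↔ a ≤ 0 := by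
  constructor
  · intro h1
    by_contra! ha
    exact (cutoff_lt h ha).ne h1
  · intro ha
    rw [cutoff_eq_one_iff.2 ha, cutoff_eq_one_iff.2 (h.le.trans ha)]

theorem continuous_cutoff : Continuous cutoff := by
  unfold cutoff
  refine Continuous.inv₀ (by fun_prop) fun x => ?_
  positivity

/-- Up to the factor `r`, the point `(1 - r) • p + r • b` is `k • p + b` with `k = (1 - r) / r`. On
the segment `k` is nonnegative, so a negative root is never reached and lies below every `k`. -/
theorem lt_ratio_iff {a r : ℝ} (hr : 0 < r) (hr1 : r ≤ 1) :
    a < (1 - r) / r ↔ r < cutoff a ∨ a < 0 := by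
  have h : 0 ≤ (1 - r) / r := div_nonneg (by linarith) hr.le
  have e : r < cutoff a ↔ max a 0 < (1 - r) / r := by
    unfold cutoff
    rw [lt_inv_comm₀ hr (by positivity), lt_div_iff₀ hr, ← one_div, lt_div_iff₀ hr]
    constructor <;> intro h <;> linarith
  rw [e, max_lt_iff]
  constructor
  · intro h1
    by_cases h2 : a < 0
    · exact Or.inr h2
    · exact Or.inl ⟨h1, by linarith⟩
  · rintro (h1 | h1)
    · exact h1.1
    · linarith

theorem le_ratio_iff {a r : ℝ} (hr : 0 < r) (hr1 : r ≤ 1) :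
    a ≤ (1 - r) / r ↔ r ≤ cutoff a ∨ a ≤ 0 := by
  have h : 0 ≤ (1 - r) / r := div_nonneg (by linarith) hr.le
  have e : r ≤ cutoff a ↔ max a 0 ≤ (1 - r) / r := by
    unfold cutoff
    rw [le_inv_comm₀ hr (by positivity), le_div_iff₀ hr, ← one_div, le_div_iff₀ hr]
    constructor <;> intro h <;> linarith
  rw [e, max_le_iff]
  constructor
  · intro h1
    exact Or.inl ⟨h1, h⟩
  · rintro (h1 | h1)
    · exact h1.1
    · linarith

section compare

variable {a c τ : ℝ}

/-- In this and the next three comparisons only the time and the sign of a root survive. Two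
segments whose roots have the same signs therefore have the same character at equal times. -/
theorem hi_lt_iff (h : c < a) (hτ : 0 < breakPath (cutoff a) (cutoff c) τ)
    (hτ1 : breakPath (cutoff a) (cutoff c) τ ≤ 1) :
    a < (1 - breakPath (cutoff a) (cutoff c) τ) / breakPath (cutoff a) (cutoff c) τ ↔
      τ < 1 ∨ a < 0 := by
  rw [lt_ratio_iff hτ hτ1, breakPath_lt_left (cutoff_pos _) (cutoff_le h.le) (cutoff_le_one _)]

theorem hi_le_iff (h : c < a) (hτ : 0 < breakPath (cutoff a) (cutoff c) τ)
    (hτ1 : breakPath (cutoff a) (cutoff c) τ ≤ 1) :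
    a ≤ (1 - breakPath (cutoff a) (cutoff c) τ) / breakPath (cutoff a) (cutoff c) τ ↔
      τ ≤ 1 ∨ a ≤ 0 := by
  rw [le_ratio_iff hτ hτ1]
  by_cases ha : a ≤ 0
  · simp [ha]
  · rw [breakPath_le_left (cutoff_pos _) (cutoff_lt h (not_le.1 ha)) (cutoff_le_one _)]

theorem lo_lt_iff (h : c < a) (hτ : 0 < breakPath (cutoff a) (cutoff c) τ)
    (hτ1 : breakPath (cutoff a) (cutoff c) τ ≤ 1) :
    c < (1 - breakPath (cutoff a) (cutoff c) τ) / breakPath (cutoff a) (cutoff c) τ ↔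
      τ < 2 ∨ c < 0 := by
  rw [lt_ratio_iff hτ hτ1]
  by_cases hc : c < 0
  · simp [hc]
  · rw [breakPath_lt_right (cutoff_pos _) (cutoff_lt h (by linarith)) (cutoff_le_one _)]

theorem lo_le_iff (h : c < a) (hτ : 0 < breakPath (cutoff a) (cutoff c) τ)
    (hτ1 : breakPath (cutoff a) (cutoff c) τ ≤ 1) :
    c ≤ (1 - breakPath (cutoff a) (cutoff c) τ) / breakPath (cutoff a) (cutoff c) τ ↔
      τ ≤ 2 ∨ c ≤ 0 := by
  rw [le_ratio_iff hτ hτ1]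
  by_cases hc : c ≤ 0
  · simp [hc]
  · rw [breakPath_le_right (cutoff_pos _) (cutoff_le h.le)
      (lt_of_le_of_ne (cutoff_le_one _) (mt cutoff_eq_one_iff.1 hc))]

end compare

/-! ### Cones over a compact base and extension of causal maps. -/

/-- The set `X` is the cone with apex `p` over the compact base `B`, in general position with
respect to the origin. -/
structure IsConeOver (p : Minkowski) (B X : Set Minkowski) : Prop where
  isCompact : IsCompact B
  ne_zero : ∀ b ∈ B, ∀ k : ℝ, k • p + b ≠ 0
  mem : ∀ b ∈ B, ∀ r ∈ Icc (0 : ℝ) 1, (1 - r) • p + r • b ∈ X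
  surj : ∀ x ∈ X, ∃ b ∈ B, ∃ r ∈ Icc (0 : ℝ) 1, (1 - r) • p + r • b = x
  inj : ∀ b ∈ B, ∀ b' ∈ B, ∀ r ∈ Icc (0 : ℝ) 1, ∀ r' ∈ Icc (0 : ℝ) 1,
    (1 - r) • p + r • b = (1 - r') • p + r' • b' → r = r' ∧ (r ≠ 0 → b = b')

/-- The map `f` is a homeomorphism from `X` onto `X'` that preserves the causal character of points
up to the time orientation `δ`. -/
structure IsCausalMap (δ : ℤˣ) (f : Minkowski → Minkowski) (X X' : Set Minkowski) : Prop where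
  continuousOn : ContinuousOn f X
  bijOn : BijOn f X X'
  sameCharacter : ∀ x ∈ X, SameCharacter δ x (f x)

/-- The position on the segment from `p` to `b` at time `τ`, where the segment leaves the cone of
`p` at time `1` and enters the opposite cone at time `2`. -/
noncomputable def raySpeed (p b : Minkowski) (τ : ℝ) : ℝ :=
  breakPath (cutoff (rootHi p b)) (cutoff (rootLo p b)) τ

/-- The point on the segment from `p` to `b` at time `τ`. -/
noncomputable def rayPoint (p b : Minkowski) (τ : ℝ) : Minkowski :=
  (1 - raySpeed p b τ) • p + raySpeed p b τ • b

theorem continuous_raySpeed (p : Minkowski) :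
    Continuous fun z : Minkowski × ℝ => raySpeed p z.1 z.2 :=
  continuous_breakPath
    (continuous_cutoff.comp ((continuous_rootHi p).comp continuous_fst))
    (continuous_cutoff.comp ((continuous_rootLo p).comp continuous_fst)) continuous_snd

theorem continuous_rayPoint (p : Minkowski) :
    Continuous fun z : Minkowski × ℝ => rayPoint p z.1 z.2 := by
  have := continuous_raySpeed p
  unfold rayPoint
  fun_prop

theorem rayPoint_three (p b : Minkowski) : rayPoint p b 3 = b := by
  simp [rayPoint, raySpeed, breakPath_three]

theorem rayPoint_zero (p b : Minkowski) : rayPoint p b 0 = p := by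
  simp [rayPoint, raySpeed, breakPath_zero]

section

variable {ε : ℤˣ} {p : Minkowski} {B X : Set Minkowski}

theorem IsConeOver.raySpeed_mem (hX : IsConeOver p B X) (hp : p ∈ timelike ε) {b : Minkowski}
    (hb : b ∈ B) {τ : ℝ} (hτ : τ ∈ Icc (0 : ℝ) 3) : raySpeed p b τ ∈ Icc (0 : ℝ) 1 :=
  breakPath_mem (cutoff_pos _) (cutoff_le (rootLo_lt_rootHi hp (hX.ne_zero b hb)).le)
    (cutoff_le_one _) hτ

/-- The coordinates (base point, time) are not injective: time 0 is the apex, and time may stand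
still on a segment that ends early. Which coordinates coincide depends only on base points, times
and signs of roots, so a causal map of bases transports the coincidences. -/
theorem IsConeOver.rayPoint_eq_iff (hX : IsConeOver p B X) (hp : p ∈ timelike ε)
    {b b' : Minkowski} (hb : b ∈ B) (hb' : b' ∈ B) {τ τ' : ℝ} (hτ : τ ∈ Icc (0 : ℝ) 3)
    (hτ' : τ' ∈ Icc (0 : ℝ) 3) :
    rayPoint p b τ = rayPoint p b' τ' ↔ (τ = 0 ∧ τ' = 0) ∨ (b = b' ∧ min τ 1 = min τ' 1 ∧
      (min (max (τ - 1) 0) 1 = min (max (τ' - 1) 0) 1 ∨ rootHi p b ≤ 0) ∧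
      (max (τ - 2) 0 = max (τ' - 2) 0 ∨ rootLo p b ≤ 0)) := by
  have hlt := rootLo_lt_rootHi hp (hX.ne_zero b hb)
  have hlt' := rootLo_lt_rootHi hp (hX.ne_zero b' hb')
  rw [← cutoff_eq_cutoff_iff hlt, ← cutoff_eq_one_iff (k := rootLo p b),
    ← breakPath_eq_iff (cutoff_pos _) (cutoff_le hlt.le) (cutoff_le_one _),
    ← breakPath_eq_zero_iff (τ := τ) (cutoff_pos _) (cutoff_le hlt.le) (cutoff_le_one _),
    ← breakPath_eq_zero_iff (τ := τ') (cutoff_pos _) (cutoff_le hlt'.le) (cutoff_le_one _)]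
  change _ ↔ (raySpeed p b τ = 0 ∧ raySpeed p b' τ' = 0) ∨
    (b = b' ∧ raySpeed p b τ = raySpeed p b τ')
  constructor
  · intro h
    obtain ⟨h1, h2⟩ := hX.inj b hb b' hb' _ (hX.raySpeed_mem hp hb hτ) _
      (hX.raySpeed_mem hp hb' hτ') h
    by_cases h0 : raySpeed p b τ = 0
    · exact Or.inl ⟨h0, h1 ▸ h0⟩
    · obtain rfl := h2 h0
      exact Or.inr ⟨rfl, h1⟩
  · rintro (⟨h1, h2⟩ | ⟨rfl, h1⟩)
    · simp [rayPoint, h1, h2]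
    · simp [rayPoint, h1]

theorem IsConeOver.exists_rayPoint (hX : IsConeOver p B X) {x : Minkowski} (hx : x ∈ X) :
    ∃ b ∈ B, ∃ τ ∈ Icc (0 : ℝ) 3, rayPoint p b τ = x := by
  obtain ⟨b, hb, r, hr, rfl⟩ := hX.surj x hx
  have hc : ContinuousOn (raySpeed p b) (Icc 0 3) :=
    ((continuous_raySpeed p).comp (Continuous.prodMk_right b)).continuousOn
  have hi := intermediate_value_Icc (by norm_num) hc
  have e0 : raySpeed p b 0 = 0 := breakPath_zero _ _
  have e3 : raySpeed p b 3 = 1 := breakPath_three _ _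
  rw [e0, e3] at hi
  obtain ⟨τ, hτ, h⟩ := hi hr
  exact ⟨b, hb, τ, hτ, by rw [rayPoint, h]⟩

theorem IsConeOver.sameCharacter (hX : IsConeOver p B X) (hp : p ∈ timelike ε) {δ : ℤˣ}
    {p' : Minkowski} {B' X' : Set Minkowski} (hX' : IsConeOver p' B' X')
    (hp' : p' ∈ timelike (δ * ε)) {b b' : Minkowski} (hb : b ∈ B) (hb' : b' ∈ B')
    (h : SameCharacter δ b b') {τ : ℝ} (hτ : τ ∈ Icc (0 : ℝ) 3) :
    SameCharacter δ (rayPoint p b τ) (rayPoint p' b' τ) := by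
  rcases hτ.1.eq_or_lt with rfl | h0
  · rw [rayPoint_zero, rayPoint_zero]
    exact SameCharacter.of_timelike hp hp'
  have hlt := rootLo_lt_rootHi hp (hX.ne_zero b hb)
  have hlt' := rootLo_lt_rootHi hp' (hX'.ne_zero b' hb')
  obtain ⟨hr0, hr1⟩ := hX.raySpeed_mem hp hb hτ
  obtain ⟨hr0', hr1'⟩ := hX'.raySpeed_mem hp' hb' hτ
  have hr : 0 < raySpeed p b τ := lt_of_le_of_ne hr0 fun h => h0.ne'
    ((breakPath_eq_zero_iff (cutoff_pos _) (cutoff_le hlt.le) (cutoff_le_one _)).1 h.symm)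
  have hr' : 0 < raySpeed p' b' τ := lt_of_le_of_ne hr0' fun h => h0.ne'
    ((breakPath_eq_zero_iff (cutoff_pos _) (cutoff_le hlt'.le) (cutoff_le_one _)).1 h.symm)
  have e : ∀ (p b : Minkowski) (r : ℝ), 0 < r →
      (1 - r) • p + r • b = r • (((1 - r) / r) • p + b) := by
    intro p b r hr
    rw [smul_add, smul_smul, mul_div_cancel₀ _ hr.ne']
  rw [rayPoint, rayPoint, e _ _ _ hr, e _ _ _ hr']
  refine SameCharacter.smul hr hr' ?_
  rw [sameCharacter_ray hp (hX.ne_zero b hb) hp' (hX'.ne_zero b' hb')]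
  -- The base point is the point `k = 0` of its line, so its character records the signs of both
  -- roots.
  have h' : SameCharacter δ ((0 : ℝ) • p + b) ((0 : ℝ) • p' + b') := by simpa using h
  rw [sameCharacter_ray hp (hX.ne_zero b hb) hp' (hX'.ne_zero b' hb')] at h'
  obtain ⟨h1, h2, h3, h4⟩ := h'
  unfold raySpeed at hr hr' hr1 hr1' ⊢
  rw [hi_lt_iff hlt hr hr1, hi_lt_iff hlt' hr' hr1', hi_le_iff hlt hr hr1,
    hi_le_iff hlt' hr' hr1', lo_lt_iff hlt hr hr1, lo_lt_iff hlt' hr' hr1', lo_le_iff hlt hr hr1,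
    lo_le_iff hlt' hr' hr1', h1, h2, h3, h4]
  exact ⟨Iff.rfl, Iff.rfl, Iff.rfl, Iff.rfl⟩

/-- A causal map between the bases extends to the cones when the apices are timelike. -/
theorem IsConeOver.exists_extension (hX : IsConeOver p B X) (hp : p ∈ timelike ε) {δ : ℤˣ}
    {p' : Minkowski} {B' X' : Set Minkowski} (hX' : IsConeOver p' B' X')
    (hp' : p' ∈ timelike (δ * ε)) {f : Minkowski → Minkowski} (hf : IsCausalMap δ f B B') :
    ∃ F, IsCausalMap δ F X X' ∧ EqOn F f B := by
  -- Coordinates are chosen arbitrarily; `hker` shows that the image does not depend on the choice,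
  -- and also gives injectivity.
  choose! β hβ τ hτ hβτ using fun x (hx : x ∈ X) => hX.exists_rayPoint hx
  have hmaps := hf.bijOn.mapsTo
  have hker : ∀ b ∈ B, ∀ b' ∈ B, ∀ t ∈ Icc (0 : ℝ) 3, ∀ t' ∈ Icc (0 : ℝ) 3,
      (rayPoint p b t = rayPoint p b' t' ↔ rayPoint p' (f b) t = rayPoint p' (f b') t') := by
    intro b hb b' hb' t ht t' ht'
    rw [hX.rayPoint_eq_iff hp hb hb' ht ht',
      hX'.rayPoint_eq_iff hp' (hmaps hb) (hmaps hb') ht ht', hf.bijOn.injOn.eq_iff hb hb']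
    have h' : SameCharacter δ ((0 : ℝ) • p + b) ((0 : ℝ) • p' + f b) := by
      simpa using hf.sameCharacter b hb
    rw [sameCharacter_ray hp (hX.ne_zero b hb) hp' (hX'.ne_zero _ (hmaps hb))] at h'
    rw [h'.2.1, h'.2.2.2]
  let F : Minkowski → Minkowski := fun x => rayPoint p' (f (β x)) (τ x)
  have hmem : ∀ b ∈ B, ∀ t ∈ Icc (0 : ℝ) 3, rayPoint p b t ∈ X := fun b hb t ht =>
    hX.mem b hb _ (hX.raySpeed_mem hp hb ht)
  have hF : ∀ b ∈ B, ∀ t ∈ Icc (0 : ℝ) 3, F (rayPoint p b t) = rayPoint p' (f b) t := by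
    intro b hb t ht
    have hx := hmem b hb t ht
    exact (hker _ (hβ _ hx) b hb _ (hτ _ hx) t ht).1 (hβτ _ hx)
  have h3 : (3 : ℝ) ∈ Icc (0 : ℝ) 3 := by simp
  refine ⟨F, ⟨?_, ⟨?_, ?_, ?_⟩, ?_⟩, ?_⟩
  · have hK : IsCompact (B ×ˢ Icc (0 : ℝ) 3) := hX.isCompact.prod isCompact_Icc
    have himg : (fun z : Minkowski × ℝ => rayPoint p z.1 z.2) '' (B ×ˢ Icc (0 : ℝ) 3) = X := by
      ext x
      constructor
      · rintro ⟨⟨b, t⟩, ⟨hb, ht⟩, rfl⟩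
        exact hmem b hb t ht
      · intro hx
        exact ⟨(β x, τ x), ⟨hβ x hx, hτ x hx⟩, hβτ x hx⟩
    rw [← himg]
    refine continuousOn_image_of_comp hK (continuous_rayPoint p).continuousOn ?_
    have hg : ContinuousOn (fun z : Minkowski × ℝ => rayPoint p' (f z.1) z.2)
        (B ×ˢ Icc (0 : ℝ) 3) := by
      refine (continuous_rayPoint p').comp_continuousOn (f := fun z : Minkowski × ℝ => (f z.1, z.2))
        (ContinuousOn.prodMk ?_ continuousOn_snd)
      exact hf.continuousOn.comp continuousOn_fst fun z hz => hz.1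
    exact hg.congr fun z hz => hF z.1 hz.1 z.2 hz.2
  · intro x hx
    exact hX'.mem _ (hmaps (hβ x hx)) _ (hX'.raySpeed_mem hp' (hmaps (hβ x hx)) (hτ x hx))
  · intro x hx y hy h
    rw [← hβτ x hx, ← hβτ y hy]
    exact (hker _ (hβ x hx) _ (hβ y hy) _ (hτ x hx) _ (hτ y hy)).2 h
  · intro y hy
    obtain ⟨b', hb', t, ht, rfl⟩ := hX'.exists_rayPoint hy
    obtain ⟨b, hb, rfl⟩ := hf.bijOn.surjOn hb'
    exact ⟨_, hmem b hb t ht, hF b hb t ht⟩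
  · intro x hx
    have := hX.sameCharacter hp hX' hp' (hβ x hx) (hmaps (hβ x hx))
      (hf.sameCharacter _ (hβ x hx)) (hτ x hx)
    rwa [hβτ x hx] at this
  · intro b hb
    have := hF b hb 3 h3
    -- Time 3 is the base point itself, so the extension restricts to `f`.
    rwa [rayPoint_three, rayPoint_three] at this

end

end LorentzCausal

/-! ### Simplices transverse to the lightcone. -/

namespace LorentzCausal

open Set Filter Topology

/-- At a null vector the square norm has derivative 2⟨x, y⟩ in direction `y`; when this is nonzero,
a small move in the right direction makes the vector timelike. The choice -⟨x, y⟩ has the right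
sign. -/
theorem exists_perturbation {ε : ℤˣ} {x y : Minkowski} (hx : x ∈ lightcone ε)
    (hxy : mink x y ≠ 0) :
    ∃ σ : ℝ, ∀ᶠ t in 𝓝[>] (0 : ℝ), x + (t * σ) • y ∈ timelike ε := by
  refine ⟨-mink x y, ?_⟩
  have h1 : ∀ᶠ t in 𝓝 (0 : ℝ), 0 < ((ε : ℤ) : ℝ) * (x + (t * -mink x y) • y) 0 := by
    have hc : Continuous fun t : ℝ => ((ε : ℤ) : ℝ) * (x 0 + t * -mink x y * y 0) := by
      fun_prop
    exact hc.continuousAt.eventually (lt_mem_nhds (by simpa using hx.2))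
  have h2 : ∀ᶠ t in 𝓝 (0 : ℝ),
      2 * (-mink x y * mink x y) + t * (mink x y ^ 2 * mink y y) < 0 := by
    have hc : Continuous fun t : ℝ =>
        2 * (-mink x y * mink x y) + t * (mink x y ^ 2 * mink y y) := by fun_prop
    refine hc.continuousAt.eventually (gt_mem_nhds ?_)
    have := sq_pos_of_ne_zero hxy
    linarith
  filter_upwards [h1.filter_mono nhdsWithin_le_nhds, h2.filter_mono nhdsWithin_le_nhds,
    self_mem_nhdsWithin] with t h1 h2 ht
  refine ⟨?_, h1⟩
  rw [mink_add_left, mink_add_right, mink_add_right, mink_smul_left, mink_smul_left,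
    mink_smul_right, mink_smul_right, hx.1, mink_comm y x]
  have := mul_neg_of_pos_of_neg (show (0 : ℝ) < t from ht) h2
  linarith

section simplex

variable {ι : Type*} {w w' : ι → Minkowski}

/-- The closed face of a simplex, given by its set of vertices. -/
abbrev simplexFace (w : ι → Minkowski) (s : Set ι) : Set Minkowski := convexHull ℝ (w '' s)

theorem simplexFace_mono {s t : Set ι} (h : s ⊆ t) : simplexFace w s ⊆ simplexFace w t :=
  convexHull_mono (image_mono h)

theorem single_one_nonneg [DecidableEq ι] (i j : ι) : (0 : ℝ) ≤ (Pi.single i 1 : ι → ℝ) j := by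
  rcases eq_or_ne j i with rfl | h
  · simp
  · simp [h]

variable [Fintype ι]

/-- The linear combination with coefficients `a` of the family `w`. -/
abbrev comb (w : ι → Minkowski) : (ι → ℝ) →ₗ[ℝ] Minkowski := Fintype.linearCombination ℝ w

theorem continuous_comb (w : ι → Minkowski) : Continuous (comb w) :=
  LinearMap.continuous_of_finiteDimensional _

theorem comb_injective (hw : LinearIndependent ℝ w) : Function.Injective (comb w) :=
  hw.fintypeLinearCombination_injective

theorem mem_simplexFace {s : Set ι} {x : Minkowski} :
    x ∈ simplexFace w s ↔ ∃ a ∈ stdSimplex ℝ ι, (∀ i ∉ s, a i = 0) ∧ comb w a = x := by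
  classical
  constructor
  · have hconv : Convex ℝ (comb w '' (stdSimplex ℝ ι ∩ {a | ∀ i ∉ s, a i = 0})) := by
      refine ((convex_stdSimplex ℝ ι).inter ?_).linear_image _
      intro a ha b hb u v _ _ _ i hi
      simp [ha i hi, hb i hi]
    have hsub : w '' s ⊆ comb w '' (stdSimplex ℝ ι ∩ {a | ∀ i ∉ s, a i = 0}) := by
      rintro _ ⟨i, hi, rfl⟩
      refine ⟨Pi.single i 1, ⟨single_mem_stdSimplex ℝ i, fun j hj => ?_⟩, by simp⟩
      exact Pi.single_eq_of_ne (fun h : j = i => hj (by rwa [h])) _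
    intro hx
    obtain ⟨a, ⟨h1, h2⟩, h3⟩ := convexHull_min hsub hconv hx
    exact ⟨a, h1, h2, h3⟩
  · rintro ⟨a, ha, has, rfl⟩
    rw [Fintype.linearCombination_apply,
      ← Finset.sum_filter_add_sum_filter_not Finset.univ (fun i => i ∈ s)]
    have h0 : ∀ i ∈ Finset.univ.filter (fun i => i ∉ s), a i = 0 := by
      intro i hi
      exact has i (by simpa using hi)
    rw [Finset.sum_eq_zero (s := Finset.univ.filter (fun i => i ∉ s)) (fun i hi => by
      rw [h0 i hi, zero_smul]), add_zero]
    refine (convex_convexHull ℝ _).sum_mem (fun i _ => ha.1 i) ?_ fun i hi => ?_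
    · rw [← ha.2, ← Finset.sum_filter_add_sum_filter_not Finset.univ (fun i => i ∈ s) a,
        Finset.sum_eq_zero h0, add_zero]
    · exact subset_convexHull ℝ _ ⟨i, by simpa using hi, rfl⟩

theorem mem_simplex {x : Minkowski} :
    x ∈ simplexFace w univ ↔ ∃ a ∈ stdSimplex ℝ ι, comb w a = x := by
  simp [mem_simplexFace]

theorem comb_mem_simplexFace (hw : LinearIndependent ℝ w) {s : Set ι} {a : ι → ℝ}
    (ha : a ∈ stdSimplex ℝ ι) : comb w a ∈ simplexFace w s ↔ ∀ i ∉ s, a i = 0 := by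
  rw [mem_simplexFace]
  constructor
  · rintro ⟨b, _, hb, h⟩
    rwa [← comb_injective hw h]
  · exact fun h => ⟨a, ha, h, rfl⟩

theorem isCompact_simplexFace (s : Set ι) : IsCompact (simplexFace w s) :=
  ((toFinite s).image w).isCompact_convexHull ℝ

/-- The relative boundary of a simplex. -/
def simplexBoundary (w : ι → Minkowski) : Set Minkowski := ⋃ i, simplexFace w {i}ᶜ

theorem mem_simplexBoundary {x : Minkowski} :
    x ∈ simplexBoundary w ↔ ∃ a ∈ stdSimplex ℝ ι, (∃ i, a i = 0) ∧ comb w a = x := by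
  simp only [simplexBoundary, mem_iUnion, mem_simplexFace, mem_compl_iff, mem_singleton_iff,
    not_not, forall_eq]
  constructor
  · rintro ⟨i, a, h1, h2, h3⟩
    exact ⟨a, h1, ⟨i, h2⟩, h3⟩
  · rintro ⟨a, h1, ⟨i, h2⟩, h3⟩
    exact ⟨i, a, h1, h2, h3⟩

/-- In barycentric coordinates, the ray from the interior point `a` through `c` leaves the simplex
where the coordinate with the smallest ratio `c i / a i` vanishes. Linear independence keeps the
lines in direction of the apex away from the origin. -/
theorem isConeOver_simplex [Nontrivial ι] (hw : LinearIndependent ℝ w) {a : ι → ℝ}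
    (ha : ∀ i, 0 < a i) (ha1 : ∑ i, a i = 1) :
    IsConeOver (comb w a) (simplexBoundary w) (simplexFace w univ) := by
  classical
  have haS : a ∈ stdSimplex ℝ ι := ⟨fun i => (ha i).le, ha1⟩
  have hinj := comb_injective hw
  refine ⟨isCompact_iUnion fun i => isCompact_simplexFace _, ?_, ?_, ?_, ?_⟩
  · intro b hb k hk
    obtain ⟨c, hc, ⟨i, hi⟩, rfl⟩ := mem_simplexBoundary.1 hb
    rw [← map_smul, ← map_add] at hk
    have h0 : k • a + c = 0 := hinj (by rw [hk, map_zero])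
    have hk0 : k = 0 := by
      have := congrFun h0 i
      simpa [hi, (ha i).ne'] using this
    have hc0 : c = 0 := by simpa [hk0] using h0
    have := hc.2
    simp [hc0] at this
  · intro b hb r hr
    obtain ⟨c, hc, _, rfl⟩ := mem_simplexBoundary.1 hb
    rw [← map_smul, ← map_smul, ← map_add]
    exact mem_simplex.2 ⟨_, convex_stdSimplex ℝ ι haS hc (by linarith [hr.2]) hr.1 (by ring), rfl⟩
  · intro x hx
    obtain ⟨c, hc, rfl⟩ := mem_simplex.1 hx
    obtain ⟨i, -, hi⟩ := Finset.exists_min_image Finset.univ (fun i => c i / a i)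
      Finset.univ_nonempty
    have hm : ∀ j, c i / a i * a j ≤ c j := fun j => by
      have := hi j (Finset.mem_univ j)
      rwa [le_div_iff₀ (ha j)] at this
    set m := c i / a i with hmdef
    have hm0 : 0 ≤ m := div_nonneg (hc.1 i) (ha i).le
    have hsum : ∑ j, (c j - m * a j) = 1 - m := by
      rw [Finset.sum_sub_distrib, ← Finset.mul_sum, ha1, mul_one, hc.2]
    have hm1 : m ≤ 1 := by
      have : 0 ≤ ∑ j, (c j - m * a j) := Finset.sum_nonneg fun j _ => by linarith [hm j]
      linarith
    rcases hm1.eq_or_lt with h1 | h1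
    · have hz : ∀ j, c j - m * a j = 0 := by
        rw [h1, sub_self] at hsum
        intro j
        rw [h1]
        exact (Finset.sum_eq_zero_iff_of_nonneg (fun j _ => by
          have := hm j; rw [h1] at this; linarith)).1 hsum j (Finset.mem_univ j)
      have hca : c = a := by
        ext j
        have := hz j
        rw [h1] at this
        linarith
      obtain ⟨j, hj⟩ := exists_ne i
      -- The point is the apex itself, so `r = 0` works with any base point, here a vertex.
      exact ⟨comb w (Pi.single i 1), mem_simplexBoundary.2
        ⟨_, single_mem_stdSimplex ℝ i, ⟨j, Pi.single_eq_of_ne hj _⟩, rfl⟩, 0, by simp,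
        by simp [hca]⟩
    · have hr : 0 < 1 - m := by linarith
      refine ⟨comb w ((1 - m)⁻¹ • (c - m • a)), mem_simplexBoundary.2 ⟨_, ⟨fun j => ?_, ?_⟩,
        ⟨i, ?_⟩, rfl⟩, 1 - m, ⟨hr.le, by linarith⟩, ?_⟩
      · have := hm j
        simp only [Pi.smul_apply, Pi.sub_apply, smul_eq_mul]
        exact mul_nonneg (inv_nonneg.2 hr.le) (by linarith)
      · simp only [Pi.smul_apply, Pi.sub_apply, smul_eq_mul]
        rw [← Finset.mul_sum, hsum, inv_mul_cancel₀ hr.ne']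
      · simp [hmdef, div_mul_cancel₀ _ (ha i).ne']
      · rw [← map_smul, ← map_smul, ← map_add, smul_inv_smul₀ hr.ne']
        congr 1
        ext j
        simp
  · intro b hb b' hb' r hr r' hr' h
    obtain ⟨c, hc, ⟨i, hi⟩, rfl⟩ := mem_simplexBoundary.1 hb
    obtain ⟨c', hc', ⟨j, hj⟩, rfl⟩ := mem_simplexBoundary.1 hb'
    simp only [← map_smul, ← map_add] at h
    have h' := hinj h
    have e1 := congrFun h' i
    have e2 := congrFun h' j
    simp only [Pi.add_apply, Pi.smul_apply, smul_eq_mul, hi, hj, mul_zero, add_zero] at e1 e2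
    -- A vanishing coordinate of each base point gives one of the two inequalities between `r` and
    -- `r'`.
    have f1 : (1 - r') * a i ≤ (1 - r) * a i := by nlinarith [mul_nonneg hr'.1 (hc'.1 i)]
    have f2 : (1 - r) * a j ≤ (1 - r') * a j := by nlinarith [mul_nonneg hr.1 (hc.1 j)]
    have g1 := le_of_mul_le_mul_right f1 (ha i)
    have g2 := le_of_mul_le_mul_right f2 (ha j)
    have hrr : r = r' := by linarith
    refine ⟨hrr, fun h0 => ?_⟩
    rw [← hrr] at h'
    rw [smul_right_injective _ h0 (add_left_cancel h')]

/-- The open cone spanned by the family `w` meets the timelike region `ε`. -/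
def MeetsTimelike (w : ι → Minkowski) (ε : ℤˣ) : Prop :=
  ∃ a : ι → ℝ, (∀ i, 0 < a i) ∧ comb w a ∈ timelike ε

/-- The open cone spanned by the family `w` meets the lightcone `ε`. -/
def MeetsLightcone (w : ι → Minkowski) (ε : ℤˣ) : Prop :=
  ∃ a : ι → ℝ, (∀ i, 0 < a i) ∧ comb w a ∈ lightcone ε

/-- No face of the simplicial cone spanned by `w` is tangent to the lightcone. -/
def IsTransverse (w : ι → Minkowski) : Prop :=
  ∀ a : ι → ℝ, (∀ i, 0 ≤ a i) → a ≠ 0 → mink (comb w a) (comb w a) = 0 →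
    ∃ i, 0 < a i ∧ mink (comb w a) (w i) ≠ 0

/-- The timelike region is open, so all coefficients can be raised slightly: a timelike point on the
boundary yields one in the interior. -/
theorem MeetsTimelike.of_nonneg {ε : ℤˣ} {a : ι → ℝ} (ha : ∀ i, 0 ≤ a i)
    (h : comb w a ∈ timelike ε) : MeetsTimelike w ε := by
  have hc : Continuous fun t : ℝ => comb w (a + t • 1) := (continuous_comb w).comp (by fun_prop)
  have h0 : ∀ᶠ t in 𝓝 (0 : ℝ), comb w (a + t • 1) ∈ timelike ε :=
    hc.continuousAt.eventually_mem (by simpa using (isOpen_timelike ε).mem_nhds h)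
  obtain ⟨t, ht, ht0⟩ := ((h0.filter_mono nhdsWithin_le_nhds).and
    (self_mem_nhdsWithin : Ioi (0 : ℝ) ∈ 𝓝[>] 0)).exists
  refine ⟨_, fun i => ?_, ht⟩
  have : (0 : ℝ) < t := ht0
  simpa using add_pos_of_nonneg_of_pos (ha i) this

/-- The null point is moved along a non-orthogonal vertex vector. Its coefficient is positive, so a
small move of either sign keeps the coefficients nonnegative. -/
theorem IsTransverse.meetsTimelike (hw : IsTransverse w) {ε : ℤˣ} {a : ι → ℝ} (ha : ∀ i, 0 ≤ a i)
    (h : comb w a ∈ lightcone ε) : MeetsTimelike w ε := by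
  classical
  have ha0 : a ≠ 0 := by
    rintro rfl
    have := h.2
    simp at this
  obtain ⟨i, hi, hm⟩ := hw a ha ha0 h.1
  obtain ⟨σ, hσ⟩ := exists_perturbation h hm
  have h3 : ∀ᶠ t in 𝓝 (0 : ℝ), 0 < a i + t * σ := by
    have hc' : Continuous fun t : ℝ => a i + t * σ := by fun_prop
    exact hc'.continuousAt.eventually (lt_mem_nhds (by simpa using hi))
  obtain ⟨t, h1, h3⟩ := (hσ.and (h3.filter_mono nhdsWithin_le_nhds)).exists
  refine MeetsTimelike.of_nonneg (a := a + t • Pi.single i σ) (fun j => ?_) ?_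
  · rcases eq_or_ne j i with rfl | hj
    · simpa using h3.le
    · simpa [hj] using ha j
  · rwa [map_add, map_smul, Fintype.linearCombination_apply_single, smul_smul]

theorem IsTransverse.vertex_ne (hw : IsTransverse w) (i : ι) : mink (w i) (w i) ≠ 0 := by
  classical
  intro h
  obtain ⟨j, hj, hj'⟩ := hw (Pi.single i 1) (single_one_nonneg i) (by simp) (by simpa using h)
  rcases eq_or_ne j i with rfl | hji
  · simp [h] at hj'
  · simp [hji] at hj

theorem MeetsTimelike.of_vertex {ε : ℤˣ} {i : ι} (h : w i ∈ timelike ε) : MeetsTimelike w ε := by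
  classical
  exact MeetsTimelike.of_nonneg (a := Pi.single i 1) (single_one_nonneg i) (by simpa using h)

theorem ray_ne_zero_of_pos [Nontrivial ι] (hw : LinearIndependent ℝ w) {a : ι → ℝ}
    (ha : ∀ i, 0 < a i) (i : ι) (k : ℝ) : k • comb w a + w i ≠ 0 := by
  classical
  intro h
  obtain ⟨j, hj⟩ := exists_ne i
  have e : comb w (k • a + Pi.single i 1) = k • comb w a + w i := by simp
  have h0 : k • a + Pi.single i 1 = 0 := comb_injective hw (by rw [e, h, map_zero])
  have h1 := congrFun h0 j
  have h2 := congrFun h0 i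
  simp [hj, (ha j).ne'] at h1
  simp [h1] at h2

/-- The segment from an interior point in I_ε to a vertex outside I_ε must cross L_ε. The vertex is
not null, so the crossing comes before it, at a positive root, where all coefficients are positive.
-/
theorem IsTransverse.meetsLightcone_of_vertex [Nontrivial ι] (hw : IsTransverse w)
    (hli : LinearIndependent ℝ w) {ε : ℤˣ} (h : MeetsTimelike w ε) {i : ι}
    (hi : w i ∉ timelike ε) : MeetsLightcone w ε := by
  classical
  obtain ⟨a, ha, hp⟩ := h
  have hne := ray_ne_zero_of_pos hli ha i
  have hk : 0 < rootHi (comb w a) (w i) := by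
    have h1 := ray_mem_timelike hp hne (k := 0)
    have h2 := ray_mem_lightcone hp hne (k := 0)
    rw [zero_smul, zero_add] at h1 h2
    rw [h1, not_lt] at hi
    refine lt_of_le_of_ne hi fun h => ?_
    exact hw.vertex_ne i (h2.2 h).1
  refine ⟨rootHi (comb w a) (w i) • a + Pi.single i 1, fun j => ?_, ?_⟩
  · exact add_pos_of_pos_of_nonneg (mul_pos hk (ha j)) (single_one_nonneg i j)
  · have := (ray_mem_lightcone hp hne).2 rfl
    simpa using this

theorem sum_smul_mem_timelike {ε : ℤˣ} {a : ι → ℝ} (ha : ∀ i, 0 ≤ a i) (h0 : a ≠ 0)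
    (h : ∀ i, w i ∈ timelike ε) : comb w a ∈ timelike ε := by
  classical
  rw [Fintype.linearCombination_apply]
  obtain ⟨i, hi⟩ := Function.ne_iff.1 h0
  have hi' : 0 < a i := lt_of_le_of_ne (ha i) (Ne.symm hi)
  rw [← Finset.add_sum_erase _ _ (Finset.mem_univ i)]
  have key : ∀ s : Finset ι, ∀ x ∈ timelike ε, x + ∑ j ∈ s, a j • w j ∈ timelike ε := by
    intro s
    induction s using Finset.induction_on with
    | empty => simp
    | insert j s hj ih =>
      intro x hx
      rw [Finset.sum_insert hj, ← add_assoc]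
      refine ih _ ?_
      rcases (ha j).eq_or_lt with hz | hz
      · simpa [← hz] using hx
      · exact add_mem_timelike hx ((smul_mem_timelike hz).2 (h j))
  exact key _ _ ((smul_mem_timelike hi').2 (h i))

theorem IsTransverse.meetsLightcone_iff [Nontrivial ι] (hw : IsTransverse w)
    (hli : LinearIndependent ℝ w) {ε : ℤˣ} :
    MeetsLightcone w ε ↔ MeetsTimelike w ε ∧ ∃ i, w i ∉ timelike ε := by
  constructor
  · rintro ⟨a, ha, h⟩
    refine ⟨hw.meetsTimelike (fun i => (ha i).le) h, ?_⟩
    by_contra! hall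
    have h0 : a ≠ 0 := by
      rintro rfl
      have := h.2
      simp at this
    exact timelike_not_lightcone (sum_smul_mem_timelike (fun i => (ha i).le) h0 hall) h
  · rintro ⟨h, i, hi⟩
    exact hw.meetsLightcone_of_vertex hli h hi

/-- This translates the observable pattern (lightcones and vertices) into the timelike regions met,
which supply the apices of the cone construction. -/
theorem IsTransverse.meetsTimelike_iff [Nontrivial ι] (hw : IsTransverse w)
    (hli : LinearIndependent ℝ w) {ε : ℤˣ} :
    MeetsTimelike w ε ↔ MeetsLightcone w ε ∨ ∃ i, w i ∈ timelike ε := by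
  constructor
  · intro h
    by_cases hi : ∃ i, w i ∈ timelike ε
    · exact Or.inr hi
    · push Not at hi
      obtain ⟨i⟩ : Nonempty ι := inferInstance
      exact Or.inl (hw.meetsLightcone_of_vertex hli h (hi i))
  · rintro (h | ⟨i, hi⟩)
    · exact ((hw.meetsLightcone_iff hli).1 h).1
    · exact .of_vertex hi

theorem IsTransverse.mem_spacelike (hw : IsTransverse w) (hli : LinearIndependent ℝ w)
    (h : ∀ ε, ¬ MeetsTimelike w ε) {a : ι → ℝ} (ha : ∀ i, 0 ≤ a i) (h0 : a ≠ 0) :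
    comb w a ∈ spacelike := by
  by_contra hs
  have hs' : mink (comb w a) (comb w a) ≤ 0 := not_lt.1 hs
  have hne : comb w a ≠ 0 := fun h1 => h0 (comb_injective hli (by rw [h1, map_zero]))
  obtain ⟨ε, hε⟩ := exists_sign_of_causal hs' hne
  rcases hs'.lt_or_eq with h1 | h1
  · exact h ε (.of_nonneg ha ⟨h1, hε⟩)
  · exact h ε (hw.meetsTimelike ha ⟨h1, hε⟩)

theorem MeetsTimelike.exists_normalized [Nonempty ι] {ε : ℤˣ} (h : MeetsTimelike w ε) :
    ∃ a : ι → ℝ, (∀ i, 0 < a i) ∧ ∑ i, a i = 1 ∧ comb w a ∈ timelike ε := by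
  obtain ⟨a, ha, h⟩ := h
  have hs : 0 < ∑ i, a i := Finset.sum_pos (fun i _ => ha i) Finset.univ_nonempty
  refine ⟨(∑ i, a i)⁻¹ • a, fun i => mul_pos (inv_pos.2 hs) (ha i), ?_, ?_⟩
  · simp only [Pi.smul_apply, smul_eq_mul]
    rw [← Finset.mul_sum, inv_mul_cancel₀ hs.ne']
  · rw [map_smul]
    exact (smul_mem_timelike (inv_pos.2 hs)).2 h

theorem ne_zero_of_mem_stdSimplex {a : ι → ℝ} (ha : a ∈ stdSimplex ℝ ι) : a ≠ 0 := by
  rintro rfl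
  have := ha.2
  simp at this

theorem exists_linearMap_comb (hw : LinearIndependent ℝ w) (w' : ι → Minkowski) :
    ∃ L : Minkowski →ₗ[ℝ] Minkowski, ∀ a, L (comb w a) = comb w' a := by
  have hinj := comb_injective hw
  obtain ⟨g, hg⟩ := (comb w).exists_leftInverse_of_injective (LinearMap.ker_eq_bot.2 hinj)
  exact ⟨comb w' ∘ₗ g, fun a => congrArg (comb w') (LinearMap.congr_fun hg a)⟩

/-- A causal map between the boundaries of two simplices extends to the simplices; if there are no
timelike points, then the affine map takes its place. -/
theorem exists_causalMap_simplex [Nontrivial ι] {δ : ℤˣ} (hw : LinearIndependent ℝ w)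
    (hw' : LinearIndependent ℝ w') (ht : IsTransverse w) (ht' : IsTransverse w')
    (hm : ∀ ε, MeetsTimelike w ε ↔ MeetsTimelike w' (δ * ε)) {f : Minkowski → Minkowski}
    (hf : IsCausalMap δ f (simplexBoundary w) (simplexBoundary w')) :
    ∃ F, IsCausalMap δ F (simplexFace w univ) (simplexFace w' univ) ∧
      (EqOn F f (simplexBoundary w) ∨ ∀ a, F (comb w a) = comb w' a) := by
  by_cases h : ∃ ε, MeetsTimelike w ε
  · obtain ⟨ε, h⟩ := h
    obtain ⟨a, ha, ha1, hp⟩ := h.exists_normalized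
    obtain ⟨a', ha', ha1', hp'⟩ := ((hm ε).1 h).exists_normalized
    obtain ⟨F, h1, h2⟩ := (isConeOver_simplex hw ha ha1).exists_extension hp
      (isConeOver_simplex hw' ha' ha1') hp' hf
    exact ⟨F, h1, Or.inl h2⟩
  -- The boundary map is discarded here. The substitute preserves barycentric coordinates and thus
  -- every face, which is all that is needed later.
  · push Not at h
    have h' : ∀ ε, ¬ MeetsTimelike w' ε := by
      intro ε hε
      refine h (δ * ε) ((hm _).2 ?_)
      rwa [← mul_assoc, Int.units_mul_self, one_mul]
    obtain ⟨L, hL⟩ := exists_linearMap_comb hw w'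
    refine ⟨L, ⟨L.continuous_of_finiteDimensional.continuousOn, ⟨?_, ?_, ?_⟩, ?_⟩, Or.inr hL⟩
    · intro x hx
      obtain ⟨a, ha, rfl⟩ := mem_simplex.1 hx
      rw [hL]
      exact mem_simplex.2 ⟨a, ha, rfl⟩
    · intro x hx y hy hxy
      obtain ⟨a, ha, rfl⟩ := mem_simplex.1 hx
      obtain ⟨b, hb, rfl⟩ := mem_simplex.1 hy
      rw [hL, hL] at hxy
      rw [comb_injective hw' hxy]
    · intro y hy
      obtain ⟨a, ha, rfl⟩ := mem_simplex.1 hy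
      exact ⟨comb w a, mem_simplex.2 ⟨a, ha, rfl⟩, hL a⟩
    · intro x hx
      obtain ⟨a, ha, rfl⟩ := mem_simplex.1 hx
      rw [hL]
      exact .of_spacelike (ht.mem_spacelike hw h ha.1 (ne_zero_of_mem_stdSimplex ha))
        (ht'.mem_spacelike hw' h' ha.1 (ne_zero_of_mem_stdSimplex ha))

theorem IsTransverse.sameCharacter_vertex (ht : IsTransverse w) (hw : LinearIndependent ℝ w)
    (ht' : IsTransverse w') (hw' : LinearIndependent ℝ w') {δ : ℤˣ} {i : ι}
    (h : ∀ ε, w i ∈ timelike ε ↔ w' i ∈ timelike (δ * ε)) : SameCharacter δ (w i) (w' i) := by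
  have key : ∀ {u : ι → Minkowski}, IsTransverse u → LinearIndependent ℝ u →
      (∃ ε, u i ∈ timelike ε) ∨ u i ∈ spacelike := by
    intro u hu hli
    rcases lt_or_gt_of_ne (hu.vertex_ne i) with h1 | h1
    · obtain ⟨ε, hε⟩ := exists_sign_of_causal h1.le (hli.ne_zero i)
      exact Or.inl ⟨ε, h1, hε⟩
    · exact Or.inr h1
  rcases key ht hw with ⟨ε, hε⟩ | hs
  · exact .of_timelike hε ((h ε).1 hε)
  · rcases key ht' hw' with ⟨ε, hε⟩ | hs'
    · refine absurd ((h (δ * ε)).2 ?_) (spacelike_not_timelike hs)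
      rwa [← mul_assoc, Int.units_mul_self, one_mul]
    · exact .of_spacelike hs hs'

end simplex

/-! ### Faces, and causal maps of edges and triangles. -/

section subfamily

variable {ι κ : Type*} [Fintype ι] [Fintype κ] {w w' : ι → Minkowski}

theorem comb_extend {e : κ → ι} (he : Function.Injective e) (a : κ → ℝ) :
    comb w (Function.extend e a 0) = comb (w ∘ e) a := by
  rw [Fintype.linearCombination_apply, Fintype.linearCombination_apply]
  symm
  refine Fintype.sum_of_injective e he _ _ (fun i hi => ?_) fun k => ?_
  · rw [Function.extend_apply' _ _ _ hi]
    simp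
  · rw [he.extend_apply]
    rfl

/-- Coefficients are extended by zero. Since transversality provides an index with positive
coefficient, that index belongs to the subfamily. -/
theorem IsTransverse.comp (hw : IsTransverse w) {e : κ → ι} (he : Function.Injective e) :
    IsTransverse (w ∘ e) := by
  intro a ha h0 hq
  rw [← comb_extend he] at hq ⊢
  have hcases : ∀ i, (∃ k, e k = i ∧ Function.extend e a 0 i = a k) ∨
      Function.extend e a 0 i = 0 := by
    intro i
    by_cases hi : ∃ k, e k = i
    · obtain ⟨k, rfl⟩ := hi
      exact Or.inl ⟨k, rfl, he.extend_apply _ _ _⟩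
    · exact Or.inr (Function.extend_apply' _ _ _ hi)
  obtain ⟨i, hi, hm⟩ := hw (Function.extend e a 0) (fun i => by
    rcases hcases i with ⟨k, _, h⟩ | h
    · rw [h]; exact ha k
    · rw [h]) (fun h => h0 (by
      ext k
      have := congrFun h (e k)
      rwa [he.extend_apply] at this)) hq
  rcases hcases i with ⟨k, rfl, h⟩ | h
  · exact ⟨k, h ▸ hi, hm⟩
  · exact absurd h hi.ne'

end subfamily

theorem mem_simplexBoundary_two {w : Fin 2 → Minkowski} {x : Minkowski} :
    x ∈ simplexBoundary w ↔ ∃ i, w i = x := by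
  have h : ∀ i : Fin 2, simplexFace w {i}ᶜ = {w (1 - i)} := by
    intro i
    have : ({i}ᶜ : Set (Fin 2)) = {1 - i} := by
      ext j
      fin_cases i <;> fin_cases j <;> simp
    rw [simplexFace, this, image_singleton, convexHull_singleton]
  simp only [simplexBoundary, mem_iUnion, h, mem_singleton_iff]
  constructor
  · rintro ⟨i, rfl⟩
    exact ⟨_, rfl⟩
  · rintro ⟨i, rfl⟩
    exact ⟨1 - i, by simp⟩

/-- The boundary consists of two vertices of equal characters, so the linear map that matches them
is a causal map there. Control of the vertices is needed to glue the edges. -/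
theorem exists_causalMap_edge {w w' : Fin 2 → Minkowski} {δ : ℤˣ} (hw : LinearIndependent ℝ w)
    (hw' : LinearIndependent ℝ w') (ht : IsTransverse w) (ht' : IsTransverse w')
    (hv : ∀ i ε, w i ∈ timelike ε ↔ w' i ∈ timelike (δ * ε))
    (hm : ∀ ε, MeetsTimelike w ε ↔ MeetsTimelike w' (δ * ε)) :
    ∃ F, IsCausalMap δ F (simplexFace w univ) (simplexFace w' univ) ∧ ∀ i, F (w i) = w' i := by
  classical
  obtain ⟨L, hL⟩ := exists_linearMap_comb hw w'
  have hLi : ∀ i, L (w i) = w' i := fun i => by simpa using hL (Pi.single i 1)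
  have hf : IsCausalMap δ L (simplexBoundary w) (simplexBoundary w') := by
    refine ⟨L.continuous_of_finiteDimensional.continuousOn, ⟨?_, ?_, ?_⟩, ?_⟩
    · intro x hx
      obtain ⟨i, rfl⟩ := mem_simplexBoundary_two.1 hx
      exact mem_simplexBoundary_two.2 ⟨i, (hLi i).symm⟩
    · intro x hx y hy hxy
      obtain ⟨i, rfl⟩ := mem_simplexBoundary_two.1 hx
      obtain ⟨j, rfl⟩ := mem_simplexBoundary_two.1 hy
      rw [hLi, hLi] at hxy
      rw [hw'.injective hxy]
    · intro y hy
      obtain ⟨i, rfl⟩ := mem_simplexBoundary_two.1 hy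
      exact ⟨w i, mem_simplexBoundary_two.2 ⟨i, rfl⟩, hLi i⟩
    · intro x hx
      obtain ⟨i, rfl⟩ := mem_simplexBoundary_two.1 hx
      rw [hLi]
      exact ht.sameCharacter_vertex hw ht' hw' (hv i)
  obtain ⟨F, hF, h⟩ := exists_causalMap_simplex hw hw' ht ht' hm hf
  refine ⟨F, hF, fun i => ?_⟩
  rcases h with h | h
  · rw [h (mem_simplexBoundary_two.2 ⟨i, rfl⟩), hLi]
  · simpa using h (Pi.single i 1)

theorem exists_glue {ι A B : Type*} {S : ι → Set A} {f : ι → A → B} (g : A → B)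
    (h : ∀ i j, ∀ x ∈ S i, x ∈ S j → f i x = f j x) : ∃ F : A → B, ∀ i, EqOn F (f i) (S i) := by
  classical
  refine ⟨fun x => if hx : ∃ i, x ∈ S i then f hx.choose x else g x, fun i x hi => ?_⟩
  have hx : ∃ i, x ∈ S i := ⟨i, hi⟩
  simp only [hx, dif_pos]
  exact h _ _ _ hx.choose_spec hi

theorem simplexFace_succAbove {n : ℕ} (w : Fin (n + 1) → Minkowski) (k : Fin (n + 1)) :
    simplexFace (w ∘ k.succAbove) univ = simplexFace w {k}ᶜ := by
  rw [simplexFace, image_univ, range_comp, Fin.range_succAbove]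

theorem mem_two_edges {w : Fin 3 → Minkowski} (hw : LinearIndependent ℝ w) {i j : Fin 3}
    (hij : i ≠ j) {x : Minkowski} (hi : x ∈ simplexFace w {i}ᶜ) (hj : x ∈ simplexFace w {j}ᶜ) :
    ∃ l, l ≠ i ∧ l ≠ j ∧ x = w l := by
  obtain ⟨a, ha, hai, rfl⟩ := mem_simplexFace.1 hi
  have haj := (comb_mem_simplexFace hw ha).1 hj
  have h1 := hai i (by simp)
  have h2 := haj j (by simp)
  have hs := ha.2
  simp only [Fin.sum_univ_three] at hs
  simp only [Fintype.linearCombination_apply, Fin.sum_univ_three]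
  fin_cases i <;> fin_cases j <;> first | exact absurd rfl hij | skip
  all_goals simp only [Fin.zero_eta, Fin.mk_one, Fin.reduceFinMk] at h1 h2
  all_goals simp only [h1, h2, zero_add, add_zero] at hs
  all_goals simp only [h1, h2, hs, zero_smul, one_smul, zero_add, add_zero]
  · exact ⟨2, by decide, by decide, rfl⟩
  · exact ⟨1, by decide, by decide, rfl⟩
  · exact ⟨2, by decide, by decide, rfl⟩
  · exact ⟨0, by decide, by decide, rfl⟩
  · exact ⟨1, by decide, by decide, rfl⟩
  · exact ⟨0, by decide, by decide, rfl⟩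

theorem vertex_mem_simplexFace {ι : Type*} (w : ι → Minkowski) {s : Set ι} {i : ι} (hi : i ∈ s) :
    w i ∈ simplexFace w s := subset_convexHull ℝ _ ⟨i, hi, rfl⟩

/-- Two transverse triangles with the same causal pattern admit a causal map that respects the
faces. -/
theorem exists_causalMap_triangle {w w' : Fin 3 → Minkowski} {δ : ℤˣ}
    (hw : LinearIndependent ℝ w) (hw' : LinearIndependent ℝ w') (ht : IsTransverse w)
    (ht' : IsTransverse w') (hv : ∀ i ε, w i ∈ timelike ε ↔ w' i ∈ timelike (δ * ε))
    (he : ∀ k ε, MeetsTimelike (w ∘ Fin.succAbove k) ε ↔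
      MeetsTimelike (w' ∘ Fin.succAbove k) (δ * ε))
    (hm : ∀ ε, MeetsTimelike w ε ↔ MeetsTimelike w' (δ * ε)) :
    ∃ F, IsCausalMap δ F (simplexFace w univ) (simplexFace w' univ) ∧
      ∀ k, BijOn F (simplexFace w {k}ᶜ) (simplexFace w' {k}ᶜ) := by
  have hinj : ∀ k : Fin 3, Function.Injective k.succAbove := fun k => Fin.succAbove_right_injective
  have hedge : ∀ k : Fin 3, ∃ f, IsCausalMap δ f (simplexFace w {k}ᶜ) (simplexFace w' {k}ᶜ) ∧
      ∀ i, i ≠ k → f (w i) = w' i := by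
    intro k
    obtain ⟨f, hf, hfv⟩ := exists_causalMap_edge (hw.comp _ (hinj k)) (hw'.comp _ (hinj k))
      (ht.comp (hinj k)) (ht'.comp (hinj k)) (fun i ε => hv _ ε) (he k)
    rw [simplexFace_succAbove, simplexFace_succAbove] at hf
    refine ⟨f, hf, fun i hi => ?_⟩
    obtain ⟨j, rfl⟩ := Fin.exists_succAbove_eq hi
    exact hfv j
  choose f hf hfv using hedge
  -- Different edges share only a vertex, where both edge maps have the prescribed value.
  obtain ⟨g, hg⟩ := exists_glue (S := fun k : Fin 3 => simplexFace w {k}ᶜ) (f := f) id (by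
    intro i j x hi hj
    rcases eq_or_ne i j with rfl | hij
    · rfl
    · obtain ⟨l, hli, hlj, rfl⟩ := mem_two_edges hw hij hi hj
      rw [hfv i l hli, hfv j l hlj])
  have hbij : ∀ k, BijOn g (simplexFace w {k}ᶜ) (simplexFace w' {k}ᶜ) := fun k =>
    (hf k).bijOn.congr (hg k).symm
  have hgv : ∀ l : Fin 3, g (w l) = w' l := by
    intro l
    obtain ⟨k, hk⟩ := exists_ne l
    rw [hg k (vertex_mem_simplexFace w (by simpa using hk.symm)), hfv k l hk.symm]
  have hcausal : IsCausalMap δ g (simplexBoundary w) (simplexBoundary w') := by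
    refine ⟨?_, ⟨?_, ?_, ?_⟩, ?_⟩
    · exact (locallyFinite_of_finite _).continuousOn_iUnion
        (fun k => (isCompact_simplexFace _).isClosed) fun k => (hf k).continuousOn.congr (hg k)
    · intro x hx
      obtain ⟨k, hk⟩ := mem_iUnion.1 hx
      exact mem_iUnion.2 ⟨k, (hbij k).mapsTo hk⟩
    · intro x hx y hy hxy
      obtain ⟨i, hi⟩ := mem_iUnion.1 hx
      obtain ⟨j, hj⟩ := mem_iUnion.1 hy
      rcases eq_or_ne i j with rfl | hij
      · exact (hbij i).injOn hi hj hxy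
      -- A common image of points on two different edges is a vertex, whose only preimage on each
      -- edge is the corresponding vertex.
      · obtain ⟨l, hli, hlj, hl⟩ := mem_two_edges hw' hij ((hbij i).mapsTo hi)
          (hxy ▸ (hbij j).mapsTo hj)
        have e1 : x = w l := (hbij i).injOn hi
          (vertex_mem_simplexFace w (by simpa using hli)) (by rw [hl, hgv])
        have e2 : y = w l := (hbij j).injOn hj
          (vertex_mem_simplexFace w (by simpa using hlj)) (by rw [← hxy, hl, hgv])
        rw [e1, e2]
    · intro y hy
      obtain ⟨k, hk⟩ := mem_iUnion.1 hy
      obtain ⟨x, hx, rfl⟩ := (hbij k).surjOn hk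
      exact ⟨x, mem_iUnion.2 ⟨k, hx⟩, rfl⟩
    · intro x hx
      obtain ⟨k, hk⟩ := mem_iUnion.1 hx
      rw [hg k hk]
      exact (hf k).sameCharacter x hk
  obtain ⟨F, hF, hext⟩ := exists_causalMap_simplex hw hw' ht ht' hm hcausal
  refine ⟨F, hF, fun k => ?_⟩
  rcases hext with h | h
  · exact (hbij k).congr fun x hx => (h (mem_iUnion.2 ⟨k, hx⟩)).symm
  · refine ⟨?_, hF.bijOn.injOn.mono (simplexFace_mono (subset_univ _)), ?_⟩
    · intro x hx
      obtain ⟨a, ha, h0, rfl⟩ := mem_simplexFace.1 hx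
      rw [h]
      exact mem_simplexFace.2 ⟨a, ha, h0, rfl⟩
    · intro y hy
      obtain ⟨a, ha, h0, rfl⟩ := mem_simplexFace.1 hy
      exact ⟨comb w a, mem_simplexFace.2 ⟨a, ha, h0, rfl⟩, h a⟩

/-- Every face is an intersection of facets, so for the triangle it is enough to control the three
edges. -/
theorem mem_simplexFace_iff_forall {ι : Type*} [Fintype ι] {w : ι → Minkowski}
    (hw : LinearIndependent ℝ w) {s : Set ι} {x : Minkowski} (hx : x ∈ simplexFace w univ) :
    x ∈ simplexFace w s ↔ ∀ k ∉ s, x ∈ simplexFace w {k}ᶜ := by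
  obtain ⟨a, ha, rfl⟩ := mem_simplex.1 hx
  simp [comb_mem_simplexFace hw ha]

/-! ### The vertices of a tetrahedron as a transverse family. -/

namespace Tetrahedron

variable (t : Tetrahedron)

theorem linearIndependent : LinearIndependent ℝ t.v := by
  have h := (affineIndependent_iff_linearIndependent_vsub ℝ t.vertex 0).1 t.affineIndependent
  simp only [t.vertex_zero, vsub_eq_sub, sub_zero] at h
  exact h.comp (fun i : Fin 3 => ⟨i.succ, Fin.succ_ne_zero i⟩) fun i j hij => by
    simpa using hij

theorem exists_mink_ne_zero {x : Minkowski} (hx : x ≠ 0) : ∃ i, mink x (t.v i) ≠ 0 := by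
  by_contra! h
  apply hx
  have hspan : ∀ y, mink x y = 0 := by
    intro y
    have hy : y ∈ Submodule.span ℝ (range t.v) := by
      rw [t.linearIndependent.span_eq_top_of_card_eq_finrank (by simp)]
      trivial
    induction hy using Submodule.span_induction with
    | mem y hy => obtain ⟨i, rfl⟩ := hy; exact h i
    | zero => simp [mink]
    | add y z _ _ hy hz => rw [mink_add_right, hy, hz, add_zero]
    | smul c y _ hy => rw [mink_smul_right, hy, mul_zero]
  ext i
  have := hspan (Pi.single i 1)
  fin_cases i <;> simpa [mink] using this

theorem vertex_ne (i : Fin 3) : mink (t.v i) (t.v i) ≠ 0 := by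
  have := t.edge_not_null i.succ 0 (Fin.succ_ne_zero i)
  rwa [t.vertex_zero, sub_zero] at this

theorem exists_mink_ne_zero_of_edge {i j : Fin 3} (hij : i ≠ j) {x : Minkowski} (hx : x ≠ 0)
    (hxs : x ∈ Submodule.span ℝ {t.v i, t.v j}) : mink x (t.v i) ≠ 0 ∨ mink x (t.v j) ≠ 0 := by
  by_contra! h
  refine t.face_not_null {0, i.succ, j.succ} ?_ ⟨x, ?_, hx, ?_⟩
  · rw [Finset.card_eq_three]
    exact ⟨0, i.succ, j.succ, (Fin.succ_ne_zero i).symm, (Fin.succ_ne_zero j).symm,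
      fun h => hij (Fin.succ_injective _ h), rfl⟩
  all_goals
    have hs : vectorSpan ℝ (t.vertex '' (({0, i.succ, j.succ} : Finset (Fin 4)) : Set (Fin 4))) =
        Submodule.span ℝ {t.v i, t.v j} := by
      have h0 : (0 : Minkowski) ∈
          t.vertex '' (({0, i.succ, j.succ} : Finset (Fin 4)) : Set (Fin 4)) :=
        ⟨0, by simp, t.vertex_zero⟩
      rw [vectorSpan_eq_span_vsub_set_right ℝ h0]
      simp [image_insert_eq, t.vertex_zero, Tetrahedron.v]
    rw [hs]
  · exact hxs
  · intro u hu
    induction hu using Submodule.span_induction with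
    | mem y hy =>
      rcases hy with rfl | rfl
      · exact h.1
      · exact h.2
    | zero => simp [mink]
    | add y z _ _ hy hz => rw [mink_add_right, hy, hz, add_zero]
    | smul c y _ hy => rw [mink_smul_right, hy, mul_zero]

/-- With three positive coefficients the vertices span the space, on which the form is
nondegenerate. With two, the face through the origin and the two vertices is not null. With one, the
edge from the origin is not null. -/
theorem isTransverse : IsTransverse t.v := by
  intro a ha h0 hq
  have hne : comb t.v a ≠ 0 := fun h => h0 (comb_injective t.linearIndependent (by
    rw [h, map_zero]))
  obtain ⟨i, hi⟩ := Function.ne_iff.1 h0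
  have hi' : 0 < a i := lt_of_le_of_ne (ha i) (Ne.symm hi)
  by_cases hall : ∀ k, 0 < a k
  · obtain ⟨k, hk⟩ := t.exists_mink_ne_zero hne
    exact ⟨k, hall k, hk⟩
  · push Not at hall
    obtain ⟨k, hk⟩ := hall
    have hk0 : a k = 0 := le_antisymm hk (ha k)
    have hik : i ≠ k := by rintro rfl; linarith
    obtain ⟨j, hji, hjk⟩ : ∃ j, j ≠ i ∧ j ≠ k := by
      clear * - hik
      decide +revert
    have hsum : comb t.v a = a i • t.v i + a j • t.v j := by
      rw [Fintype.linearCombination_apply, ← Finset.sum_subset (Finset.subset_univ {i, j}),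
        Finset.sum_pair hji.symm]
      intro l _ hl
      have : l = k := by
        simp only [Finset.mem_insert, Finset.mem_singleton, not_or] at hl
        obtain ⟨h1, h2⟩ := hl
        clear * - h1 h2 hik hji hjk
        decide +revert
      rw [this, hk0, zero_smul]
    rcases (ha j).eq_or_lt with hj | hj
    · refine ⟨i, hi', ?_⟩
      rw [hsum, ← hj, zero_smul, add_zero, mink_smul_left]
      exact mul_ne_zero hi'.ne' (t.vertex_ne i)
    · rcases t.exists_mink_ne_zero_of_edge hji.symm hne (by
        rw [hsum]
        exact Submodule.add_mem _
          (Submodule.smul_mem _ _ (Submodule.subset_span (by simp)))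
          (Submodule.smul_mem _ _ (Submodule.subset_span (by simp)))) with h | h
      · exact ⟨i, hi', h⟩
      · exact ⟨j, hj, h⟩

theorem mem_interiorCones {ε : ℤˣ} : ε ∈ t.interiorCones ↔ MeetsLightcone t.v ε := by
  constructor
  · rintro ⟨_, ⟨a, ha, _, rfl⟩, h⟩
    exact ⟨a, ha, by rwa [Fintype.linearCombination_apply]⟩
  · rintro ⟨a, ha, h⟩
    have hs : 0 < ∑ i, a i := Finset.sum_pos (fun i _ => ha i) Finset.univ_nonempty
    refine ⟨comb t.v ((∑ i, a i)⁻¹ • a), ⟨(∑ i, a i)⁻¹ • a, fun i => mul_pos (inv_pos.2 hs) (ha i), ?_, ?_⟩, ?_⟩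
    · simp only [Pi.smul_apply, smul_eq_mul]
      rw [← Finset.mul_sum, inv_mul_cancel₀ hs.ne']
    · rw [Fintype.linearCombination_apply]
    · rw [map_smul]
      exact (smul_mem_lightcone (inv_pos.2 hs)).2 h

theorem mem_edgeCones {i j : Fin 3} {ε : ℤˣ} :
    ε ∈ t.edgeCones i j ↔ ∃ a b : ℝ, 0 < a ∧ 0 < b ∧ a • t.v i + b • t.v j ∈ lightcone ε := by
  constructor
  · rintro ⟨_, ⟨a, b, ha, hb, _, rfl⟩, h⟩
    exact ⟨a, b, ha, hb, h⟩
  · rintro ⟨a, b, ha, hb, h⟩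
    have hs : 0 < a + b := by positivity
    refine ⟨(a + b)⁻¹ • (a • t.v i + b • t.v j), ⟨(a + b)⁻¹ * a, (a + b)⁻¹ * b, by positivity,
      by positivity, ?_, ?_⟩, (smul_mem_lightcone (inv_pos.2 hs)).2 h⟩
    · field_simp
    · rw [smul_add, smul_smul, smul_smul]

/-- The pair of vertices `i, j` as a family. -/
def pair (i j : Fin 3) : Fin 2 → Minkowski := t.v ∘ ![i, j]

variable {t}

theorem pair_injective {i j : Fin 3} (hij : i ≠ j) : Function.Injective ![i, j] := by
  intro a b h
  fin_cases a <;> fin_cases b <;> simp_all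

theorem meetsLightcone_pair {i j : Fin 3} {ε : ℤˣ} :
    MeetsLightcone (t.pair i j) ε ↔ ε ∈ t.edgeCones i j := by
  rw [mem_edgeCones]
  constructor
  · rintro ⟨a, ha, h⟩
    refine ⟨a 0, a 1, ha 0, ha 1, ?_⟩
    simpa [Fintype.linearCombination_apply, pair] using h
  · rintro ⟨a, b, ha, hb, h⟩
    refine ⟨![a, b], fun k => ?_, ?_⟩
    · fin_cases k <;> assumption
    · simpa [Fintype.linearCombination_apply, pair] using h

theorem isTransverse_pair {i j : Fin 3} (hij : i ≠ j) : IsTransverse (t.pair i j) :=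
  t.isTransverse.comp (pair_injective hij)

theorem linearIndependent_pair {i j : Fin 3} (hij : i ≠ j) : LinearIndependent ℝ (t.pair i j) :=
  t.linearIndependent.comp _ (pair_injective hij)

theorem meetsTimelike_pair {i j : Fin 3} (hij : i ≠ j) {ε : ℤˣ} :
    MeetsTimelike (t.pair i j) ε ↔
      ε ∈ t.edgeCones i j ∨ t.v i ∈ timelike ε ∨ t.v j ∈ timelike ε := by
  rw [(isTransverse_pair hij).meetsTimelike_iff (linearIndependent_pair hij), meetsLightcone_pair]
  simp [Fin.exists_fin_two, pair]

end Tetrahedron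

end LorentzCausal

/-! ### Equivalence of causal structure and intersection pattern. -/

namespace LorentzCausal

open Set

namespace Tetrahedron

variable {t t' : Tetrahedron} {σ : Equiv.Perm (Fin 3)} {δ : ℤˣ}

theorem meetsLightcone_comp_perm {w : Fin 3 → Minkowski} {ε : ℤˣ} :
    MeetsLightcone (w ∘ σ) ε ↔ MeetsLightcone w ε := by
  have key : ∀ (u : Fin 3 → Minkowski) (τ : Equiv.Perm (Fin 3)),
      MeetsLightcone u ε → MeetsLightcone (u ∘ τ) ε := by
    rintro u τ ⟨a, ha, h⟩
    refine ⟨a ∘ τ, fun i => ha _, ?_⟩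
    rw [Fintype.linearCombination_apply] at h ⊢
    rwa [← Equiv.sum_comp τ] at h
  refine ⟨fun h => ?_, key w σ⟩
  have := key _ σ.symm h
  rwa [Function.comp_assoc, Equiv.self_comp_symm, Function.comp_id] at this

theorem face_image (t : Tetrahedron) (σ : Equiv.Perm (Fin 3)) (s : Set (Fin 3)) :
    t.face (σ '' s) = simplexFace (t.v ∘ σ) s := by
  rw [face, simplexFace, image_comp]

theorem SamePattern.sameStructureVia (H : SamePattern σ δ t t') : SameStructureVia σ δ t t' := by
  have hli := t.linearIndependent
  have hli' : LinearIndependent ℝ (t'.v ∘ σ) := t'.linearIndependent.comp _ σ.injective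
  have ht := t.isTransverse
  have ht' : IsTransverse (t'.v ∘ σ) := t'.isTransverse.comp σ.injective
  have hm : ∀ ε, MeetsTimelike t.v ε ↔ MeetsTimelike (t'.v ∘ σ) (δ * ε) := by
    intro ε
    rw [ht.meetsTimelike_iff hli, ht'.meetsTimelike_iff hli', meetsLightcone_comp_perm,
      ← mem_interiorCones, ← mem_interiorCones, H.interior_iff]
    simp only [H.timelike_iff, Function.comp_apply]
  have he : ∀ (k : Fin 3) ε, MeetsTimelike (t.v ∘ Fin.succAbove k) ε ↔
      MeetsTimelike ((t'.v ∘ σ) ∘ Fin.succAbove k) (δ * ε) := by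
    intro k ε
    have hk : k.succAbove (0 : Fin 2) ≠ k.succAbove 1 :=
      Fin.succAbove_right_injective.ne (by decide)
    have e1 : t.v ∘ Fin.succAbove k = t.pair (k.succAbove 0) (k.succAbove 1) := by
      ext i j
      fin_cases i <;> rfl
    have e2 : (t'.v ∘ σ) ∘ Fin.succAbove k =
        t'.pair (σ (k.succAbove 0)) (σ (k.succAbove 1)) := by
      ext i j
      fin_cases i <;> rfl
    rw [e1, e2, meetsTimelike_pair hk, meetsTimelike_pair (σ.injective.ne hk),
      H.edge_iff _ _ hk, H.timelike_iff, H.timelike_iff]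
  obtain ⟨F, hF, hface⟩ := exists_causalMap_triangle hli hli' ht ht' H.timelike_iff he hm
  have htri : simplexFace (t'.v ∘ σ) univ = t'.triangle := by
    rw [← face_image, image_univ_of_surjective σ.surjective]
    rfl
  rw [htri] at hF
  have : CompactSpace t.triangle := isCompact_iff_compactSpace.1 (isCompact_simplexFace univ)
  let e : t.triangle ≃ t'.triangle := hF.bijOn.equiv F
  -- A continuous bijection from a compact space to a Hausdorff space is a homeomorphism, so
  -- continuity of the inverse comes for free.
  have hcont : Continuous e := (hF.continuousOn.mapsToRestrict hF.bijOn.mapsTo)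
  have hval : ∀ x, (hcont.homeoOfEquivCompactToT2 x : Minkowski) = F x := fun x => rfl
  refine ⟨hcont.homeoOfEquivCompactToT2, fun s x => ?_, fun ε x => ?_, fun ε x => ?_, fun x => ?_⟩
  · have hFx : F x ∈ simplexFace (t'.v ∘ σ) univ := by
      rw [htri]; exact hF.bijOn.mapsTo x.2
    rw [hval, face_image, mem_simplexFace_iff_forall hli' hFx]
    refine (mem_simplexFace_iff_forall hli x.2).trans (forall₂_congr fun k _ => ?_)
    refine ⟨fun h => (hface k).mapsTo h, fun h => ?_⟩
    obtain ⟨y, hy, hxy⟩ := (hface k).surjOn h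
    rwa [← hF.bijOn.injOn (simplexFace_mono (subset_univ _) hy) x.2 hxy]
  · exact (hF.sameCharacter x x.2).timelike ε
  · exact (hF.sameCharacter x x.2).lightcone ε
  · exact (hF.sameCharacter x x.2).spacelike

theorem v_mem_triangle (t : Tetrahedron) (i : Fin 3) : t.v i ∈ t.triangle :=
  vertex_mem_simplexFace t.v (mem_univ i)

theorem face_singleton (t : Tetrahedron) (i : Fin 3) : t.face {i} = {t.v i} := by
  rw [face, image_singleton, convexHull_singleton]

theorem face_subset_triangle (t : Tetrahedron) (s : Set (Fin 3)) : t.face s ⊆ t.triangle :=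
  simplexFace_mono (subset_univ s)

/-- An open edge is described by closed faces alone, so a homeomorphism that respects faces respects
it. `mem_openTriangle_iff` does the same for the open triangle. -/
theorem mem_openSegment_iff (t : Tetrahedron) {i j : Fin 3} (hij : i ≠ j) {x : Minkowski} :
    x ∈ openSegment ℝ (t.v i) (t.v j) ↔ x ∈ t.face {i, j} ∧ x ∉ t.face {i} ∧ x ∉ t.face {j} := by
  rw [face_singleton, face_singleton, face, image_pair, convexHull_pair, ← insert_endpoints_openSegment]
  have hne : t.v i ≠ t.v j := t.linearIndependent.injective.ne hij
  have h1 : t.v i ∉ openSegment ℝ (t.v i) (t.v j) := fun h => hne (left_mem_openSegment_iff.1 h)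
  have h2 : t.v j ∉ openSegment ℝ (t.v i) (t.v j) := fun h => hne (right_mem_openSegment_iff.1 h)
  simp only [mem_insert_iff, mem_singleton_iff]
  constructor
  · intro h
    exact ⟨Or.inr (Or.inr h), fun e => h1 (e ▸ h), fun e => h2 (e ▸ h)⟩
  · rintro ⟨h | h | h, h3, h4⟩
    · exact absurd h h3
    · exact absurd h h4
    · exact h

theorem mem_openTriangle_iff (t : Tetrahedron) {x : Minkowski} :
    x ∈ t.openTriangle ↔ x ∈ t.triangle ∧ ∀ k, x ∉ t.face {k}ᶜ := by
  constructor
  · rintro ⟨a, ha, h1, rfl⟩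
    have haS : a ∈ stdSimplex ℝ (Fin 3) := ⟨fun i => (ha i).le, h1⟩
    rw [← Fintype.linearCombination_apply]
    refine ⟨mem_simplex.2 ⟨a, haS, rfl⟩, fun k hk => ?_⟩
    exact (ha k).ne' ((comb_mem_simplexFace t.linearIndependent haS).1 hk k (by simp))
  · rintro ⟨h1, h2⟩
    obtain ⟨a, ha, rfl⟩ := mem_simplex.1 h1
    refine ⟨a, fun i => lt_of_le_of_ne (ha.1 i) fun h => ?_, ha.2, rfl⟩
    refine h2 i ((comb_mem_simplexFace t.linearIndependent ha).2 fun j hj => ?_)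
    rw [notMem_compl_iff, mem_singleton_iff] at hj
    rw [hj, ← h]

theorem SameStructureVia.edge (H : SameStructureVia σ δ t t') {i j : Fin 3} (hij : i ≠ j)
    {ε : ℤˣ} (h : ε ∈ t.edgeCones i j) : δ * ε ∈ t'.edgeCones (σ i) (σ j) := by
  obtain ⟨k, h1, -, h3, -⟩ := H
  obtain ⟨x, hx, hxε⟩ := h
  have hx' := (t.mem_openSegment_iff hij).1 hx
  let y : t.triangle := ⟨x, t.face_subset_triangle _ hx'.1⟩
  have hy : (x : Minkowski) = (y : Minkowski) := rfl
  rw [hy, h1, h1, h1, image_pair, image_singleton, image_singleton,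
    ← mem_openSegment_iff _ (σ.injective.ne hij)] at hx'
  exact ⟨k y, hx', (h3 ε y).1 hxε⟩

theorem SameStructureVia.interior (H : SameStructureVia σ δ t t') {ε : ℤˣ}
    (h : ε ∈ t.interiorCones) : δ * ε ∈ t'.interiorCones := by
  obtain ⟨k, h1, -, h3, -⟩ := H
  obtain ⟨x, hx, hxε⟩ := h
  rw [mem_openTriangle_iff] at hx
  let y : t.triangle := ⟨x, hx.1⟩
  refine ⟨k y, t'.mem_openTriangle_iff.2 ⟨(k y).2, fun l => ?_⟩, (h3 ε y).1 hxε⟩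
  have := hx.2 (σ.symm l)
  rwa [show x = (y : Minkowski) from rfl, h1, image_compl_eq σ.bijective, image_singleton,
    Equiv.apply_symm_apply] at this

theorem SameStructureVia.samePattern (H : SameStructureVia σ δ t t') : SamePattern σ δ t t' := by
  have hδ : ∀ ε : ℤˣ, δ * (δ * ε) = ε := fun ε => by
    rw [← mul_assoc, Int.units_mul_self, one_mul]
  have hv : ∃ k : t.triangle ≃ₜ t'.triangle,
      (∀ i, (k ⟨t.v i, t.v_mem_triangle i⟩ : Minkowski) = t'.v (σ i)) ∧
      (∀ ε (x : t.triangle), (x : Minkowski) ∈ timelike ε ↔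
        (k x : Minkowski) ∈ timelike (δ * ε)) ∧
      (∀ x : t.triangle, (x : Minkowski) ∈ spacelike ↔ (k x : Minkowski) ∈ spacelike) := by
    obtain ⟨k, h1, h2, -, h4⟩ := H
    refine ⟨k, fun i => ?_, h2, h4⟩
    have := (h1 {i} ⟨t.v i, t.v_mem_triangle i⟩).1 (by rw [face_singleton]; rfl)
    rwa [image_singleton, face_singleton] at this
  obtain ⟨k, hk, h2, h4⟩ := hv
  refine ⟨fun i ε => ?_, fun i => ?_, fun i j hij ε => ⟨H.edge hij, fun h => ?_⟩,
    fun ε => ⟨H.interior, fun h => ?_⟩⟩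
  · rw [← hk]
    exact h2 ε ⟨t.v i, t.v_mem_triangle i⟩
  · rw [← hk]
    exact h4 ⟨t.v i, t.v_mem_triangle i⟩
  · have := H.symm.edge (σ.injective.ne hij) h
    rwa [hδ, Equiv.symm_apply_apply, Equiv.symm_apply_apply] at this
  · have := H.symm.interior h
    rwa [hδ] at this

theorem sameStructureVia_iff : SameStructureVia σ δ t t' ↔ SamePattern σ δ t t' :=
  ⟨SameStructureVia.samePattern, SamePattern.sameStructureVia⟩

end Tetrahedron

/-! ### Constraints on the lightcones met by edges and triangle. -/

theorem smul_sub_smul_mem_timelike {ε : ℤˣ} {x y : Minkowski} (hx : x ∈ timelike ε)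
    (hy : y ∈ timelike (-ε)) {c d : ℝ} (hc : 0 ≤ c) (hd : 0 ≤ d) (h : 0 < c ∨ 0 < d) :
    c • x - d • y ∈ timelike ε := by
  have hy' : -y ∈ timelike ε := by
    have := neg_mem_timelike.2 hy
    rwa [neg_neg] at this
  rw [sub_eq_add_neg, ← smul_neg]
  rcases hc.eq_or_lt with rfl | hc
  · have hd := h.resolve_left (lt_irrefl _)
    rw [zero_smul, zero_add]
    exact (smul_mem_timelike hd).2 hy'
  · rcases hd.eq_or_lt with rfl | hd
    · rw [zero_smul, add_zero]
      exact (smul_mem_timelike hc).2 hx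
    · exact add_mem_timelike ((smul_mem_timelike hc).2 hx) ((smul_mem_timelike hd).2 hy')

theorem smul_mem_timelike_neg {ε : ℤˣ} {x : Minkowski} {c : ℝ} (hc : c < 0) :
    c • x ∈ timelike ε ↔ x ∈ timelike (-ε) := by
  rw [← neg_mem_timelike, ← neg_smul, smul_mem_timelike (neg_pos.2 hc)]

theorem units_ne_neg (ε : ℤˣ) : ε ≠ -ε := by
  rcases Int.units_eq_one_or ε with rfl | rfl <;> decide

theorem set_units_eq_pair {S : Set ℤˣ} {ε : ℤˣ} (h1 : ε ∈ S) (h2 : -ε ∈ S) : S = {ε, -ε} := by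
  ext η
  rcases units_eq_or_eq_neg ε η with rfl | rfl <;> simp [h1, h2]

theorem set_units_eq_singleton {S : Set ℤˣ} {ε : ℤˣ} (h1 : ε ∈ S) (h2 : -ε ∉ S) : S = {ε} := by
  ext η
  rcases units_eq_or_eq_neg ε η with rfl | rfl
  · simp [h1]
  · simp [h2, (units_ne_neg ε).symm]

theorem set_units_eq_empty {S : Set ℤˣ} (ε : ℤˣ) (h1 : ε ∉ S) (h2 : -ε ∉ S) : S = ∅ := by
  ext η
  rcases units_eq_or_eq_neg ε η with rfl | rfl <;> simp [h1, h2]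

theorem univ_eq_of_ne {a b c : Fin 3} (hab : a ≠ b) (hac : a ≠ c) (hbc : b ≠ c) :
    (Finset.univ : Finset (Fin 3)) = {a, b, c} := by
  decide +revert

namespace Tetrahedron

variable {t : Tetrahedron} {i j a b c : Fin 3} {ε : ℤˣ}

theorem vertex_cases (t : Tetrahedron) (i : Fin 3) :
    (∃ ε, t.v i ∈ timelike ε) ∨ t.v i ∈ spacelike := by
  rcases lt_or_gt_of_ne (t.vertex_ne i) with h1 | h1
  · obtain ⟨ε, hε⟩ := exists_sign_of_causal h1.le (t.linearIndependent.ne_zero i)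
    exact Or.inl ⟨ε, h1, hε⟩
  · exact Or.inr h1

theorem comb_pair (t : Tetrahedron) (i j : Fin 3) (u : Fin 2 → ℝ) :
    comb (t.pair i j) u = u 0 • t.v i + u 1 • t.v j := by
  simp [Fintype.linearCombination_apply, pair]

theorem meetsTimelike_pair_of_nonneg {x y : ℝ} (hx : 0 ≤ x) (hy : 0 ≤ y)
    (h : x • t.v i + y • t.v j ∈ timelike ε) : MeetsTimelike (t.pair i j) ε := by
  refine MeetsTimelike.of_nonneg (a := ![x, y]) (fun k => ?_) ?_
  · fin_cases k <;> assumption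
  · simpa [comb_pair] using h

theorem mem_edgeCones_iff (hij : i ≠ j) : ε ∈ t.edgeCones i j ↔
    MeetsTimelike (t.pair i j) ε ∧ ¬ (t.v i ∈ timelike ε ∧ t.v j ∈ timelike ε) := by
  rw [← meetsLightcone_pair,
    (isTransverse_pair hij).meetsLightcone_iff (linearIndependent_pair hij), Fin.exists_fin_two,
    not_and_or]
  rfl

/-- If an edge meets both timelike regions, then its endpoints lie in different ones. -/
theorem endpoints_of_meets_both (h1 : MeetsTimelike (t.pair i j) ε)
    (h2 : MeetsTimelike (t.pair i j) (-ε)) :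
    (t.v i ∈ timelike ε ∧ t.v j ∈ timelike (-ε)) ∨
      (t.v i ∈ timelike (-ε) ∧ t.v j ∈ timelike ε) := by
  obtain ⟨u, hu, hx⟩ := h1
  obtain ⟨w, hw, hy⟩ := h2
  rw [comb_pair] at hx hy
  -- Eliminating one endpoint from the points in I_ε and I_{-ε} leaves a multiple of the other that
  -- still lies in I_ε. The two factors are opposite determinants, so their sign puts the endpoints
  -- in opposite regions.
  have k1 := smul_sub_smul_mem_timelike hx hy (hw 1).le (hu 1).le (Or.inl (hw 1))
  have k2 := smul_sub_smul_mem_timelike hx hy (hw 0).le (hu 0).le (Or.inl (hw 0))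
  have e1 : w 1 • (u 0 • t.v i + u 1 • t.v j) - u 1 • (w 0 • t.v i + w 1 • t.v j) =
      (u 0 * w 1 - w 0 * u 1) • t.v i := by module
  have e2 : w 0 • (u 0 • t.v i + u 1 • t.v j) - u 0 • (w 0 • t.v i + w 1 • t.v j) =
      (-(u 0 * w 1 - w 0 * u 1)) • t.v j := by module
  rw [e1] at k1
  rw [e2] at k2
  rcases lt_trichotomy (u 0 * w 1 - w 0 * u 1) 0 with h | h | h
  · exact Or.inr ⟨(smul_mem_timelike_neg h).1 k1, (smul_mem_timelike (neg_pos.2 h)).1 k2⟩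
  · rw [h, zero_smul] at k1
    exact absurd k1.1 (by simp [mink])
  · exact Or.inl ⟨(smul_mem_timelike h).1 k1, (smul_mem_timelike_neg (neg_lt_zero.2 h)).1 k2⟩

theorem edgeCones_comm (t : Tetrahedron) (i j : Fin 3) : t.edgeCones i j = t.edgeCones j i := by
  simp only [edgeCones, openSegment_symm ℝ (t.v i)]

theorem not_timelike_neg {x : Minkowski} (h : x ∈ timelike ε) : x ∉ timelike (-ε) := fun h' =>
  units_ne_neg ε ((timelike_disjoint h).1 h').symm

theorem edgeCones_self (t : Tetrahedron) (i : Fin 3) : t.edgeCones i i = ∅ := by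
  ext ε
  simp only [edgeCones, openSegment_same, mem_ofPred_eq, mem_empty_iff_false, iff_false]
  rintro ⟨x, rfl, hx⟩
  exact t.vertex_ne i hx.1

theorem edgeCones_timelike_timelike (hij : i ≠ j) (hi : t.v i ∈ timelike ε)
    (hj : t.v j ∈ timelike ε) : t.edgeCones i j = ∅ := by
  refine set_units_eq_empty ε (fun h => ?_) fun h => ?_
  · exact ((mem_edgeCones_iff hij).1 h).2 ⟨hi, hj⟩
  · have h2 := ((mem_edgeCones_iff hij).1 h).1
    rcases endpoints_of_meets_both ((meetsTimelike_pair hij).2 (Or.inr (Or.inl hi))) h2 with h | h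
    · exact not_timelike_neg hj h.2
    · exact not_timelike_neg hi h.1

theorem edgeCones_opposite (hij : i ≠ j) (hi : t.v i ∈ timelike ε)
    (hj : t.v j ∈ timelike (-ε)) : t.edgeCones i j = {ε, -ε} := by
  refine set_units_eq_pair ?_ ?_
  · exact (mem_edgeCones_iff hij).2 ⟨(meetsTimelike_pair hij).2 (Or.inr (Or.inl hi)),
      fun h => not_timelike_neg h.2 hj⟩
  · exact (mem_edgeCones_iff hij).2 ⟨(meetsTimelike_pair hij).2 (Or.inr (Or.inr hj)),
      fun h => not_timelike_neg hi h.1⟩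

theorem neg_notMem_edgeCones (hij : i ≠ j) (h : MeetsTimelike (t.pair i j) ε)
    (hj : t.v j ∈ spacelike) : -ε ∉ t.edgeCones i j := by
  intro h'
  rcases endpoints_of_meets_both h ((mem_edgeCones_iff hij).1 h').1 with h | h <;>
    exact spacelike_not_timelike hj h.2

theorem edgeCones_timelike_spacelike (hij : i ≠ j) (hi : t.v i ∈ timelike ε)
    (hj : t.v j ∈ spacelike) : t.edgeCones i j = {ε} := by
  have hm : MeetsTimelike (t.pair i j) ε := (meetsTimelike_pair hij).2 (Or.inr (Or.inl hi))
  exact set_units_eq_singleton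
    ((mem_edgeCones_iff hij).2 ⟨hm, fun h => spacelike_not_timelike hj h.2⟩)
    (neg_notMem_edgeCones hij hm hj)

theorem edgeCones_eq_singleton (hij : i ≠ j) (hj : t.v j ∈ spacelike)
    (h : ε ∈ t.edgeCones i j) : t.edgeCones i j = {ε} :=
  set_units_eq_singleton h (neg_notMem_edgeCones hij ((mem_edgeCones_iff hij).1 h).1 hj)

/-- By transversality, contact with a lightcone on the boundary produces timelike points inside.
Hence the closed and the open triangle meet the same lightcones. -/
theorem mem_cones_iff : ε ∈ t.cones ↔ MeetsTimelike t.v ε ∧ ∃ i, t.v i ∉ timelike ε := by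
  rw [← t.isTransverse.meetsLightcone_iff t.linearIndependent]
  constructor
  · rintro ⟨x, hx, h⟩
    obtain ⟨u, hu, rfl⟩ := mem_simplex.1 hx
    rw [t.isTransverse.meetsLightcone_iff t.linearIndependent]
    refine ⟨t.isTransverse.meetsTimelike hu.1 h, ?_⟩
    by_contra! hall
    exact timelike_not_lightcone
      (sum_smul_mem_timelike hu.1 (ne_zero_of_mem_stdSimplex hu) hall) h
  · intro h
    obtain ⟨x, hx, h⟩ := t.mem_interiorCones.2 h
    exact ⟨x, (t.mem_openTriangle_iff.1 hx).1, h⟩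

theorem interiorCones_eq_cones (t : Tetrahedron) : t.interiorCones = t.cones := by
  ext ε
  rw [mem_cones_iff, mem_interiorCones, t.isTransverse.meetsLightcone_iff t.linearIndependent]

theorem edgeCones_subset_cones (t : Tetrahedron) (i j : Fin 3) : t.edgeCones i j ⊆ t.cones := by
  rintro ε ⟨x, hx, h⟩
  exact ⟨x, (convex_convexHull ℝ _).openSegment_subset (t.v_mem_triangle i) (t.v_mem_triangle j) hx,
    h⟩

theorem mem_cones_of_vertex (hi : t.v i ∈ timelike ε) (hj : t.v j ∉ timelike ε) : ε ∈ t.cones :=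
  mem_cones_iff.2 ⟨.of_vertex hi, j, hj⟩

theorem comb_eq_three (hab : a ≠ b) (hac : a ≠ c) (hbc : b ≠ c) (u : Fin 3 → ℝ) :
    comb t.v u = u a • t.v a + u b • t.v b + u c • t.v c := by
  rw [Fintype.linearCombination_apply, univ_eq_of_ne hab hac hbc, Finset.sum_insert (by simp [hab, hac]),
    Finset.sum_pair hbc, add_assoc]

theorem exists_other_two (i : Fin 3) : ∃ j k : Fin 3, i ≠ j ∧ i ≠ k ∧ j ≠ k := by
  decide +revert

theorem forall_edge (hab : a ≠ b) (hac : a ≠ c) (hbc : b ≠ c) {P : Fin 3 → Fin 3 → Prop}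
    (hP : ∀ i j, P i j → P j i) (h1 : P a b) (h2 : P a c) (h3 : P b c) (i j : Fin 3)
    (hij : i ≠ j) : P i j := by
  have key : ∀ i j, i ≠ j → ((i = a ∧ j = b) ∨ (i = a ∧ j = c) ∨ (i = b ∧ j = c)) ∨
      ((j = a ∧ i = b) ∨ (j = a ∧ i = c) ∨ (j = b ∧ i = c)) := by
    clear * - hab hac hbc
    decide +revert
  rcases key i j hij with (⟨rfl, rfl⟩ | ⟨rfl, rfl⟩ | ⟨rfl, rfl⟩) |
    (⟨rfl, rfl⟩ | ⟨rfl, rfl⟩ | ⟨rfl, rfl⟩)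
  all_goals first | assumption | (apply hP; assumption)

/-- If the open triangle meets both timelike regions, then so does its boundary. -/
theorem exists_edge_meets (h1 : MeetsTimelike t.v ε) (h2 : MeetsTimelike t.v (-ε)) :
    ∃ i j, i ≠ j ∧ MeetsTimelike (t.pair i j) (-ε) := by
  obtain ⟨p, hp, hx⟩ := h1
  obtain ⟨u, hu, hy⟩ := h2
  -- The largest multiple of the point in I_ε that keeps coefficients nonnegative is subtracted from
  -- the point in I_{-ε}. The result stays in I_{-ε} and lies in the cone over an edge.
  obtain ⟨i, -, hi⟩ := Finset.exists_min_image Finset.univ (fun i => u i / p i)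
    Finset.univ_nonempty
  have hm : ∀ j, 0 ≤ u j - u i / p i * p j := fun j => by
    have := hi j (Finset.mem_univ j)
    rw [le_div_iff₀ (hp j)] at this
    linarith
  have h0 : u i - u i / p i * p i = 0 := by rw [div_mul_cancel₀ _ (hp i).ne', sub_self]
  have hpos : 0 < u i / p i := div_pos (hu i) (hp i)
  obtain ⟨j, k, hij, hik, hjk⟩ := exists_other_two i
  refine ⟨j, k, hjk, meetsTimelike_pair_of_nonneg (hm j) (hm k) ?_⟩
  have hx' : comb t.v p ∈ timelike (- -ε) := by rwa [neg_neg]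
  have key := smul_sub_smul_mem_timelike hy hx' zero_le_one hpos.le (Or.inl one_pos)
  rw [comb_eq_three hij hik hjk, comb_eq_three hij hik hjk] at key
  have e : (1 : ℝ) • (u i • t.v i + u j • t.v j + u k • t.v k) -
      (u i / p i) • (p i • t.v i + p j • t.v j + p k • t.v k) =
      (u i - u i / p i * p i) • t.v i + ((u j - u i / p i * p j) • t.v j +
        (u k - u i / p i * p k) • t.v k) := by module
  rwa [e, h0, zero_smul, zero_add] at key

theorem cones_eq_singleton (h : ε ∈ t.cones) (hv : ∀ i, t.v i ∉ timelike (-ε))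
    (he : ∀ i j, i ≠ j → -ε ∉ t.edgeCones i j) : t.cones = {ε} := by
  refine set_units_eq_singleton h fun h' => ?_
  obtain ⟨i, j, hij, hm⟩ := exists_edge_meets (mem_cones_iff.1 h).1 (mem_cones_iff.1 h').1
  rcases (meetsTimelike_pair hij).1 hm with h1 | h1 | h1
  · exact he i j hij h1
  · exact hv i h1
  · exact hv j h1

/-- Two edges meet one lightcone and the third edge meets the other one only if the common vertex
of the two edges is timelike. -/
theorem timelike_of_edges (hab : a ≠ b) (hac : a ≠ c) (hbc : b ≠ c)
    (h1 : ε ∈ t.edgeCones a b) (h2 : ε ∈ t.edgeCones a c) (h3 : -ε ∈ t.edgeCones b c) :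
    t.v a ∈ timelike ε := by
  obtain ⟨u, hu, hx⟩ := ((mem_edgeCones_iff hab).1 h1).1
  obtain ⟨w, hw, hy⟩ := ((mem_edgeCones_iff hac).1 h2).1
  obtain ⟨z, hz, hq⟩ := ((mem_edgeCones_iff hbc).1 h3).1
  rw [comb_pair] at hx hy hq
  -- The points on the two edges at `a` are scaled so that, after subtraction of the point on the
  -- third edge, `b` and `c` cancel and a positive multiple of `t.v a` remains.
  have hp1 : 0 < z 0 / u 1 := div_pos (hz 0) (hu 1)
  have hp2 : 0 < z 1 / w 1 := div_pos (hz 1) (hw 1)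
  have key := add_mem_timelike ((smul_mem_timelike hp1).2 hx)
    (smul_sub_smul_mem_timelike hy hq hp2.le zero_le_one (Or.inr one_pos))
  have e : (z 0 / u 1) • (u 0 • t.v a + u 1 • t.v b) +
      ((z 1 / w 1) • (w 0 • t.v a + w 1 • t.v c) - (1 : ℝ) • (z 0 • t.v b + z 1 • t.v c)) =
      (z 0 / u 1 * u 0 + z 1 / w 1 * w 0) • t.v a + (z 0 / u 1 * u 1 - z 0) • t.v b +
        (z 1 / w 1 * w 1 - z 1) • t.v c := by module
  rw [e, div_mul_cancel₀ _ (hu 1).ne', div_mul_cancel₀ _ (hw 1).ne', sub_self, sub_self, zero_smul,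
    zero_smul, add_zero, add_zero] at key
  exact (smul_mem_timelike (by have := hu 0; have := hw 0; positivity)).1 key

theorem simplexFace_pair (t : Tetrahedron) (b c : Fin 3) :
    simplexFace (t.pair b c) univ = segment ℝ (t.v b) (t.v c) := by
  have : range (t.pair b c) = {t.v b, t.v c} := by
    ext x
    simp [Fin.exists_fin_two, pair, eq_comm]
  rw [simplexFace, image_univ, this, convexHull_pair]

/-- An interior timelike point splits the edge into two segments, each ending at a spacelike vertex
and crossing L_ε exactly once. -/
theorem ncard_edge_lightcone (hbc : b ≠ c) (hb : t.v b ∈ spacelike) (hc : t.v c ∈ spacelike)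
    (h : ε ∈ t.edgeCones b c) : (openSegment ℝ (t.v b) (t.v c) ∩ lightcone ε).ncard = 2 := by
  obtain ⟨u, hu, hu1, hp⟩ := ((mem_edgeCones_iff hbc).1 h).1.exists_normalized
  have hli : LinearIndependent ℝ (t.pair b c) := linearIndependent_pair hbc
  have hne := ray_ne_zero_of_pos hli hu
  have hcone := isConeOver_simplex hli hu hu1
  set p := comb (t.pair b c) u
  have hB : ∀ k, t.pair b c k ∈ simplexBoundary (t.pair b c) := fun k =>
    mem_simplexBoundary_two.2 ⟨k, rfl⟩
  have hs : ∀ k : Fin 2, t.pair b c k ∈ spacelike := by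
    intro k
    fin_cases k <;> assumption
  have hk : ∀ k : Fin 2, 0 < rootHi p (t.pair b c k) := fun k =>
    ((ray_mem_spacelike hp (hne k) (k := 0)).1 (by simpa using hs k)).2
  -- The solution of `(1 - r) / r = rootHi`, that is, the crossing in segment coordinates.
  let r : Fin 2 → ℝ := fun k => (1 + rootHi p (t.pair b c k))⁻¹
  have hr : ∀ k, 0 < r k := fun k => inv_pos.2 (by linarith [hk k])
  have hr1 : ∀ k, r k ∈ Icc (0 : ℝ) 1 := fun k =>
    ⟨(hr k).le, inv_le_one_of_one_le₀ (by linarith [hk k])⟩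
  let N : Fin 2 → Minkowski := fun k => (1 - r k) • p + r k • t.pair b c k
  have hsplit : ∀ (s : ℝ) (k : Fin 2), 0 < s →
      (1 - s) • p + s • t.pair b c k = s • (((1 - s) / s) • p + t.pair b c k) := by
    intro s k hs
    rw [smul_add, smul_smul, mul_div_cancel₀ _ hs.ne']
  have hratio : ∀ (s : ℝ) (k : Fin 2), 0 < s →
      ((1 - s) / s = rootHi p (t.pair b c k) ↔ s = r k) := by
    intro s k hs
    have := hk k
    rw [div_eq_iff hs.ne', show r k = 1 / (1 + rootHi p (t.pair b c k)) from (one_div _).symm,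
      eq_div_iff (by positivity)]
    constructor <;> intro h <;> linarith
  have hN : ∀ k, N k ∈ lightcone ε := by
    intro k
    simp only [N]
    rw [hsplit _ _ (hr k), smul_mem_lightcone (hr k), ray_mem_lightcone hp (hne k),
      hratio _ _ (hr k)]
  have hinj : Function.Injective N := by
    intro k l hkl
    have := (hcone.inj _ (hB k) _ (hB l) _ (hr1 k) _ (hr1 l) hkl).2 (hr k).ne'
    exact hli.injective this
  have hset : openSegment ℝ (t.v b) (t.v c) ∩ lightcone ε = N '' univ := by
    apply subset_antisymm
    · rintro x ⟨hx, hxε⟩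
      have hx' := openSegment_subset_segment ℝ _ _ hx
      rw [← simplexFace_pair] at hx'
      obtain ⟨_, hb', s, hs, rfl⟩ := hcone.surj x hx'
      obtain ⟨k, rfl⟩ := mem_simplexBoundary_two.1 hb'
      rcases hs.1.eq_or_lt with rfl | hs0
      · simp only [sub_zero, one_smul, zero_smul, add_zero] at hxε
        exact absurd hxε (timelike_not_lightcone hp)
      · rw [hsplit _ _ hs0, smul_mem_lightcone hs0, ray_mem_lightcone hp (hne k),
          hratio _ _ hs0] at hxε
        exact ⟨k, trivial, by rw [hxε]⟩
    · rintro _ ⟨k, -, rfl⟩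
      refine ⟨?_, hN k⟩
      have hx := hcone.mem _ (hB k) _ (hr1 k)
      rw [simplexFace_pair, ← insert_endpoints_openSegment] at hx
      have hns : N k ∉ spacelike := fun h => spacelike_not_lightcone h (hN k)
      rcases hx with hx | hx | hx
      · exact absurd (show N k ∈ spacelike by simpa only [N, hx] using hb) hns
      · exact absurd (show N k ∈ spacelike by simpa only [N, hx] using hc) hns
      · exact hx
  rw [hset, ncard_image_of_injective _ hinj, ncard_univ, Nat.card_fin]

end Tetrahedron

/-! ### The thirteen types exhaust all tetrahedra. -/

namespace Tetrahedron

variable {t t' : Tetrahedron} {a b c : Fin 3} {ε : ℤˣ}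

theorem isOfType_of {τ : VertexCausalType} (hab : a ≠ b) (hac : a ≠ c) (hbc : b ≠ c)
    (h : t.IsOfTypeWith a b c ε τ) : t.IsOfType τ := by
  have key : ∀ a b c : Fin 3, a ≠ b → a ≠ c → b ≠ c →
      ∃ σ : Equiv.Perm (Fin 3), σ 0 = a ∧ σ 1 = b ∧ σ 2 = c := by decide
  obtain ⟨σ, rfl, rfl, rfl⟩ := key a b c hab hac hbc
  exact ⟨σ, ε, h⟩

theorem forall_notMem_timelike (hab : a ≠ b) (hac : a ≠ c) (hbc : b ≠ c)
    (ha : t.v a ∉ timelike ε) (hb : t.v b ∉ timelike ε)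
    (hc : t.v c ∉ timelike ε) (i : Fin 3) : t.v i ∉ timelike ε := by
  have hi : i ∈ ({a, b, c} : Finset (Fin 3)) := by
    rw [← univ_eq_of_ne hab hac hbc]
    exact Finset.mem_univ i
  simp only [Finset.mem_insert, Finset.mem_singleton] at hi
  rcases hi with rfl | rfl | rfl <;> assumption

theorem cones_eq_singleton_of (hab : a ≠ b) (hac : a ≠ c) (hbc : b ≠ c) (h : ε ∈ t.cones)
    (ha : t.v a ∉ timelike (-ε)) (hb : t.v b ∉ timelike (-ε)) (hc : t.v c ∉ timelike (-ε))
    (h1 : -ε ∉ t.edgeCones a b) (h2 : -ε ∉ t.edgeCones a c) (h3 : -ε ∉ t.edgeCones b c) :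
    t.cones = {ε} :=
  cones_eq_singleton h (forall_notMem_timelike hab hac hbc ha hb hc)
    (forall_edge hab hac hbc (P := fun i j => -ε ∉ t.edgeCones i j)
      (fun i j h => by rwa [edgeCones_comm]) h1 h2 h3)

theorem isOfType_A1 (ha : ∀ i, t.v i ∈ timelike ε) : t.IsOfType .A1 := by
  refine ⟨1, ε, ⟨ha _, ha _, ha _⟩, set_units_eq_empty ε (fun h => ?_) fun h => ?_⟩
  · obtain ⟨-, i, hi⟩ := mem_cones_iff.1 h
    exact hi (ha i)
  · obtain ⟨i, j, hij, hm⟩ := exists_edge_meets (.of_vertex (ha 0)) (mem_cones_iff.1 h).1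
    rcases (meetsTimelike_pair hij).1 hm with h1 | h1 | h1
    · rw [edgeCones_timelike_timelike hij (ha i) (ha j)] at h1
      exact h1
    · exact not_timelike_neg (ha i) h1
    · exact not_timelike_neg (ha j) h1

theorem isOfType_A2 (hab : a ≠ b) (hac : a ≠ c) (hbc : b ≠ c) (ha : t.v a ∈ timelike ε)
    (hb : t.v b ∈ timelike ε) (hc : t.v c ∈ timelike (-ε)) : t.IsOfType .A2 :=
  isOfType_of hab hac hbc ⟨⟨ha, hb, hc⟩,
    set_units_eq_pair (mem_cones_of_vertex ha fun h => not_timelike_neg h hc)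
      (mem_cones_of_vertex hc (not_timelike_neg ha)),
    edgeCones_timelike_timelike hab ha hb, edgeCones_opposite hac ha hc,
    edgeCones_opposite hbc hb hc⟩

theorem isOfType_B1 (hab : a ≠ b) (hac : a ≠ c) (hbc : b ≠ c) (ha : t.v a ∈ timelike ε)
    (hb : t.v b ∈ timelike ε) (hc : t.v c ∈ spacelike) : t.IsOfType .B1 := by
  have h1 := edgeCones_timelike_timelike hab ha hb
  have h2 := edgeCones_timelike_spacelike hac ha hc
  have h3 := edgeCones_timelike_spacelike hbc hb hc
  refine isOfType_of hab hac hbc ⟨⟨ha, hb, hc⟩, ?_, h1, h2, h3⟩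
  refine cones_eq_singleton_of hab hac hbc
    (mem_cones_of_vertex ha (spacelike_not_timelike hc)) (not_timelike_neg ha)
    (not_timelike_neg hb) (spacelike_not_timelike hc) ?_ ?_ ?_ <;>
  simp [h1, h2, h3, (units_ne_neg ε).symm]

theorem isOfType_B2 (hab : a ≠ b) (hac : a ≠ c) (hbc : b ≠ c) (ha : t.v a ∈ timelike ε)
    (hb : t.v b ∈ timelike (-ε)) (hc : t.v c ∈ spacelike) : t.IsOfType .B2 :=
  isOfType_of hab hac hbc ⟨⟨ha, hb, hc⟩,
    set_units_eq_pair (mem_cones_of_vertex ha (spacelike_not_timelike hc))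
      (mem_cones_of_vertex hb (spacelike_not_timelike hc)),
    edgeCones_opposite hab ha hb, edgeCones_timelike_spacelike hac ha hc,
    edgeCones_timelike_spacelike hbc hb hc⟩

theorem isOfType_C1 (hab : a ≠ b) (hac : a ≠ c) (hbc : b ≠ c) (ha : t.v a ∈ timelike ε)
    (hb : t.v b ∈ spacelike) (hc : t.v c ∈ spacelike) (h3 : t.edgeCones b c = ∅) :
    t.IsOfType .C1 := by
  have h1 := edgeCones_timelike_spacelike hab ha hb
  have h2 := edgeCones_timelike_spacelike hac ha hc
  refine isOfType_of hab hac hbc ⟨⟨ha, hb, hc⟩, ?_, h1, h2, h3⟩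
  refine cones_eq_singleton_of hab hac hbc
    (mem_cones_of_vertex ha (spacelike_not_timelike hc)) (not_timelike_neg ha)
    (spacelike_not_timelike hb) (spacelike_not_timelike hc) ?_ ?_ ?_ <;>
  simp [h1, h2, h3, (units_ne_neg ε).symm]

theorem isOfType_C2 (hab : a ≠ b) (hac : a ≠ c) (hbc : b ≠ c) (ha : t.v a ∈ timelike ε)
    (hb : t.v b ∈ spacelike) (hc : t.v c ∈ spacelike) (h : ε ∈ t.edgeCones b c) :
    t.IsOfType .C2 := by
  have h1 := edgeCones_timelike_spacelike hab ha hb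
  have h2 := edgeCones_timelike_spacelike hac ha hc
  have h3 := edgeCones_eq_singleton hbc hc h
  refine isOfType_of hab hac hbc
    ⟨⟨ha, hb, hc⟩, ?_, h1, h2, h3, ncard_edge_lightcone hbc hb hc h⟩
  refine cones_eq_singleton_of hab hac hbc
    (mem_cones_of_vertex ha (spacelike_not_timelike hc)) (not_timelike_neg ha)
    (spacelike_not_timelike hb) (spacelike_not_timelike hc) ?_ ?_ ?_ <;>
  simp [h1, h2, h3, (units_ne_neg ε).symm]

theorem isOfType_C3 (hab : a ≠ b) (hac : a ≠ c) (hbc : b ≠ c) (ha : t.v a ∈ timelike ε)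
    (hb : t.v b ∈ spacelike) (hc : t.v c ∈ spacelike) (h : -ε ∈ t.edgeCones b c) :
    t.IsOfType .C3 :=
  isOfType_of hab hac hbc ⟨⟨ha, hb, hc⟩,
    set_units_eq_pair (mem_cones_of_vertex ha (spacelike_not_timelike hc))
      (t.edgeCones_subset_cones b c h),
    edgeCones_timelike_spacelike hab ha hb, edgeCones_timelike_spacelike hac ha hc,
    edgeCones_eq_singleton hbc hc h⟩

theorem isOfType_D1 (h : ∀ i, t.v i ∈ spacelike) (hc : t.cones = ∅) : t.IsOfType .D1 :=
  ⟨1, 1, ⟨h _, h _, h _⟩, hc⟩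

theorem isOfType_D2 (h : ∀ i, t.v i ∈ spacelike) (he : ∀ i j, i ≠ j → t.edgeCones i j = ∅)
    (hc : ε ∈ t.cones) : t.IsOfType .D2 := by
  have hcones : t.cones = {ε} := cones_eq_singleton hc (fun i => spacelike_not_timelike (h i))
    fun i j hij => by simp [he i j hij]
  exact ⟨1, ε, ⟨h _, h _, h _⟩, hcones, by rw [interiorCones_eq_cones, hcones],
    he _ _ (by decide), he _ _ (by decide), he _ _ (by decide)⟩

theorem cones_eq_singleton_of_spacelike (hab : a ≠ b) (hac : a ≠ c) (hbc : b ≠ c)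
    (h : ∀ i, t.v i ∈ spacelike) (h1 : t.edgeCones a b ⊆ {ε}) (h2 : t.edgeCones a c ⊆ {ε})
    (h3 : t.edgeCones b c = {ε}) : t.cones = {ε} := by
  have hne : -ε ∉ ({ε} : Set ℤˣ) := by simp [(units_ne_neg ε).symm]
  have hs : ∀ i, t.v i ∉ timelike (-ε) := fun i => spacelike_not_timelike (h i)
  exact cones_eq_singleton_of hab hac hbc (t.edgeCones_subset_cones b c (by simp [h3])) (hs a)
    (hs b) (hs c) (fun h => hne (h1 h)) (fun h => hne (h2 h)) (by rwa [h3])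

theorem isOfType_D3 (hab : a ≠ b) (hac : a ≠ c) (hbc : b ≠ c) (h : ∀ i, t.v i ∈ spacelike)
    (h1 : t.edgeCones a b = ∅) (h2 : t.edgeCones a c = ∅) (h3 : t.edgeCones b c = {ε}) :
    t.IsOfType .D3 :=
  isOfType_of hab hac hbc ⟨⟨h _, h _, h _⟩, cones_eq_singleton_of_spacelike hab hac hbc h
    (by simp [h1]) (by simp [h2]) h3, h1, h2, h3⟩

theorem isOfType_D4 (hab : a ≠ b) (hac : a ≠ c) (hbc : b ≠ c) (h : ∀ i, t.v i ∈ spacelike)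
    (h1 : t.edgeCones a b = ∅) (h2 : t.edgeCones a c = {ε}) (h3 : t.edgeCones b c = {ε}) :
    t.IsOfType .D4 :=
  isOfType_of hab hac hbc ⟨⟨h _, h _, h _⟩, cones_eq_singleton_of_spacelike hab hac hbc h
    (by simp [h1]) (by simp [h2]) h3, h1, h2, h3⟩

theorem isOfType_D5 (hab : a ≠ b) (hac : a ≠ c) (hbc : b ≠ c) (h : ∀ i, t.v i ∈ spacelike)
    (h1 : t.edgeCones a b = {ε}) (h2 : t.edgeCones a c = {ε}) (h3 : t.edgeCones b c = {ε}) :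
    t.IsOfType .D5 :=
  isOfType_of hab hac hbc ⟨⟨h _, h _, h _⟩, cones_eq_singleton_of_spacelike hab hac hbc h
    (by simp [h1]) (by simp [h2]) h3, h1, h2, h3⟩

theorem edgeCones_eq_empty_of_opposite (hab : a ≠ b) (hac : a ≠ c) (hbc : b ≠ c)
    (h : ∀ i, t.v i ∈ spacelike) (h1 : ε ∈ t.edgeCones a b) (h2 : -ε ∈ t.edgeCones a c) :
    t.edgeCones b c = ∅ := by
  refine set_units_eq_empty ε (fun h3 => ?_) fun h3 => ?_
  · rw [edgeCones_comm] at h1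
    exact spacelike_not_timelike (h b) (timelike_of_edges hab.symm hbc hac h1 h3 h2)
  · rw [edgeCones_comm] at h2 h3
    exact spacelike_not_timelike (h c)
      (timelike_of_edges hac.symm hbc.symm hab h2 h3 (by rwa [neg_neg]))

theorem isOfType_D6 (hab : a ≠ b) (hac : a ≠ c) (hbc : b ≠ c) (h : ∀ i, t.v i ∈ spacelike)
    (h1 : ε ∈ t.edgeCones a b) (h2 : -ε ∈ t.edgeCones a c) : t.IsOfType .D6 :=
  isOfType_of hab hac hbc ⟨⟨h _, h _, h _⟩,
    set_units_eq_pair (t.edgeCones_subset_cones a b h1) (t.edgeCones_subset_cones a c h2),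
    edgeCones_eq_singleton hab (h b) h1, edgeCones_eq_singleton hac (h c) h2,
    edgeCones_eq_empty_of_opposite hab hac hbc h h1 h2⟩

/-- The time orientation of a timelike vertex, and `none` for a spacelike one. -/
theorem exists_position (t : Tetrahedron) : ∃ f : Fin 3 → Option ℤˣ,
    ∀ i, (f i = none → t.v i ∈ spacelike) ∧ ∀ ε, f i = some ε → t.v i ∈ timelike ε := by
  have : ∀ i, ∃ o : Option ℤˣ, (o = none → t.v i ∈ spacelike) ∧
      ∀ ε, o = some ε → t.v i ∈ timelike ε := by
    intro i
    rcases t.vertex_cases i with ⟨ε, h⟩ | h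
    · exact ⟨some ε, by simp, by rintro η ⟨⟩; exact h⟩
    · exact ⟨none, by simp [h], by simp⟩
  choose f hf using this
  exact ⟨f, hf⟩

/-- Edges are indexed by the opposite vertex, and with spacelike ends each meets at most one
lightcone. Edge data then has the same shape as vertex data, and `position_cases` serves for both.
-/
theorem exists_edge_sign (h : ∀ i, t.v i ∈ spacelike) : ∃ g : Fin 3 → Option ℤˣ,
    ∀ i j k, i ≠ j → i ≠ k → j ≠ k → (g k = none → t.edgeCones i j = ∅) ∧
      ∀ ε, g k = some ε → t.edgeCones i j = {ε} := by
  have : ∀ k, ∃ o : Option ℤˣ, ∀ i j, i ≠ j → i ≠ k → j ≠ k → (o = none → t.edgeCones i j = ∅) ∧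
      ∀ ε, o = some ε → t.edgeCones i j = {ε} := by
    intro k
    obtain ⟨i, j, hki, hkj, hij⟩ := exists_other_two k
    have hsym : ∀ i' j', i' ≠ j' → i' ≠ k → j' ≠ k → t.edgeCones i' j' = t.edgeCones i j := by
      intro i' j' h1 h2 h3
      have : (i' = i ∧ j' = j) ∨ (i' = j ∧ j' = i) := by
        clear * - hki hkj hij h1 h2 h3
        decide +revert
      rcases this with ⟨rfl, rfl⟩ | ⟨rfl, rfl⟩
      · rfl
      · exact edgeCones_comm _ _ _
    rcases (t.edgeCones i j).eq_empty_or_nonempty with he | ⟨ε, he⟩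
    · exact ⟨none, fun i' j' h1 h2 h3 => by simp [hsym i' j' h1 h2 h3, he]⟩
    · have he' := edgeCones_eq_singleton hij (h j) he
      exact ⟨some ε, fun i' j' h1 h2 h3 => by simp [hsym i' j' h1 h2 h3, he']⟩
  choose g hg using this
  exact ⟨g, fun i j k hij hik hjk => hg k i j hij hik hjk⟩

set_option synthInstance.maxSize 1000 in
theorem position_cases (f : Fin 3 → Option ℤˣ) : ∃ a b c : Fin 3, a ≠ b ∧ a ≠ c ∧ b ≠ c ∧
    ((f a = none ∧ f b = none ∧ f c = none) ∨ ∃ ε : ℤˣ, f a = some ε ∧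
      ((f b = some ε ∧ f c = some ε) ∨ (f b = some ε ∧ f c = some (-ε)) ∨
      (f b = some ε ∧ f c = none) ∨ (f b = some (-ε) ∧ f c = none) ∨
      (f b = none ∧ f c = none))) := by
  decide +revert

theorem exists_isOfType_of_spacelike (h : ∀ i, t.v i ∈ spacelike) : ∃ τ, t.IsOfType τ := by
  obtain ⟨g, hg⟩ := exists_edge_sign h
  obtain ⟨a, b, c, hab, hac, hbc, hcase⟩ := position_cases g
  have gab := hg a b c hab hac hbc
  have gac := hg a c b hac hab hbc.symm
  have gbc := hg b c a hbc hab.symm hac.symm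
  rcases hcase with ⟨h1, h2, h3⟩ | ⟨ε, h1, h23⟩
  · rcases t.cones.eq_empty_or_nonempty with hc | ⟨ε, hc⟩
    · exact ⟨_, isOfType_D1 h hc⟩
    · exact ⟨_, isOfType_D2 h (forall_edge hab hac hbc (P := fun i j => t.edgeCones i j = ∅)
        (fun i j h => by rwa [edgeCones_comm]) (gab.1 h3) (gac.1 h2) (gbc.1 h1)) hc⟩
  · have ebc := gbc.2 ε h1
    rcases h23 with ⟨h2, h3⟩ | ⟨h2, h3⟩ | ⟨h2, h3⟩ | ⟨h2, h3⟩ | ⟨h2, h3⟩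
    · exact ⟨_, isOfType_D5 hab hac hbc h (gab.2 ε h3) (gac.2 ε h2) ebc⟩
    -- The signs ε, ε, -ε on the edges would make the common vertex of the first two timelike.
    · exfalso
      have e1 := gac.2 ε h2
      have e2 := gab.2 (-ε) h3
      rw [edgeCones_comm] at e1 ebc
      exact spacelike_not_timelike (h c) (timelike_of_edges (ε := ε) hac.symm hbc.symm hab
        (by simp [e1]) (by simp [ebc]) (by simp [e2]))
    · exact ⟨_, isOfType_D4 hab hac hbc h (gab.1 h3) (gac.2 ε h2) ebc⟩
    · have e2 := gac.2 (-ε) h2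
      rw [edgeCones_comm] at e2 ebc
      exact ⟨_, isOfType_D6 (ε := ε) hbc.symm hac.symm hab.symm h (by simp [ebc]) (by simp [e2])⟩
    · exact ⟨_, isOfType_D3 hab hac hbc h (gab.1 h3) (gac.1 h2) ebc⟩

theorem exists_isOfType (t : Tetrahedron) : ∃ τ, t.IsOfType τ := by
  obtain ⟨f, hf⟩ := t.exists_position
  obtain ⟨a, b, c, hab, hac, hbc, hcase⟩ := position_cases f
  have hall : ∀ {P : Fin 3 → Prop}, P a → P b → P c → ∀ i, P i := by
    intro P ha hb hc i
    have hi : i ∈ ({a, b, c} : Finset (Fin 3)) := by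
      rw [← univ_eq_of_ne hab hac hbc]
      exact Finset.mem_univ i
    simp only [Finset.mem_insert, Finset.mem_singleton] at hi
    rcases hi with rfl | rfl | rfl <;> assumption
  rcases hcase with ⟨h1, h2, h3⟩ | ⟨ε, h1, h23⟩
  · exact exists_isOfType_of_spacelike (hall ((hf a).1 h1) ((hf b).1 h2) ((hf c).1 h3))
  · have ha := (hf a).2 ε h1
    rcases h23 with ⟨h2, h3⟩ | ⟨h2, h3⟩ | ⟨h2, h3⟩ | ⟨h2, h3⟩ | ⟨h2, h3⟩
    · exact ⟨_, isOfType_A1 (hall ha ((hf b).2 ε h2) ((hf c).2 ε h3))⟩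
    · exact ⟨_, isOfType_A2 hab hac hbc ha ((hf b).2 ε h2) ((hf c).2 (-ε) h3)⟩
    · exact ⟨_, isOfType_B1 hab hac hbc ha ((hf b).2 ε h2) ((hf c).1 h3)⟩
    · exact ⟨_, isOfType_B2 hab hac hbc ha ((hf b).2 (-ε) h2) ((hf c).1 h3)⟩
    · have hb := (hf b).1 h2
      have hc := (hf c).1 h3
      rcases (t.edgeCones b c).eq_empty_or_nonempty with he | ⟨η, he⟩
      · exact ⟨_, isOfType_C1 hab hac hbc ha hb hc he⟩
      · rcases units_eq_or_eq_neg ε η with rfl | rfl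
        · exact ⟨_, isOfType_C2 hab hac hbc ha hb hc he⟩
        · exact ⟨_, isOfType_C3 hab hac hbc ha hb hc he⟩

/-! ### Separation of the types by counting. -/

open Classical in
/-- The number `1` if `p` holds and `0` otherwise. -/
noncomputable def truthCount (p : Prop) : ℕ := if p then 1 else 0

@[simp]
theorem truthCount_true : truthCount True = 1 := if_pos trivial

@[simp]
theorem truthCount_false : truthCount False = 0 := if_neg not_false

/-- The number of spacelike vertices, the number of lightcones that meet the triangle, and twice
the number of edges that meet a lightcone. -/
noncomputable def invariant (t : Tetrahedron) : ℕ × ℕ × ℕ :=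
  (∑ i, truthCount (t.v i ∈ spacelike), t.cones.ncard,
    ∑ i, ∑ j, truthCount (t.edgeCones i j).Nonempty)

/-- The value of `invariant` on the tetrahedra of each type. -/
def typeCode : VertexCausalType → ℕ × ℕ × ℕ
  | .A1 => (0, 0, 0)
  | .A2 => (0, 2, 4)
  | .B1 => (1, 1, 4)
  | .B2 => (1, 2, 6)
  | .C1 => (2, 1, 4)
  | .C2 => (2, 1, 6)
  | .C3 => (2, 2, 6)
  | .D1 => (3, 0, 0)
  | .D2 => (3, 1, 0)
  | .D3 => (3, 1, 2)
  | .D4 => (3, 1, 4)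
  | .D5 => (3, 1, 6)
  | .D6 => (3, 2, 4)

theorem typeCode_injective : Function.Injective typeCode := by
  intro τ τ' h
  cases τ <;> cases τ' <;> first | rfl | (simp [typeCode] at h)

theorem edgeCones_eq_empty (h : t.cones = ∅) (i j : Fin 3) : t.edgeCones i j = ∅ :=
  subset_empty_iff.1 (h ▸ t.edgeCones_subset_cones i j)

theorem sum_three_perm (σ : Equiv.Perm (Fin 3)) (f : Fin 3 → ℕ) :
    ∑ i, f i = f (σ 0) + f (σ 1) + f (σ 2) := by
  rw [← Equiv.sum_comp σ, Fin.sum_univ_three]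

theorem IsOfType.invariant_eq {τ : VertexCausalType} (h : t.IsOfType τ) :
    t.invariant = typeCode τ := by
  obtain ⟨σ, ε, h⟩ := h
  have hts : ∀ {i : Fin 3} {ε : ℤˣ}, t.v i ∈ timelike ε → t.v i ∉ spacelike :=
    fun h h' => spacelike_not_timelike h' h
  have c10 := t.edgeCones_comm (σ 1) (σ 0)
  have c20 := t.edgeCones_comm (σ 2) (σ 0)
  have c21 := t.edgeCones_comm (σ 2) (σ 1)
  have n2 : ({ε, -ε} : Set ℤˣ).ncard = 2 := ncard_pair (units_ne_neg ε)
  -- The diagonal terms of the double sum vanish and each edge occurs in both orders, whence the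
  -- doubled edge counts.
  simp only [invariant, sum_three_perm σ, edgeCones_self, c10, c20, c21]
  cases τ
  case A1 =>
    obtain ⟨⟨h0, h1, h2⟩, hc⟩ := h
    simp [hts h0, hts h1, hts h2, hc, edgeCones_eq_empty hc, typeCode]
  case D1 =>
    obtain ⟨⟨h0, h1, h2⟩, hc⟩ := h
    simp [h0, h1, h2, hc, edgeCones_eq_empty hc, typeCode]
  case A2 =>
    obtain ⟨⟨h0, h1, h2⟩, hc, e1, e2, e3⟩ := h
    simp [hts h0, hts h1, hts h2, hc, e1, e2, e3, n2, typeCode]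
  case B1 =>
    obtain ⟨⟨h0, h1, h2⟩, hc, e1, e2, e3⟩ := h
    simp [hts h0, hts h1, h2, hc, e1, e2, e3, typeCode]
  case B2 =>
    obtain ⟨⟨h0, h1, h2⟩, hc, e1, e2, e3⟩ := h
    simp [hts h0, hts h1, h2, hc, e1, e2, e3, n2, typeCode]
  case C1 =>
    obtain ⟨⟨h0, h1, h2⟩, hc, e1, e2, e3⟩ := h
    simp [hts h0, h1, h2, hc, e1, e2, e3, typeCode]
  case C2 =>
    obtain ⟨⟨h0, h1, h2⟩, hc, e1, e2, e3, -⟩ := h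
    simp [hts h0, h1, h2, hc, e1, e2, e3, typeCode]
  case C3 =>
    obtain ⟨⟨h0, h1, h2⟩, hc, e1, e2, e3⟩ := h
    simp [hts h0, h1, h2, hc, e1, e2, e3, n2, typeCode]
  case D2 =>
    obtain ⟨⟨h0, h1, h2⟩, hc, -, e1, e2, e3⟩ := h
    simp [h0, h1, h2, hc, e1, e2, e3, typeCode]
  all_goals
    obtain ⟨⟨h0, h1, h2⟩, hc, e1, e2, e3⟩ := h
    simp [h0, h1, h2, hc, e1, e2, e3, n2, typeCode]

theorem IsOfType.unique {τ τ' : VertexCausalType} (h : t.IsOfType τ) (h' : t.IsOfType τ') :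
    τ = τ' :=
  typeCode_injective (h.invariant_eq.symm.trans h'.invariant_eq)

theorem existsUnique_isOfType (t : Tetrahedron) : ∃! τ, t.IsOfType τ := by
  obtain ⟨τ, h⟩ := t.exists_isOfType
  exact ⟨τ, h, fun τ' h' => h'.unique h⟩

theorem units_mul_mul_self (δ ε : ℤˣ) : δ * (δ * ε) = ε := by
  rw [← mul_assoc, Int.units_mul_self, one_mul]

/-- The counts see neither the names of the vertices nor the time orientation. -/
theorem SamePattern.invariant_eq {σ : Equiv.Perm (Fin 3)} {δ : ℤˣ} (H : SamePattern σ δ t t') :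
    t.invariant = t'.invariant := by
  have hcones : t'.cones = (fun ε => δ * ε) '' t.cones := by
    rw [← interiorCones_eq_cones, ← interiorCones_eq_cones]
    ext ε
    constructor
    · intro h
      exact ⟨δ * ε, (H.interior_iff _).2 (by rwa [units_mul_mul_self]), units_mul_mul_self δ ε⟩
    · rintro ⟨η, h, rfl⟩
      exact (H.interior_iff η).1 h
  have hedge : ∀ i j, (t.edgeCones i j).Nonempty ↔ (t'.edgeCones (σ i) (σ j)).Nonempty := by
    intro i j
    rcases eq_or_ne i j with rfl | hij
    · simp [edgeCones_self]
    · constructor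
      · rintro ⟨ε, h⟩
        exact ⟨_, (H.edge_iff i j hij ε).1 h⟩
      · rintro ⟨ε, h⟩
        exact ⟨δ * ε, (H.edge_iff i j hij _).2 (by rwa [units_mul_mul_self])⟩
  unfold invariant
  rw [hcones, ncard_image_of_injective _ (mul_right_injective δ)]
  congr 1
  · simp only [H.spacelike_iff]
    exact Equiv.sum_comp σ fun i => truthCount (t'.v i ∈ spacelike)
  · congr 1
    simp only [hedge]
    rw [← Equiv.sum_comp σ (fun i => ∑ j, truthCount (t'.edgeCones i j).Nonempty)]
    exact Finset.sum_congr rfl fun i _ =>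
      Equiv.sum_comp σ (fun j => truthCount (t'.edgeCones (σ i) j).Nonempty)

theorem samePattern_of_match {σ ρ : Equiv.Perm (Fin 3)} {δ : ℤˣ}
    (hv : ∀ m, SameCharacter δ (t.v (σ m)) (t'.v (ρ m)))
    (hc : t'.cones = (fun ε => δ * ε) '' t.cones)
    (h01 : t'.edgeCones (ρ 0) (ρ 1) = (fun ε => δ * ε) '' t.edgeCones (σ 0) (σ 1))
    (h02 : t'.edgeCones (ρ 0) (ρ 2) = (fun ε => δ * ε) '' t.edgeCones (σ 0) (σ 2))
    (h12 : t'.edgeCones (ρ 1) (ρ 2) = (fun ε => δ * ε) '' t.edgeCones (σ 1) (σ 2)) :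
    SamePattern (σ.symm.trans ρ) δ t t' := by
  have himg : ∀ {S : Set ℤˣ} {ε : ℤˣ}, δ * ε ∈ (fun ε => δ * ε) '' S ↔ ε ∈ S :=
    (mul_right_injective δ).mem_set_image
  have hmn : ∀ m n, m ≠ n →
      t'.edgeCones (ρ m) (ρ n) = (fun ε => δ * ε) '' t.edgeCones (σ m) (σ n) :=
    forall_edge (a := 0) (b := 1) (c := 2) (by decide) (by decide) (by decide)
      (fun m n h => by rw [edgeCones_comm t', edgeCones_comm t, h]) h01 h02 h12
  refine ⟨fun i => ?_, fun i => ?_, fun i j hij ε => ?_, fun ε => ?_⟩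
  · obtain ⟨m, rfl⟩ := σ.surjective i
    simpa using (hv m).timelike
  · obtain ⟨m, rfl⟩ := σ.surjective i
    simpa using (hv m).spacelike
  · obtain ⟨m, rfl⟩ := σ.surjective i
    obtain ⟨n, rfl⟩ := σ.surjective j
    simp only [Equiv.trans_apply, Equiv.symm_apply_apply]
    rw [hmn m n (fun h => hij (h ▸ rfl)), himg]
  · rw [interiorCones_eq_cones, interiorCones_eq_cones, hc, himg]

/-- Once names and time direction are fixed, a type determines the whole pattern. It remains to
match the two namings and the two time directions. -/
theorem IsOfType.exists_samePattern {τ : VertexCausalType} (h : t.IsOfType τ)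
    (h' : t'.IsOfType τ) : ∃ σ δ, SamePattern σ δ t t' := by
  obtain ⟨σ, ε, h⟩ := h
  obtain ⟨ρ, η, h'⟩ := h'
  obtain ⟨δ, rfl⟩ : ∃ δ, η = δ * ε := ⟨η * ε, by rw [mul_assoc, Int.units_mul_self, mul_one]⟩
  have e : -(δ * ε) = δ * -ε := by simp
  refine ⟨_, δ, samePattern_of_match (σ := σ) (ρ := ρ) ?_ ?_ ?_ ?_ ?_⟩
  · have htt : ∀ {x x' : Minkowski} {η : ℤˣ}, x ∈ timelike η → x' ∈ timelike (δ * η) →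
        SameCharacter δ x x' := SameCharacter.of_timelike
    have hss : ∀ {x x' : Minkowski}, x ∈ spacelike → x' ∈ spacelike → SameCharacter δ x x' :=
      SameCharacter.of_spacelike
    have hall : ∀ {P : Fin 3 → Prop}, P 0 → P 1 → P 2 → ∀ m, P m := by
      intro P h0 h1 h2 m
      fin_cases m <;> assumption
    cases τ
    all_goals
      obtain ⟨⟨a0, a1, a2⟩, -⟩ := h
      obtain ⟨⟨b0, b1, b2⟩, -⟩ := h'
      try rw [e] at b1
      try rw [e] at b2
      apply hall
      all_goals first | exact htt ‹_› ‹_› | exact hss ‹_› ‹_›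
  all_goals
    cases τ
    case A1 =>
      simp [h.2, h'.2, edgeCones_eq_empty h.2, edgeCones_eq_empty h'.2]
    case D1 =>
      simp [h.2, h'.2, edgeCones_eq_empty h.2, edgeCones_eq_empty h'.2]
    case C2 =>
      obtain ⟨-, c, e1, e2, e3, -⟩ := h
      obtain ⟨-, c', e1', e2', e3', -⟩ := h'
      simp [c, c', e1, e2, e3, e1', e2', e3']
    case D2 =>
      obtain ⟨-, c, -, e1, e2, e3⟩ := h
      obtain ⟨-, c', -, e1', e2', e3'⟩ := h'
      simp [c, c', e1, e2, e3, e1', e2', e3']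
    all_goals
      obtain ⟨-, c, e1, e2, e3⟩ := h
      obtain ⟨-, c', e1', e2', e3'⟩ := h'
      simp [c, c', e1, e2, e3, e1', e2', e3', image_pair]

theorem sameStructure_iff :
    SameStructure t t' ↔ ∃ τ, t.IsOfType τ ∧ t'.IsOfType τ := by
  constructor
  · rintro ⟨σ, δ, H⟩
    obtain ⟨τ, h⟩ := t.exists_isOfType
    obtain ⟨τ', h'⟩ := t'.exists_isOfType
    have := typeCode_injective
      (h.invariant_eq.symm.trans (H.samePattern.invariant_eq.trans h'.invariant_eq))
    exact ⟨τ, h, this ▸ h'⟩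
  · rintro ⟨τ, h, h'⟩
    obtain ⟨σ, δ, H⟩ := h.exists_samePattern h'
    exact ⟨σ, δ, H.sameStructureVia⟩

end Tetrahedron

/-! ### The number of causal structures. -/

/-- The types in the order of their names. -/
noncomputable def typeEquivFin : Fin 13 ≃ VertexCausalType :=
  Equiv.ofBijective ![.A1, .A2, .B1, .B2, .C1, .C2, .C3, .D1, .D2, .D3, .D4, .D5, .D6] (by
    constructor
    · intro i j h
      have := congrArg Tetrahedron.typeCode h
      revert this
      clear h
      revert i j
      decide
    · intro τ
      cases τ
      exacts [⟨0, rfl⟩, ⟨1, rfl⟩, ⟨2, rfl⟩, ⟨3, rfl⟩, ⟨4, rfl⟩, ⟨5, rfl⟩, ⟨6, rfl⟩, ⟨7, rfl⟩,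
        ⟨8, rfl⟩, ⟨9, rfl⟩, ⟨10, rfl⟩, ⟨11, rfl⟩, ⟨12, rfl⟩])

theorem natCard_vertexCausalType : Nat.card VertexCausalType = 13 := by
  rw [← Nat.card_congr typeEquivFin, Nat.card_fin]

theorem natCard_quotient (hex : ∀ τ, ∃ t : Tetrahedron, t.IsOfType τ) :
    Nat.card (Quotient Tetrahedron.structureSetoid) = 13 := by
  choose f hf using hex
  rw [← natCard_vertexCausalType]
  symm
  refine Nat.card_congr (Equiv.ofBijective
    (fun τ => Quotient.mk Tetrahedron.structureSetoid (f τ)) ⟨fun τ τ' h => ?_, fun q => ?_⟩)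
  · obtain ⟨τ'', h1, h2⟩ := Tetrahedron.sameStructure_iff.1 (Quotient.exact h)
    rw [(hf τ).unique h1, (hf τ').unique h2]
  · induction q using Quotient.inductionOn with
    | h t =>
      obtain ⟨τ, h⟩ := t.exists_isOfType
      exact ⟨τ, Quotient.sound (Tetrahedron.sameStructure_iff.2 ⟨τ, hf τ, h⟩)⟩

/-! ### Explicit tetrahedra of every type. -/

theorem not_isNullSubspace_span_pair {u w : Minkowski}
    (h : mink u u * mink w w - mink u w ^ 2 ≠ 0) :
    ¬ IsNullSubspace (Submodule.span ℝ {u, w}) := by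
  rintro ⟨x, hx, hx0, hall⟩
  obtain ⟨a, b, rfl⟩ := Submodule.mem_span_pair.1 hx
  have h1 := hall u (Submodule.subset_span (by simp))
  have h2 := hall w (Submodule.subset_span (by simp))
  rw [mink_add_left, mink_smul_left, mink_smul_left] at h1 h2
  rw [mink_comm w u] at h1
  -- Cramer's rule for the Gram matrix.
  have ha : a * (mink u u * mink w w - mink u w ^ 2) = 0 := by
    linear_combination mink w w * h1 - mink u w * h2
  have hb : b * (mink u u * mink w w - mink u w ^ 2) = 0 := by
    linear_combination mink u u * h2 - mink u w * h1
  rw [mul_eq_zero, or_iff_left h] at ha hb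
  simp [ha, hb] at hx0

theorem vectorSpan_triple (x y z : Minkowski) :
    vectorSpan ℝ {x, y, z} = Submodule.span ℝ {y - x, z - x} := by
  rw [vectorSpan_eq_span_vsub_set_right ℝ (p := x) (by simp)]
  simp [image_insert_eq, Submodule.span_insert_zero]

theorem mink_vec (a b c x y z : ℝ) : mink ![a, b, c] ![x, y, z] = -(a * x) + b * y + c * z := rfl

/-- All nondegeneracy conditions become nonvanishing of numbers: a determinant, six square norms and
four Gram determinants. -/
theorem exists_tetrahedron (p q r : Minkowski)
    (hdet : Matrix.det !![p 0, p 1, p 2; q 0, q 1, q 2; r 0, r 1, r 2] ≠ 0)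
    (hedge : mink p p ≠ 0 ∧ mink q q ≠ 0 ∧ mink r r ≠ 0 ∧ mink (q - p) (q - p) ≠ 0 ∧
      mink (r - p) (r - p) ≠ 0 ∧ mink (r - q) (r - q) ≠ 0)
    (hface : mink p p * mink q q - mink p q ^ 2 ≠ 0 ∧ mink p p * mink r r - mink p r ^ 2 ≠ 0 ∧
      mink q q * mink r r - mink q r ^ 2 ≠ 0 ∧
      mink (q - p) (q - p) * mink (r - p) (r - p) - mink (q - p) (r - p) ^ 2 ≠ 0) :
    ∃ t : Tetrahedron, t.v 0 = p ∧ t.v 1 = q ∧ t.v 2 = r := by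
  obtain ⟨hp, hq, hr, hpq, hpr, hqr⟩ := hedge
  obtain ⟨fpq, fpr, fqr, fpqr⟩ := hface
  have hli : LinearIndependent ℝ ![p, q, r] := by
    have h := Matrix.linearIndependent_rows_of_det_ne_zero hdet
    have e : ![p, q, r] =
        fun i => !![p 0, p 1, p 2; q 0, q 1, q 2; r 0, r 1, r 2] i := by
      ext i j
      fin_cases i <;> fin_cases j <;> rfl
    rw [e]
    exact h
  have haff : AffineIndependent ℝ ![0, p, q, r] := by
    rw [affineIndependent_iff_linearIndependent_vsub ℝ _ 0]
    refine (linearIndependent_equiv' (finSuccAboveEquiv (0 : Fin 4)) ?_).1 hli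
    ext i j
    fin_cases i <;> simp [finSuccAboveEquiv_apply]
  have hneg : ∀ x y : Minkowski, mink (x - y) (x - y) = mink (y - x) (y - x) := by
    intro x y
    rw [← neg_sub y x, mink_neg_left, mink_neg_right, neg_neg]
  have hcard : ∀ s : Finset (Fin 4), s.card = 3 →
      s = {0, 1, 2} ∨ s = {0, 1, 3} ∨ s = {0, 2, 3} ∨ s = {1, 2, 3} := by decide
  refine ⟨⟨![0, p, q, r], haff, rfl, ?_, ?_⟩, rfl, rfl, rfl⟩
  · intro i j hij
    fin_cases i <;> fin_cases j <;> first | exact absurd rfl hij | skip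
    all_goals simp only [Fin.zero_eta, Fin.mk_one, Fin.reduceFinMk, Matrix.cons_val, zero_sub,
      sub_zero, mink_neg_left, mink_neg_right, neg_neg]
    all_goals first | assumption | (rw [hneg]; assumption)
  · intro s hs
    rcases hcard s hs with rfl | rfl | rfl | rfl
    all_goals
      simp only [Finset.coe_insert, Finset.coe_singleton, image_insert_eq, image_singleton,
        Matrix.cons_val]
      rw [vectorSpan_triple]
      apply not_isNullSubspace_span_pair
      simpa only [sub_zero]

namespace Tetrahedron

variable {t : Tetrahedron}

/-- The form is positive definite on the plane of the two vertices; the computation completes the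
square. -/
theorem edgeCones_eq_empty_of_gram {i j : Fin 3} (hi : t.v i ∈ spacelike)
    (h : 0 < mink (t.v i) (t.v i) * mink (t.v j) (t.v j) - mink (t.v i) (t.v j) ^ 2) :
    t.edgeCones i j = ∅ := by
  ext ε
  simp only [mem_empty_iff_false, iff_false, mem_edgeCones]
  rintro ⟨a, b, ha, hb, hx, -⟩
  have hi' : 0 < mink (t.v i) (t.v i) := hi
  rw [mink_add_left, mink_add_right, mink_add_right] at hx
  simp only [mink_smul_left, mink_smul_right] at hx
  rw [mink_comm (t.v j) (t.v i)] at hx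
  have e : (a * mink (t.v i) (t.v i) + b * mink (t.v i) (t.v j)) ^ 2 +
      b ^ 2 * (mink (t.v i) (t.v i) * mink (t.v j) (t.v j) - mink (t.v i) (t.v j) ^ 2) = 0 := by
    linear_combination mink (t.v i) (t.v i) * hx
  have : 0 < b ^ 2 * (mink (t.v i) (t.v i) * mink (t.v j) (t.v j) - mink (t.v i) (t.v j) ^ 2) := by
    positivity
  linarith [sq_nonneg (a * mink (t.v i) (t.v i) + b * mink (t.v i) (t.v j))]

theorem mem_edgeCones_of_add {i j : Fin 3} {ε : ℤˣ} (hij : i ≠ j) (hj : t.v j ∈ spacelike)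
    (h : t.v i + t.v j ∈ timelike ε) : ε ∈ t.edgeCones i j :=
  (mem_edgeCones_iff hij).2 ⟨meetsTimelike_pair_of_nonneg zero_le_one zero_le_one
    (by simpa using h), fun h' => spacelike_not_timelike hj h'.2⟩

theorem forall_three {P : Fin 3 → Prop} (h0 : P 0) (h1 : P 1) (h2 : P 2) (i : Fin 3) : P i := by
  fin_cases i <;> assumption

theorem cones_eq_empty_of_mink_nonneg (h : ∀ i j, 0 ≤ mink (t.v i) (t.v j)) : t.cones = ∅ := by
  ext ε
  simp only [mem_empty_iff_false, iff_false]
  intro hε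
  obtain ⟨⟨a, ha, hx, -⟩, -⟩ := mem_cones_iff.1 hε
  rw [Fintype.linearCombination_apply, Fin.sum_univ_three] at hx
  simp only [mink_add_left, mink_add_right, mink_smul_left, mink_smul_right] at hx
  have hpos : ∀ i j, 0 ≤ a i * (a j * mink (t.v i) (t.v j)) := fun i j =>
    mul_nonneg (ha i).le (mul_nonneg (ha j).le (h i j))
  linarith [hpos 0 0, hpos 0 1, hpos 0 2, hpos 1 0, hpos 1 1, hpos 1 2, hpos 2 0, hpos 2 1,
    hpos 2 2]

end Tetrahedron

theorem timelike_vec {ε : ℤˣ} {a b c : ℝ} :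
    ![a, b, c] ∈ timelike ε ↔ -(a * a) + b * b + c * c < 0 ∧ 0 < ((ε : ℤ) : ℝ) * a := Iff.rfl

theorem spacelike_vec {a b c : ℝ} :
    ![a, b, c] ∈ spacelike ↔ 0 < -(a * a) + b * b + c * c := Iff.rfl

theorem vec_sub (a b c x y z : ℝ) : ![a, b, c] - ![x, y, z] = ![a - x, b - y, c - z] := by simp

theorem vec_add (a b c x y z : ℝ) : ![a, b, c] + ![x, y, z] = ![a + x, b + y, c + z] := by simp

open Tetrahedron in
-- Where an edge between spacelike vertices must meet a lightcone, the vectors are chosen with a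
-- timelike sum; where it must not, with positive Gram determinant. For D1 all pairwise products are
-- nonnegative.
theorem exists_tetrahedron_of_type (τ : VertexCausalType) : ∃ t : Tetrahedron, t.IsOfType τ := by
  have h01 : (0 : Fin 3) ≠ 1 := by decide
  have h02 : (0 : Fin 3) ≠ 2 := by decide
  have h12 : (1 : Fin 3) ≠ 2 := by decide
  cases τ
  case A1 =>
    obtain ⟨t, h0, h1, h2⟩ := exists_tetrahedron ![2, 0, 1] ![2, 1, 0] ![2, 0, 0]
      (by simp [Matrix.det_fin_three])
      (by simp only [mink_vec, vec_sub]; norm_num) (by simp only [mink_vec, vec_sub]; norm_num)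
    refine ⟨t, isOfType_A1 (ε := 1) (forall_three ?_ ?_ ?_)⟩
    all_goals norm_num [h0, h1, h2, timelike_vec, spacelike_vec, vec_add, mink_vec]
  case A2 =>
    obtain ⟨t, h0, h1, h2⟩ := exists_tetrahedron ![2, 1, 0] ![2, 0, -1] ![-1, 0, 0]
      (by simp [Matrix.det_fin_three])
      (by simp only [mink_vec, vec_sub]; norm_num) (by simp only [mink_vec, vec_sub]; norm_num)
    refine ⟨t, isOfType_A2 (ε := 1) h01 h02 h12 ?_ ?_ ?_⟩
    all_goals norm_num [h0, h1, h2, timelike_vec, spacelike_vec, vec_add, mink_vec]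
  case B1 =>
    obtain ⟨t, h0, h1, h2⟩ := exists_tetrahedron ![2, 0, 0] ![2, 0, 1] ![0, -1, 0]
      (by simp [Matrix.det_fin_three])
      (by simp only [mink_vec, vec_sub]; norm_num) (by simp only [mink_vec, vec_sub]; norm_num)
    refine ⟨t, isOfType_B1 (ε := 1) h01 h02 h12 ?_ ?_ ?_⟩
    all_goals norm_num [h0, h1, h2, timelike_vec, spacelike_vec, vec_add, mink_vec]
  case B2 =>
    obtain ⟨t, h0, h1, h2⟩ := exists_tetrahedron ![2, 1, 0] ![-2, 0, 0] ![0, 0, -1]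
      (by simp [Matrix.det_fin_three])
      (by simp only [mink_vec, vec_sub]; norm_num) (by simp only [mink_vec, vec_sub]; norm_num)
    refine ⟨t, isOfType_B2 (ε := 1) h01 h02 h12 ?_ ?_ ?_⟩
    all_goals norm_num [h0, h1, h2, timelike_vec, spacelike_vec, vec_add, mink_vec]
  case C1 =>
    obtain ⟨t, h0, h1, h2⟩ := exists_tetrahedron ![1, 0, 0] ![0, 0, -2] ![0, -1, 1]
      (by simp [Matrix.det_fin_three])
      (by simp only [mink_vec, vec_sub]; norm_num) (by simp only [mink_vec, vec_sub]; norm_num)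
    refine ⟨t, isOfType_C1 (ε := 1) h01 h02 h12 ?_ ?_ ?_
      (edgeCones_eq_empty_of_gram ?_ ?_)⟩
    all_goals norm_num [h0, h1, h2, timelike_vec, spacelike_vec, vec_add, mink_vec]
  case C2 =>
    obtain ⟨t, h0, h1, h2⟩ := exists_tetrahedron ![2, 0, 0] ![2, -2, 1] ![0, 1, 0]
      (by simp [Matrix.det_fin_three])
      (by simp only [mink_vec, vec_sub]; norm_num) (by simp only [mink_vec, vec_sub]; norm_num)
    refine ⟨t, isOfType_C2 (ε := 1) h01 h02 h12 ?_ ?_ ?_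
      (mem_edgeCones_of_add h12 ?_ ?_)⟩
    all_goals norm_num [h0, h1, h2, timelike_vec, spacelike_vec, vec_add, mink_vec]
  case C3 =>
    obtain ⟨t, h0, h1, h2⟩ := exists_tetrahedron ![2, 0, 1] ![0, 1, 1] ![-1, -1, -1]
      (by simp [Matrix.det_fin_three])
      (by simp only [mink_vec, vec_sub]; norm_num) (by simp only [mink_vec, vec_sub]; norm_num)
    refine ⟨t, isOfType_C3 (ε := 1) h01 h02 h12 ?_ ?_ ?_
      (mem_edgeCones_of_add h12 ?_ ?_)⟩
    all_goals norm_num [h0, h1, h2, timelike_vec, spacelike_vec, vec_add, mink_vec]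
  case D1 =>
    obtain ⟨t, h0, h1, h2⟩ := exists_tetrahedron ![-1, 0, -2] ![0, -1, 0] ![0, -2, -1]
      (by simp [Matrix.det_fin_three])
      (by simp only [mink_vec, vec_sub]; norm_num) (by simp only [mink_vec, vec_sub]; norm_num)
    have hs : ∀ i, t.v i ∈ spacelike := forall_three (by norm_num [h0, spacelike_vec])
      (by norm_num [h1, spacelike_vec]) (by norm_num [h2, spacelike_vec])
    refine ⟨t, isOfType_D1 hs (cones_eq_empty_of_mink_nonneg ?_)⟩
    refine forall_three (forall_three ?_ ?_ ?_) (forall_three ?_ ?_ ?_) (forall_three ?_ ?_ ?_)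
    all_goals norm_num [h0, h1, h2, timelike_vec, vec_add, mink_vec]
  case D2 =>
    -- The three vectors add up to the timelike vector (1, 0, 0), although the form is positive
    -- definite on the plane of every pair.
    obtain ⟨t, h0, h1, h2⟩ := exists_tetrahedron ![1, -2, 0] ![0, 1, 1] ![0, 1, -1]
      (by simp [Matrix.det_fin_three]; norm_num)
      (by simp only [mink_vec, vec_sub]; norm_num) (by simp only [mink_vec, vec_sub]; norm_num)
    have hs : ∀ i, t.v i ∈ spacelike := forall_three (by norm_num [h0, spacelike_vec])
      (by norm_num [h1, spacelike_vec]) (by norm_num [h2, spacelike_vec])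
    refine ⟨t, isOfType_D2 (ε := 1) hs (forall_edge h01 h02 h12
      (P := fun i j => t.edgeCones i j = ∅) (fun i j h => by rwa [edgeCones_comm])
      (edgeCones_eq_empty_of_gram (hs _) ?_) (edgeCones_eq_empty_of_gram (hs _) ?_)
      (edgeCones_eq_empty_of_gram (hs _) ?_))
      (mem_cones_iff.2 ⟨.of_nonneg (a := 1) (fun _ => zero_le_one) ?_, 0,
        spacelike_not_timelike (hs 0)⟩)⟩
    case refine_4 =>
      rw [Fintype.linearCombination_apply, Fin.sum_univ_three]
      norm_num [h0, h1, h2, timelike_vec, vec_add]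
    all_goals norm_num [h0, h1, h2, timelike_vec, vec_add, mink_vec]
  case D3 =>
    obtain ⟨t, h0, h1, h2⟩ := exists_tetrahedron ![0, 0, -1] ![0, 2, 1] ![1, -2, -1]
      (by simp [Matrix.det_fin_three])
      (by simp only [mink_vec, vec_sub]; norm_num) (by simp only [mink_vec, vec_sub]; norm_num)
    have hs : ∀ i, t.v i ∈ spacelike := forall_three (by norm_num [h0, spacelike_vec])
      (by norm_num [h1, spacelike_vec]) (by norm_num [h2, spacelike_vec])
    refine ⟨t, isOfType_D3 (ε := 1) h01 h02 h12 hs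
      (edgeCones_eq_empty_of_gram (hs _) ?_) (edgeCones_eq_empty_of_gram (hs _) ?_)
      (edgeCones_eq_singleton h12 (hs _) (mem_edgeCones_of_add h12 (hs _) ?_))⟩
    all_goals norm_num [h0, h1, h2, timelike_vec, vec_add, mink_vec]
  case D4 =>
    obtain ⟨t, h0, h1, h2⟩ := exists_tetrahedron ![1, 0, 2] ![0, -1, 1] ![1, 1, -1]
      (by simp [Matrix.det_fin_three])
      (by simp only [mink_vec, vec_sub]; norm_num) (by simp only [mink_vec, vec_sub]; norm_num)
    have hs : ∀ i, t.v i ∈ spacelike := forall_three (by norm_num [h0, spacelike_vec])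
      (by norm_num [h1, spacelike_vec]) (by norm_num [h2, spacelike_vec])
    refine ⟨t, isOfType_D4 (ε := 1) h01 h02 h12 hs
      (edgeCones_eq_empty_of_gram (hs _) ?_)
      (edgeCones_eq_singleton h02 (hs _) (mem_edgeCones_of_add h02 (hs _) ?_))
      (edgeCones_eq_singleton h12 (hs _) (mem_edgeCones_of_add h12 (hs _) ?_))⟩
    all_goals norm_num [h0, h1, h2, timelike_vec, vec_add, mink_vec]
  case D5 =>
    obtain ⟨t, h0, h1, h2⟩ := exists_tetrahedron ![1, 1, 1] ![1, -2, 0] ![2, 1, -2]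
      (by simp [Matrix.det_fin_three]; norm_num)
      (by simp only [mink_vec, vec_sub]; norm_num) (by simp only [mink_vec, vec_sub]; norm_num)
    have hs : ∀ i, t.v i ∈ spacelike := forall_three (by norm_num [h0, spacelike_vec])
      (by norm_num [h1, spacelike_vec]) (by norm_num [h2, spacelike_vec])
    refine ⟨t, isOfType_D5 (ε := 1) h01 h02 h12 hs
      (edgeCones_eq_singleton h01 (hs _) (mem_edgeCones_of_add h01 (hs _) ?_))
      (edgeCones_eq_singleton h02 (hs _) (mem_edgeCones_of_add h02 (hs _) ?_))
      (edgeCones_eq_singleton h12 (hs _) (mem_edgeCones_of_add h12 (hs _) ?_))⟩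
    all_goals norm_num [h0, h1, h2, timelike_vec, vec_add, mink_vec]
  case D6 =>
    obtain ⟨t, h0, h1, h2⟩ := exists_tetrahedron ![0, 1, -1] ![1, -1, 1] ![-2, -2, 1]
      (by simp [Matrix.det_fin_three]; norm_num)
      (by simp only [mink_vec, vec_sub]; norm_num) (by simp only [mink_vec, vec_sub]; norm_num)
    have hs : ∀ i, t.v i ∈ spacelike := forall_three (by norm_num [h0, spacelike_vec])
      (by norm_num [h1, spacelike_vec]) (by norm_num [h2, spacelike_vec])
    refine ⟨t, isOfType_D6 (ε := 1) h01 h02 h12 hs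
      (mem_edgeCones_of_add h01 (hs _) ?_) (mem_edgeCones_of_add h02 (hs _) ?_)⟩
    all_goals norm_num [h0, h1, h2, timelike_vec, vec_add, mink_vec]

end LorentzCausal

theorem proposition2 :
    -- the causal structure is determined by the vertex positions and the intersection pattern
    (∀ (σ : Equiv.Perm (Fin 3)) (δ : ℤˣ) (t t' : LorentzCausal.Tetrahedron),
      LorentzCausal.Tetrahedron.SameStructureVia σ δ t t' ↔
        LorentzCausal.Tetrahedron.SamePattern σ δ t t') ∧
    -- every tetrahedron has exactly one of the types, and every type occurs
    (∀ t : LorentzCausal.Tetrahedron, ∃! τ : LorentzCausal.VertexCausalType, t.IsOfType τ) ∧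
    (∀ τ : LorentzCausal.VertexCausalType, ∃ t : LorentzCausal.Tetrahedron, t.IsOfType τ) ∧
    -- the types are the classes of tetrahedra with the same causal structure
    (∀ t t' : LorentzCausal.Tetrahedron,
      LorentzCausal.Tetrahedron.SameStructure t t' ↔
        ∃ τ : LorentzCausal.VertexCausalType, t.IsOfType τ ∧ t'.IsOfType τ) ∧
    -- there are exactly thirteen causal structures
    Nat.card (Quotient LorentzCausal.Tetrahedron.structureSetoid) = 13 :=
  ⟨fun _ _ _ _ => LorentzCausal.Tetrahedron.sameStructureVia_iff,
    LorentzCausal.Tetrahedron.existsUnique_isOfType, LorentzCausal.exists_tetrahedron_of_type,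
    fun _ _ => LorentzCausal.Tetrahedron.sameStructure_iff,
    LorentzCausal.natCard_quotient LorentzCausal.exists_tetrahedron_of_type⟩
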